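/- **Setting.** Let $\nu\ge 1$, $D\ge 1$ be integers. For finite $\Lambda\subset\mathbb Z^\nu$ let $\mathcal A(\Lambda)=B(\bigotimes_{x\in\Lambda}\mathbb C^D)$, and let $\mathcal A$ be the quasilocal algebra, i.e. the norm closure of $\bigcup_\Lambda\mathcal A(\Lambda)$, with translation automorphisms $\tau_x$, $x\in\mathbb Z^\nu$. A state is a positive normalized linear functional on $\mathcal A$; it is translation invariant if $\omega\circ\tau_x=\omega$ for all $x$. If $\rho_\Lambda$ is the density matrix of $\omega|_{\mathcal A(\Lambda)}$, put $S_\Lambda(\omega)=-\mathrm{Tr}(\rho_\Lambda\log\rho_\Lambda)$; the mean entropy is $s(\omega)=\lim_{\Lambda\nearrow\infty}S_\Lambda(\omega)/|\Lambda|$ (van Hove limit). Let $\Phi$ be a translation-invariant interaction with at most two-body terms: $\Phi(X)=\Phi(X)^*\in\mathcal A(X)$ for finite $X\subset\mathbb Z^\nu$, $\Phi(X+x)=\tau_x(\Phi(X))$, $\Phi(X)=0$ if $|X|>2$; put $H_\Lambda=\sum_{X\subset\Lambda}\Phi(X)$. For a family $(\tau_t)_{t\in\mathbb R}$ of automorphisms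 of $\mathcal A$, a state $\omega$ and a sequence $t_n\to+\infty$, write $\omega_t=\omega\circ\tau_t$ for $t\in\mathbb R$, and $\omega_{\pm\infty}=\lim_n\omega_{\pm t_n}$ (weak-* limit) if this limit exists. * The *modified second law* holds if $T\mapsto s(\omega_T)$ is non-decreasing on the set of those $T\in[-\infty,\infty]$ for which $\omega_T$ exists (so that $s(\omega_{+\infty})$ is its maximum). The *mean entropy is constant in time* if this function is constant. * The motion is *time-reversal invariant* if either $\omega_{-t}=\omega_t$ for all $t$, or there is an antilinear $*$-automorphism $\Theta$ of $\mathcal A$, mapping every $\mathcal A(\Lambda)$ onto itself, such that $\omega_{-t}(A)=\overline{\omega_t(\Theta A)}$ for all $t\in\mathbb R$, $A\in\mathcal A$. A *time-arrow exists* if the motion is not time-reversal invariant. **Proposition.** Suppose that $\|\Phi(\{0,x\})\|<C(1+|x|)^{-\alpha}$ for all $x\in\mathbb Z^\nu$, with constants $C$ and $\alpha>2\nu$. Then there are automorphisms $\tau_t$ of $\mathcal A$, $t\in\mathbb R$, such that $\tau_t(A)=\lim_{\Lambda\nearrow\mathbb Z^\nu}e^{itH_\Lambda}Ae^{-itH_\Lambda}$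 in norm for every local $A$, and for every translation-invariant state $\omega$: 1. for all $t\in\mathbb R$ the mean entropy of $\omega_t$ exists and $s(\omega_t)=s(\omega)$. Moreover, for every sequence $t_n\to+\infty$: 2. the mean entropy of $\omega_T$ exists for every $T\in[-\infty,\infty]$ for which $\omega_T$ exists; 3. if the motion is time-reversal invariant, $\omega_{+\infty}$ exists and $s(\omega_{+\infty})>s(\omega)$, then $\omega_{-\infty}$ exists and $s(\omega_{-\infty})>s(\omega)$; 4. if the modified second law holds, then either the mean entropy is constant in time or a time-arrow exists. -/

import Mathlib

open Filter Topology
open scoped ComplexOrder InnerProductSpace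

noncomputable section

namespace SpinSystem

/-! ### The quasilocal algebra of a quantum spin system on `ℤ^ν` with single-site space `ℂ^D`

The algebra is realised concretely on `ℓ²` of the set of all classical configurations
`σ : ℤ^ν → {0, …, D-1}`: a matrix `M ∈ 𝒜(Λ) = B(⊗_{x ∈ Λ} ℂ^D)` acts on the coordinates of `σ`
in `Λ` and leaves the others untouched.  This is a faithful `*`-representation of every local
algebra, so that the norm closure of the union is the (unique) quasilocal `C*`-algebra. -/

/-- Lattice sites, `ℤ^ν`. -/
abbrev Site (ν : ℕ) : Type := Fin ν → ℤ

/-- Classical configurations, labelling the product basis. -/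
abbrev Config (ν D : ℕ) : Type := Site ν → Fin D

/-- The Hilbert space `ℓ²(Config)`. -/
abbrev ConfigSpace (ν D : ℕ) : Type := lp (fun _ : Config ν D => ℂ) 2

/-- All bounded operators on `ℓ²(Config)`. -/
abbrev Op (ν D : ℕ) : Type := ConfigSpace ν D →L[ℂ] ConfigSpace ν D

section PartialShift

variable {ι : Type*}

open Classical in
theorem memℓp_partialShift {p : ι → Prop} {g : ι → ι} (hg : Set.InjOn g {i | p i})
    (ψ : lp (fun _ : ι => ℂ) 2) :
    Memℓp (fun i => if p i then ψ (g i) else 0) 2 ∧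
      ∑' i, ‖(if p i then ψ (g i) else (0 : ℂ))‖ ^ (2 : ENNReal).toReal
        ≤ ‖ψ‖ ^ (2 : ENNReal).toReal := by
  have h2 : 0 < (2 : ENNReal).toReal := by norm_num
  have hs : Summable fun i => ‖ψ i‖ ^ (2 : ENNReal).toReal := (lp.memℓp ψ).summable h2
  have hinj : Function.Injective fun i : {i | p i} => g i := fun a b hab =>
    Subtype.ext (hg a.2 b.2 hab)
  have heq : (fun i => ‖(if p i then ψ (g i) else (0 : ℂ))‖ ^ (2 : ENNReal).toReal)
      = Set.indicator {i | p i} (fun i => ‖ψ (g i)‖ ^ (2 : ENNReal).toReal) := by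
    funext i
    by_cases h : p i <;> simp [Set.indicator, h]
  constructor
  · apply memℓp_gen
    rw [heq, ← summable_subtype_iff_indicator]
    exact hs.comp_injective hinj
  · rw [heq, ← tsum_subtype, lp.norm_rpow_eq_tsum h2]
    exact tsum_comp_le_tsum_of_inj hs (fun _ => by positivity) hinj

open Classical in
/-- The operator `(T ψ)(i) = ψ (g i)` if `p i`, and `0` otherwise. -/
def partialShift (p : ι → Prop) (g : ι → ι) (hg : Set.InjOn g {i | p i}) :
    lp (fun _ : ι => ℂ) 2 →L[ℂ] lp (fun _ : ι => ℂ) 2 :=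
  LinearMap.mkContinuous
    { toFun := fun ψ => ⟨fun i => if p i then ψ (g i) else 0, (memℓp_partialShift hg ψ).1⟩
      map_add' := by
        intro ψ φ; ext i
        change (if p i then ψ (g i) + φ (g i) else 0)
          = (if p i then ψ (g i) else 0) + (if p i then φ (g i) else 0)
        by_cases h : p i <;> simp [h]
      map_smul' := by
        intro c ψ; ext i
        by_cases h : p i <;> simp [h] } 1 (by
    intro ψ
    rw [one_mul]
    exact lp.norm_le_of_tsum_le (by norm_num) (norm_nonneg _) (memℓp_partialShift hg ψ).2)

open Classical in
theorem partialShift_apply (p : ι → Prop) (g : ι → ι) (hg : Set.InjOn g {i | p i})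
    (ψ : lp (fun _ : ι => ℂ) 2) (i : ι) :
    partialShift p g hg ψ i = if p i then ψ (g i) else 0 := rfl

theorem partialShift_adjoint (p q : ι → Prop) (g k : ι → ι) (hg : Set.InjOn g {i | p i})
    (hk : Set.InjOn k {i | q i}) (h₁ : ∀ i, p i → q (g i) ∧ k (g i) = i)
    (h₂ : ∀ i, q i → p (k i) ∧ g (k i) = i) :
    star (partialShift p g hg) = partialShift q k hk := by
  classical
  rw [ContinuousLinearMap.star_eq_adjoint]
  symm
  rw [ContinuousLinearMap.eq_adjoint_iff]
  intro ψ φ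
  rw [lp.inner_eq_tsum, lp.inner_eq_tsum]
  simp only [partialShift_apply]
  refine tsum_eq_tsum_of_ne_zero_bij (fun i => g i.1) ?_ ?_ ?_
  · intro a b hab
    have ha : p a.1 := by
      by_contra h
      exact a.2 (by simp [h])
    have hb : p b.1 := by
      by_contra h
      exact b.2 (by simp [h])
    exact Subtype.ext (hg ha hb hab)
  · intro j hj
    have hq : q j := by
      by_contra h
      exact hj (by simp [h])
    refine ⟨⟨k j, ?_⟩, (h₂ j hq).2⟩
    have := h₂ j hq
    simpa [this.1, this.2, hq] using hj
  · intro i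
    have hp : p i.1 := by
      by_contra h
      exact i.2 (by simp [h])
    simp [hp, h₁ i.1 hp]

end PartialShift

variable {ν D : ℕ}

/-- The configuration equal to `η` on `Λ` and to `σ` outside `Λ`. -/
def override (Λ : Finset (Site ν)) (σ : Config ν D) (η : Λ → Fin D) : Config ν D :=
  fun y => if h : y ∈ Λ then η ⟨y, h⟩ else σ y

/-- The restriction of a configuration to `Λ`. -/
def restr (Λ : Finset (Site ν)) (σ : Config ν D) : Λ → Fin D := fun y => σ y

@[simp] theorem restr_override (Λ : Finset (Site ν)) (σ : Config ν D) (η : Λ → Fin D) :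
    restr Λ (override Λ σ η) = η := by
  funext y; simp [restr, override]

@[simp] theorem override_override (Λ : Finset (Site ν)) (σ : Config ν D) (η ζ : Λ → Fin D) :
    override Λ (override Λ σ η) ζ = override Λ σ ζ := by
  funext y; by_cases h : y ∈ Λ <;> simp [override, h]

@[simp] theorem override_restr (Λ : Finset (Site ν)) (σ : Config ν D) :
    override Λ σ (restr Λ σ) = σ := by
  funext y; by_cases h : y ∈ Λ <;> simp [override, restr, h]

theorem override_injOn (Λ : Finset (Site ν)) (ξ η : Λ → Fin D) :
    Set.InjOn (fun σ : Config ν D => override Λ σ η) {σ | restr Λ σ = ξ} := by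
  intro σ hσ τ hτ h
  have h' := congrArg (fun κ => override Λ κ ξ) h
  simp only [override_override] at h'
  have hσ' : restr Λ σ = ξ := hσ
  have hτ' : restr Λ τ = ξ := hτ
  rw [← hσ', override_restr, hσ', ← hτ', override_restr] at h'
  exact h'

/-- The matrix unit `|ξ⟩⟨η|` of `B(⊗_{x ∈ Λ} ℂ^D)`, acting on `ℓ²(Config)`. -/
def matrixUnit (Λ : Finset (Site ν)) (ξ η : Λ → Fin D) : Op ν D :=
  partialShift (fun σ => restr Λ σ = ξ) (fun σ => override Λ σ η) (override_injOn Λ ξ η)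

theorem matrixUnit_apply (Λ : Finset (Site ν)) (ξ η : Λ → Fin D) (ψ : ConfigSpace ν D)
    (σ : Config ν D) :
    matrixUnit Λ ξ η ψ σ = if restr Λ σ = ξ then ψ (override Λ σ η) else 0 := by
  rw [matrixUnit, partialShift_apply]
  congr

theorem star_matrixUnit (Λ : Finset (Site ν)) (ξ η : Λ → Fin D) :
    star (matrixUnit (D := D) Λ ξ η) = matrixUnit Λ η ξ := by
  apply partialShift_adjoint
  · rintro σ rfl; simp
  · rintro σ rfl; simp

/-- The action of a matrix `M ∈ B(⊗_{x ∈ Λ} ℂ^D)` on `ℓ²(Config)`. -/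
def localOp (Λ : Finset (Site ν)) (M : Matrix (Λ → Fin D) (Λ → Fin D) ℂ) : Op ν D :=
  ∑ ξ, ∑ η, M ξ η • matrixUnit Λ ξ η

theorem localOp_apply (Λ : Finset (Site ν)) (M : Matrix (Λ → Fin D) (Λ → Fin D) ℂ)
    (ψ : ConfigSpace ν D) (σ : Config ν D) :
    localOp Λ M ψ σ = ∑ η, M (restr Λ σ) η * ψ (override Λ σ η) := by
  have h : localOp Λ M ψ σ = ∑ ξ, ∑ η, M ξ η * matrixUnit Λ ξ η ψ σ := by
    simp only [localOp, _root_.sum_apply, _root_.smul_apply,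
      lp.coeFn_sum, Finset.sum_apply, lp.coeFn_smul, Pi.smul_apply, smul_eq_mul]
  rw [h, Finset.sum_comm]
  refine Finset.sum_congr rfl fun η _ => ?_
  simp [matrixUnit_apply]

/-- The embedding `B(⊗_{x ∈ Λ} ℂ^D) → B(ℓ²(Config))`. -/
def localEmbed (Λ : Finset (Site ν)) :
    Matrix (Λ → Fin D) (Λ → Fin D) ℂ →⋆ₐ[ℂ] Op ν D where
  toFun := localOp Λ
  map_one' := by
    ext ψ σ
    simp [localOp_apply, Matrix.one_apply]
  map_mul' M N := by
    ext ψ σ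
    rw [mul_apply_eq_comp, localOp_apply, localOp_apply]
    simp only [localOp_apply, restr_override, override_override, Matrix.mul_apply, Finset.sum_mul,
      Finset.mul_sum]
    rw [Finset.sum_comm]
    simp only [mul_assoc]
  map_zero' := by
    ext ψ σ
    simp [localOp_apply]
  map_add' M N := by
    ext ψ σ
    simp [localOp_apply, add_mul, Finset.sum_add_distrib]
  commutes' c := by
    ext ψ σ
    simp [localOp_apply, Algebra.algebraMap_eq_smul_one, Matrix.one_apply]
  map_star' M := by
    simp only [localOp, star_sum, star_smul, star_matrixUnit, Matrix.star_apply]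
    rw [Finset.sum_comm]

/-- The local algebra `𝒜(Λ)`. -/
def localAlg (ν D : ℕ) (Λ : Finset (Site ν)) : StarSubalgebra ℂ (Op ν D) :=
  (localEmbed Λ).range

/-- The quasilocal algebra as a subalgebra of `B(ℓ²(Config))`: the norm closure of the algebra of
all local observables. -/
def quasilocal (ν D : ℕ) : StarSubalgebra ℂ (Op ν D) :=
  (⨆ Λ : Finset (Site ν), localAlg ν D Λ).topologicalClosure

/-- The quasilocal algebra `𝒜`. -/
abbrev QuasilocalAlg (ν D : ℕ) : Type := quasilocal ν D

theorem localAlg_le_quasilocal (Λ : Finset (Site ν)) : localAlg ν D Λ ≤ quasilocal ν D :=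
  (le_iSup (localAlg ν D) Λ).trans (StarSubalgebra.le_topologicalClosure _)

/-- The element of `𝒜(Λ) ⊆ 𝒜` given by a matrix. -/
def localObs (Λ : Finset (Site ν)) (M : Matrix (Λ → Fin D) (Λ → Fin D) ℂ) :
    QuasilocalAlg ν D :=
  ⟨localEmbed Λ M, localAlg_le_quasilocal Λ ⟨M, rfl⟩⟩

/-- `A ∈ 𝒜(Λ)`. -/
def IsLocal (Λ : Finset (Site ν)) (A : QuasilocalAlg ν D) : Prop :=
  (A : Op ν D) ∈ localAlg ν D Λ

/-! ### Lattice translations -/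

/-- The unitary moving every configuration by `x`. -/
def shiftOp (ν D : ℕ) (x : Site ν) : Op ν D :=
  partialShift (fun _ => True) (fun σ y => σ (y + x)) (by
    intro σ _ τ _ h
    funext y
    simpa using congrFun h (y - x))

theorem shiftOp_apply (x : Site ν) (ψ : ConfigSpace ν D) (σ : Config ν D) :
    shiftOp ν D x ψ σ = ψ (fun y => σ (y + x)) := by
  exact (partialShift_apply _ _ _ ψ σ).trans (if_pos trivial)

theorem star_shiftOp (x : Site ν) : star (shiftOp ν D x) = shiftOp ν D (-x) := by
  apply partialShift_adjoint <;> simp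

theorem shiftOp_mul_shiftOp_neg (x : Site ν) : shiftOp ν D x * shiftOp ν D (-x) = 1 := by
  ext ψ σ
  simp [shiftOp_apply]

theorem shiftOp_neg_mul_shiftOp (x : Site ν) : shiftOp ν D (-x) * shiftOp ν D x = 1 := by
  simpa using shiftOp_mul_shiftOp_neg (D := D) (-x)

/-- Conjugation with the shift by `x`. -/
def conjShift (ν D : ℕ) (x : Site ν) : Op ν D →⋆ₐ[ℂ] Op ν D where
  toFun A := shiftOp ν D x * A * shiftOp ν D (-x)
  map_one' := by rw [mul_one, shiftOp_mul_shiftOp_neg]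
  map_mul' A B := by
    calc shiftOp ν D x * (A * B) * shiftOp ν D (-x)
        = shiftOp ν D x * A * 1 * B * shiftOp ν D (-x) := by simp only [mul_one, mul_assoc]
      _ = _ := by rw [← shiftOp_neg_mul_shiftOp x]; simp only [mul_assoc]
  map_zero' := by simp
  map_add' A B := by simp only [mul_add, add_mul]
  commutes' c := by
    rw [← Algebra.commutes, mul_assoc, shiftOp_mul_shiftOp_neg, mul_one]
  map_star' A := by
    simp only [star_mul, star_shiftOp, neg_neg, mul_assoc]

/-- The translate `Λ + x`. -/
def translateSet (x : Site ν) (Λ : Finset (Site ν)) : Finset (Site ν) :=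
  Λ.map (addRightEmbedding x)

theorem conjShift_localEmbed_mem (x : Site ν) (Λ : Finset (Site ν))
    (M : Matrix (Λ → Fin D) (Λ → Fin D) ℂ) :
    conjShift ν D x (localEmbed Λ M) ∈ localAlg ν D (translateSet x Λ) := by
  have hmem : ∀ y : Λ, (y : Site ν) + x ∈ translateSet x Λ := fun y => by
    simp [translateSet]
  have hmem' : ∀ y : translateSet x Λ, (y : Site ν) - x ∈ Λ := fun y => by
    have := y.2
    simp only [translateSet, Finset.mem_map, addRightEmbedding_apply] at this
    obtain ⟨z, hz, hzy⟩ := this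
    rw [← hzy]; simpa using hz
  let e : (translateSet x Λ → Fin D) ≃ (Λ → Fin D) :=
    { toFun := fun η y => η ⟨y + x, hmem y⟩
      invFun := fun η y => η ⟨y - x, hmem' y⟩
      left_inv := fun η => by funext y; simp
      right_inv := fun η => by funext y; simp }
  refine ⟨M.submatrix e e, ?_⟩
  ext ψ σ
  change localOp _ _ ψ σ = shiftOp ν D x (localOp Λ M (shiftOp ν D (-x) ψ)) σ
  rw [shiftOp_apply, localOp_apply, localOp_apply]
  refine Fintype.sum_equiv e _ _ fun η => ?_
  rw [shiftOp_apply]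
  congr 1
  refine congrArg (fun κ : Config ν D => ψ κ) ?_
  funext y
  by_cases h : y + -x ∈ Λ
  · have h' : y ∈ translateSet x Λ := by
      simp only [translateSet, Finset.mem_map, addRightEmbedding_apply]
      exact ⟨_, h, by simp⟩
    simp [override, h, h', e]
  · have h' : y ∉ translateSet x Λ := fun hy => h (by
      simpa [sub_eq_add_neg] using hmem' ⟨y, hy⟩)
    simp [override, h, h']

theorem conjShift_mem (x : Site ν) {A : Op ν D} (hA : A ∈ quasilocal ν D) :
    conjShift ν D x A ∈ quasilocal ν D := by
  have hcont : Continuous (conjShift ν D x) := by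
    change Continuous fun A : Op ν D => shiftOp ν D x * A * shiftOp ν D (-x)
    fun_prop
  have hle : quasilocal ν D ≤ (quasilocal ν D).comap (conjShift ν D x) := by
    refine StarSubalgebra.topologicalClosure_minimal (iSup_le fun Λ => ?_) ?_
    · rintro _ ⟨M, rfl⟩
      exact localAlg_le_quasilocal _ (conjShift_localEmbed_mem x Λ M)
    · exact (StarSubalgebra.isClosed_topologicalClosure _).preimage hcont
  exact hle hA

/-- The translation automorphism `τ_x` of `𝒜`. -/
def translate (ν D : ℕ) (x : Site ν) : QuasilocalAlg ν D →⋆ₐ[ℂ] QuasilocalAlg ν D :=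
  ((conjShift ν D x).comp (quasilocal ν D).subtype).codRestrict (quasilocal ν D)
    fun A => conjShift_mem x A.2

/-! ### States and the mean entropy -/

/-- A state of `𝒜`: a positive normalised linear functional. -/
structure State (ν D : ℕ) where
  /-- the underlying functional -/
  toFun : QuasilocalAlg ν D →ₗ[ℂ] ℂ
  nonneg : ∀ A, 0 ≤ toFun (star A * A)
  normalized : toFun 1 = 1

instance : CoeFun (State ν D) (fun _ => QuasilocalAlg ν D → ℂ) := ⟨fun ω => ω.toFun⟩

/-- `ω ∘ τ_x = ω` for all `x ∈ ℤ^ν`. -/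
def State.IsTranslationInvariant (ω : State ν D) : Prop :=
  ∀ x A, ω (translate ν D x A) = ω A

/-- The state `ω ∘ θ`. -/
def State.comp (ω : State ν D) (θ : QuasilocalAlg ν D ≃⋆ₐ[ℂ] QuasilocalAlg ν D) : State ν D where
  toFun :=
    { toFun := fun A => ω.toFun (θ A)
      map_add' := fun A B => by rw [map_add, map_add]
      map_smul' := fun c A => by rw [map_smul, map_smul, RingHom.id_apply] }
  nonneg A := by
    have := ω.nonneg (θ A)
    have hs : θ (star A) = star (θ A) := θ.map_star' A
    rw [← hs, ← map_mul] at this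
    exact this
  normalized := by
    change ω.toFun (θ 1) = 1
    rw [map_one, ω.normalized]

/-- The density matrix `ρ_Λ` of the restriction of `ω` to `𝒜(Λ)`, so that
`ω(A) = Tr(ρ_Λ A)` for `A ∈ 𝒜(Λ)`. -/
def State.density (ω : State ν D) (Λ : Finset (Site ν)) :
    Matrix (Λ → Fin D) (Λ → Fin D) ℂ :=
  Matrix.of fun ξ η => ω (localObs Λ (Matrix.single η ξ 1))

/-- The von Neumann entropy `-Tr(ρ log ρ)`. -/
def vonNeumannEntropy {n : Type*} [Fintype n] [DecidableEq n] (ρ : Matrix n n ℂ) : ℝ :=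
  (-(ρ * cfc Real.log ρ).trace).re

/-- The entropy `S_Λ(ω)` of the restriction of `ω` to `𝒜(Λ)`. -/
def State.localEntropy (ω : State ν D) (Λ : Finset (Site ν)) : ℝ :=
  vonNeumannEntropy (ω.density Λ)

/-- The cell `∏ᵢ [nᵢ aᵢ, (nᵢ + 1) aᵢ)` of the partition of `ℤ^ν` into boxes of sides `aᵢ`. -/
def cell (a : Fin ν → ℕ) (n : Site ν) : Finset (Site ν) :=
  Fintype.piFinset fun i => Finset.Ico (n i * a i) ((n i + 1) * a i)

/-- The number of cells contained in `Λ`. -/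
def innerCells (a : Fin ν → ℕ) (Λ : Finset (Site ν)) : ℕ :=
  {n : Site ν | cell a n ⊆ Λ}.ncard

/-- The number of cells that meet `Λ`. -/
def outerCells (a : Fin ν → ℕ) (Λ : Finset (Site ν)) : ℕ :=
  {n : Site ν | (cell a n ∩ Λ).Nonempty}.ncard

/-- The filter of convergence of finite regions to infinity in the sense of van Hove: for all box
sides `a`, the number of inner cells tends to infinity, and the ratio of the numbers of inner and
of outer cells tends to one. -/
def vanHove (ν : ℕ) : Filter (Finset (Site ν)) :=
  ⨅ (a : Fin ν → ℕ) (_ : ∀ i, 0 < a i),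
    comap (innerCells a) atTop ⊓
      comap (fun Λ => (innerCells a Λ : ℝ) / (outerCells a Λ : ℝ)) (𝓝 1)

/-- `S_Λ(ω) / |Λ|` converges to `s` in the van Hove limit. -/
def State.HasMeanEntropy (ω : State ν D) (s : ℝ) : Prop :=
  Tendsto (fun Λ => ω.localEntropy Λ / (Λ.card : ℝ)) (vanHove ν) (𝓝 s)

/-- The mean entropy `s(ω)`. -/
def State.meanEntropy (ω : State ν D) : ℝ :=
  limUnder (vanHove ν) fun Λ => ω.localEntropy Λ / (Λ.card : ℝ)

/-! ### Interactions and dynamics -/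

/-- A translation-invariant interaction with at most two-body terms. -/
structure Interaction (ν D : ℕ) where
  /-- the interaction function -/
  toFun : Finset (Site ν) → QuasilocalAlg ν D
  isSelfAdjoint : ∀ X, IsSelfAdjoint (toFun X)
  isLocal : ∀ X, IsLocal X (toFun X)
  translate_eq : ∀ x X, toFun (translateSet x X) = translate ν D x (toFun X)
  two_body : ∀ X, 2 < X.card → toFun X = 0

instance : CoeFun (Interaction ν D) (fun _ => Finset (Site ν) → QuasilocalAlg ν D) :=
  ⟨fun Φ => Φ.toFun⟩

/-- The Hamiltonian `H_Φ(Λ) = ∑_{X ⊆ Λ} Φ(X)`. -/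
def Interaction.hamiltonian (Φ : Interaction ν D) (Λ : Finset (Site ν)) : QuasilocalAlg ν D :=
  ∑ X ∈ Λ.powerset, Φ X

/-- The finite-volume evolution `e^{itH_Λ} A e^{-itH_Λ}`. -/
def Interaction.localEvolution (Φ : Interaction ν D) (Λ : Finset (Site ν)) (t : ℝ)
    (A : QuasilocalAlg ν D) : QuasilocalAlg ν D :=
  NormedSpace.exp ((Complex.I * t) • Φ.hamiltonian Λ) * A *
    NormedSpace.exp ((-(Complex.I * t)) • Φ.hamiltonian Λ)

/-- `τ` is the infinite-volume time evolution of `Φ`: for every local `A`, `τ_t(A)` is the norm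
limit of the finite-volume evolutions as `Λ` increases to `ℤ^ν`.  Since the local observables are
dense, this determines the automorphisms `τ_t`. -/
def Interaction.IsDynamics (Φ : Interaction ν D)
    (τ : ℝ → QuasilocalAlg ν D ≃⋆ₐ[ℂ] QuasilocalAlg ν D) : Prop :=
  ∀ (t : ℝ) (Λ : Finset (Site ν)) (A : QuasilocalAlg ν D), IsLocal Λ A →
    Tendsto (fun Λ' => Φ.localEvolution Λ' t A) atTop (𝓝 (τ t A))

/-- The Euclidean length of a lattice vector. -/
def siteNorm (x : Site ν) : ℝ := Real.sqrt (∑ i, (x i : ℝ) ^ 2)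

/-! ### The second law and time reversal

Below `τ` is a time evolution, `ω` the state at time `0` and `u` a sequence of times tending to
`+∞`, along which the states at infinite time are formed. -/

/-- `φ` is the state at time `T ∈ [-∞, ∞]`: it is `ω_T = ω ∘ τ_T` if `T` is finite, the weak-*
limit of `ω ∘ τ_{u n}` if `T = +∞`, and the weak-* limit of `ω ∘ τ_{-u n}` if `T = -∞`. -/
def IsStateAt (τ : ℝ → QuasilocalAlg ν D ≃⋆ₐ[ℂ] QuasilocalAlg ν D) (ω : State ν D) (u : ℕ → ℝ)
    (T : EReal) (φ : State ν D) : Prop :=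
  (∀ t : ℝ, T = t → φ = ω.comp (τ t)) ∧
  (T = ⊤ → ∀ A, Tendsto (fun n => ω.comp (τ (u n)) A) atTop (𝓝 (φ A))) ∧
  (T = ⊥ → ∀ A, Tendsto (fun n => ω.comp (τ (-u n)) A) atTop (𝓝 (φ A)))

/-- The modified second law: the mean entropy is non-decreasing on the time axis `[-∞, ∞]` (and so
its value at `+∞` is its maximum). -/
def ModifiedSecondLaw (τ : ℝ → QuasilocalAlg ν D ≃⋆ₐ[ℂ] QuasilocalAlg ν D) (ω : State ν D)
    (u : ℕ → ℝ) : Prop :=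
  ∀ T₁ T₂ : EReal, T₁ < T₂ → ∀ φ₁ φ₂ : State ν D,
    IsStateAt τ ω u T₁ φ₁ → IsStateAt τ ω u T₂ φ₂ → φ₁.meanEntropy ≤ φ₂.meanEntropy

/-- The mean entropy is constant on the time axis `[-∞, ∞]`. -/
def MeanEntropyConstant (τ : ℝ → QuasilocalAlg ν D ≃⋆ₐ[ℂ] QuasilocalAlg ν D) (ω : State ν D)
    (u : ℕ → ℝ) : Prop :=
  ∀ T₁ T₂ : EReal, ∀ φ₁ φ₂ : State ν D,
    IsStateAt τ ω u T₁ φ₁ → IsStateAt τ ω u T₂ φ₂ → φ₁.meanEntropy = φ₂.meanEntropy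

/-- A time-reversal operation: an antilinear `*`-automorphism of `𝒜` that maps every local algebra
onto itself. -/
structure TimeReversal (ν D : ℕ) where
  /-- the underlying ring automorphism -/
  toRingEquiv : QuasilocalAlg ν D ≃+* QuasilocalAlg ν D
  map_smul : ∀ (c : ℂ) A, toRingEquiv (c • A) = star c • toRingEquiv A
  map_star : ∀ A, toRingEquiv (star A) = star (toRingEquiv A)
  isLocal_iff : ∀ Λ A, IsLocal Λ (toRingEquiv A) ↔ IsLocal Λ A

/-- The motion `t ↦ ω_t` is invariant under time reversal: either all expectation values
`ω_t(A)` are even functions of `t`, or `ω_{-t}` is for all `t` the image of `ω_t` under some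
time-reversal operation. -/
def TimeReversalInvariant (τ : ℝ → QuasilocalAlg ν D ≃⋆ₐ[ℂ] QuasilocalAlg ν D)
    (ω : State ν D) : Prop :=
  (∀ (t : ℝ) A, ω.comp (τ (-t)) A = ω.comp (τ t) A) ∨
    ∃ Θ : TimeReversal ν D,
      ∀ (t : ℝ) A, ω.comp (τ (-t)) A = star (ω.comp (τ t) (Θ.toRingEquiv A))

/-- A time-arrow exists: the motion is not invariant under time reversal. -/
def TimeArrow (τ : ℝ → QuasilocalAlg ν D ≃⋆ₐ[ℂ] QuasilocalAlg ν D) (ω : State ν D) : Prop :=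
  ¬ TimeReversalInvariant τ ω

end SpinSystem

end

open Filter Topology
open scoped ComplexOrder InnerProductSpace

noncomputable section

namespace SpinSystem

variable {ν D : ℕ}

/-! ### Local observables -/

/-! The entropy of a finite region changes only through the terms of the interaction that cross its
boundary, and in the van Hove limit these are negligible against the volume. Hence the mean entropy
is constant at finite times. It can change only in the limits at infinite times, where it is merely
known to exist, and there time reversal exchanges `+∞` and `-∞`.

Dynamics. The decay makes `∑ₓ ‖Φ {0, x}‖` finite. A commutator with a two-body Hamiltonian enlarges
a support by at most one site, so the Taylor series of the finite-volume evolution of a local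
observable converges geometrically for small times, uniformly in the volume
(`norm_commutator_pow_le`). The group property then reaches all times.

Existence of the mean entropy. Build up a region site by site in lexicographic order and write its
entropy as a sum of conditional entropies. Strong subadditivity makes these decrease as the region
grows, and translation invariance compares them with the conditional entropy at the origin of a
cube; the mean entropy is the infimum over cubes (`hasMeanEntropy_iInf`). Strong subadditivity comes
from monotonicity of the relative entropy (`relativeEntropy_le_of_restrict`), which rests on a
variational formula for the resolvent of the relative modular operator. Limits of
translation-invariant states are translation invariant, so the mean entropy also exists at `±∞`.

Conservation. By Klein's inequality `S_Λ(φ) ≤ -φ(log ρ)` for every faithful density matrix `ρ`, with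
equality when `ρ` is that of `φ`. So the entropy as a function of time is touched from above by
smooth functions with slope `-ω_t(i[H, log ρ_t])`, and a bound on these slopes is a Lipschitz bound.
Terms inside the region or disjoint from it contribute nothing. For a crossing term the commutator
with `log ρ` has an expectation bounded independently of `ρ` (`exists_split_commutator_log`), so the
rate is at most `2 D ^ 3` times the strength of the crossing terms, which is `o(|Λ|)`.

Time reversal. An antilinear automorphism that preserves the local algebras preserves local
entropies. So if the motion is reversible, a limit at `+∞` yields one at `-∞` with the same mean
entropy, and conversely. With `s(ω_{-∞}) ≤ s(ω) ≤ s(ω_{+∞})` from the second law this forces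
equality. -/

instance isClosed_quasilocal : IsClosed (quasilocal ν D : Set (Op ν D)) :=
  StarSubalgebra.isClosed_topologicalClosure _

theorem restr_override_of_disjoint {Λ₁ Λ₂ : Finset (Site ν)} (h : Disjoint Λ₁ Λ₂)
    (σ : Config ν D) (η : Λ₁ → Fin D) : restr Λ₂ (override Λ₁ σ η) = restr Λ₂ σ := by
  funext y
  have : (y : Site ν) ∉ Λ₁ := fun hy => Finset.disjoint_left.1 h hy y.2
  simp [restr, override, this]

theorem override_comm {Λ₁ Λ₂ : Finset (Site ν)} (h : Disjoint Λ₁ Λ₂) (σ : Config ν D)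
    (η : Λ₁ → Fin D) (ζ : Λ₂ → Fin D) :
    override Λ₂ (override Λ₁ σ η) ζ = override Λ₁ (override Λ₂ σ ζ) η := by
  funext y
  by_cases h₁ : y ∈ Λ₁
  · have h₂ : y ∉ Λ₂ := Finset.disjoint_left.1 h h₁
    simp [override, h₁, h₂]
  · simp [override, h₁]

theorem localEmbed_apply (Λ : Finset (Site ν)) (M : Matrix (Λ → Fin D) (Λ → Fin D) ℂ)
    (ψ : ConfigSpace ν D) (σ : Config ν D) :
    localEmbed Λ M ψ σ = ∑ η, M (restr Λ σ) η * ψ (override Λ σ η) :=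
  localOp_apply Λ M ψ σ

theorem commute_localEmbed {Λ₁ Λ₂ : Finset (Site ν)} (h : Disjoint Λ₁ Λ₂)
    (M : Matrix (Λ₁ → Fin D) (Λ₁ → Fin D) ℂ) (N : Matrix (Λ₂ → Fin D) (Λ₂ → Fin D) ℂ) :
    Commute (localEmbed Λ₁ M) (localEmbed Λ₂ N) := by
  ext ψ σ
  rw [mul_apply_eq_comp, mul_apply_eq_comp]
  simp only [localEmbed_apply, restr_override_of_disjoint h, restr_override_of_disjoint h.symm,
    Finset.mul_sum]
  rw [Finset.sum_comm]
  refine Finset.sum_congr rfl fun ζ _ => Finset.sum_congr rfl fun η _ => ?_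
  rw [override_comm h]
  ring

/-- Applied to a basis vector of `ℓ²`, the operator displays a single matrix entry. The symbol `0`,
available because `D ≠ 0`, fills the background outside `Λ`. -/
theorem localEmbed_injective [NeZero D] (Λ : Finset (Site ν)) :
    Function.Injective (localEmbed (D := D) Λ) := by
  classical
  rw [injective_iff_map_eq_zero]
  intro M hM
  ext ξ η
  let σ : Config ν D := override Λ (fun _ => 0) ξ
  have h := localEmbed_apply Λ M (lp.single 2 (override Λ σ η) (1 : ℂ)) σ
  rw [hM] at h
  simp only [lp.single_apply, σ, restr_override, override_override] at h
  rw [Finset.sum_eq_single η] at h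
  · simpa using h.symm
  · intro ζ _ hζ
    have : override Λ (fun _ => (0 : Fin D)) ζ ≠ override Λ (fun _ => 0) η := fun h' => hζ (by
      simpa using congrArg (restr Λ) h')
    simp [this]
  · simp

/-- The configuration on `Λ₁ ∪ Λ₂` equal to `ξ` on `Λ₁` and to `ζ` on the rest of `Λ₂`. -/
def glue {Λ₁ Λ₂ : Finset (Site ν)} (ξ : Λ₁ → Fin D) (ζ : Λ₂ → Fin D) :
    (Λ₁ ∪ Λ₂ : Finset (Site ν)) → Fin D :=
  fun z => if h : (z : Site ν) ∈ Λ₁ then ξ ⟨z, h⟩ else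
    ζ ⟨z, (Finset.mem_union.1 z.2).resolve_left h⟩

/-- Configurations on a disjoint union are pairs of configurations. -/
def glueEquiv {Λ₁ Λ₂ : Finset (Site ν)} (h : Disjoint Λ₁ Λ₂) :
    (Λ₁ → Fin D) × (Λ₂ → Fin D) ≃ ((Λ₁ ∪ Λ₂ : Finset (Site ν)) → Fin D) where
  toFun p := glue p.1 p.2
  invFun η := (fun z => η ⟨z, Finset.mem_union_left _ z.2⟩, fun z => η ⟨z, Finset.mem_union_right _ z.2⟩)
  left_inv p := by
    refine Prod.ext ?_ ?_
    · funext z; simp [glue]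
    · funext z
      have : (z : Site ν) ∉ Λ₁ := Finset.disjoint_right.1 h z.2
      simp [glue, this]
  right_inv η := by
    funext z
    by_cases hz : (z : Site ν) ∈ Λ₁ <;> simp [glue, hz]

theorem glue_restr {Λ₁ Λ₂ : Finset (Site ν)} (σ : Config ν D) :
    glue (restr Λ₁ σ) (restr Λ₂ σ) = restr (Λ₁ ∪ Λ₂) σ := by
  funext z
  by_cases hz : (z : Site ν) ∈ Λ₁ <;> simp [glue, restr, hz]

theorem override_glue {Λ₁ Λ₂ : Finset (Site ν)} (h : Disjoint Λ₁ Λ₂) (σ : Config ν D)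
    (ξ : Λ₁ → Fin D) (ζ : Λ₂ → Fin D) :
    override (Λ₁ ∪ Λ₂) σ (glue ξ ζ) = override Λ₂ (override Λ₁ σ ξ) ζ := by
  funext y
  by_cases h₁ : y ∈ Λ₁
  · have h₂ : y ∉ Λ₂ := Finset.disjoint_left.1 h h₁
    simp [override, glue, h₁, h₂]
  · by_cases h₂ : y ∈ Λ₂ <;> simp [override, glue, h₁, h₂]

theorem localEmbed_single (Λ : Finset (Site ν)) (ξ η : Λ → Fin D) :
    localEmbed Λ (Matrix.single ξ η 1) = matrixUnit Λ ξ η := by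
  ext ψ σ
  rw [localEmbed_apply, matrixUnit_apply, Finset.sum_eq_single η]
  · by_cases h : restr Λ σ = ξ
    · simp [h]
    · simp [h, Ne.symm h]
  · intro ζ _ hζ
    simp [Ne.symm hζ]
  · simp

/-- This is `𝒜(Λ₁ ∪ Λ₂) = 𝒜(Λ₁) ⊗ 𝒜(Λ₂)` in coordinates: the coefficients of the matrix units over
`Λ₂` are the blocks of `M`. It yields isotony, the density matrix of a twirled state and the bound
on crossing commutators. -/
theorem localEmbed_union {Λ₁ Λ₂ : Finset (Site ν)} (h : Disjoint Λ₁ Λ₂)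
    (M : Matrix ((Λ₁ ∪ Λ₂ : Finset (Site ν)) → Fin D) ((Λ₁ ∪ Λ₂ : Finset (Site ν)) → Fin D) ℂ) :
    localEmbed (Λ₁ ∪ Λ₂) M = ∑ c, ∑ d,
      localEmbed Λ₁ (Matrix.of fun ξ η => M (glue ξ c) (glue η d)) *
        localEmbed Λ₂ (Matrix.single c d 1) := by
  ext ψ σ
  have h1 : (∑ c, ∑ d, localEmbed Λ₁ (Matrix.of fun ξ η => M (glue ξ c) (glue η d)) *
        localEmbed Λ₂ (Matrix.single c d 1)) ψ σ = ∑ c, ∑ d,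
        (localEmbed Λ₁ (Matrix.of fun ξ η => M (glue ξ c) (glue η d)) *
        localEmbed Λ₂ (Matrix.single c d 1)) ψ σ := by
    simp only [_root_.sum_apply, lp.coeFn_sum, Finset.sum_apply]
  rw [h1]
  simp only [mul_apply_eq_comp, localEmbed_apply, localEmbed_single, matrixUnit_apply,
    restr_override_of_disjoint h, Matrix.of_apply, mul_ite, mul_zero]
  rw [Finset.sum_comm]
  simp only [Finset.sum_comm (s := (Finset.univ : Finset (Λ₂ → Fin D))) (t := (Finset.univ : Finset (Λ₁ → Fin D)))]
  simp only [Finset.sum_ite_eq, Finset.mem_univ, if_true]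
  rw [← Fintype.sum_prod_type']
  refine (Fintype.sum_equiv (glueEquiv h) _ _ fun p => ?_).symm
  change _ = M (restr (Λ₁ ∪ Λ₂) σ) (glue p.1 p.2) * ψ (override (Λ₁ ∪ Λ₂) σ (glue p.1 p.2))
  rw [override_glue h, glue_restr]

theorem localAlg_mono {Λ Λ' : Finset (Site ν)} (h : Λ ⊆ Λ') : localAlg ν D Λ ≤ localAlg ν D Λ' := by
  classical
  rintro _ ⟨M, rfl⟩
  have hd : Disjoint Λ (Λ' \ Λ) := Finset.disjoint_sdiff
  rw [← Finset.union_sdiff_of_subset h]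
  -- The witness is `M ⊗ 1`.
  refine ⟨Matrix.of fun ξ η => if ((glueEquiv hd).symm ξ).2 = ((glueEquiv hd).symm η).2 then
    M ((glueEquiv hd).symm ξ).1 ((glueEquiv hd).symm η).1 else 0, ?_⟩
  have key : ∀ (ξ : Λ → Fin D) (c : (Λ' \ Λ : Finset (Site ν)) → Fin D),
      (glueEquiv hd).symm (glue ξ c) = (ξ, c) := fun ξ c =>
    (glueEquiv hd).symm_apply_apply (ξ, c)
  change localEmbed _ _ = localEmbed Λ M
  rw [localEmbed_union hd]
  simp only [Matrix.of_apply, key]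
  have : ∀ c : (Λ' \ Λ : Finset (Site ν)) → Fin D, ∑ d, localEmbed Λ (Matrix.of fun ξ η => if c = d then M ξ η else 0) *
      localEmbed (Λ' \ Λ) (Matrix.single c d 1) =
      localEmbed Λ M * localEmbed (Λ' \ Λ) (Matrix.single c c 1) := by
    intro c
    rw [Finset.sum_eq_single c]
    · congr 2
      ext ξ η
      simp
    · intro d _ hd
      have : (Matrix.of fun ξ η => if c = d then M ξ η else 0) = 0 := by
        ext ξ η; simp [Ne.symm hd]
      rw [this, map_zero, zero_mul]
    · simp
  rw [Finset.sum_congr rfl fun c _ => this c, ← Finset.mul_sum, ← map_sum]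
  have h1 : ∑ c : (Λ' \ Λ : Finset (Site ν)) → Fin D, Matrix.single c c (1 : ℂ) = 1 := by
    ext ξ η
    simp [Matrix.sum_apply, Matrix.single_apply, Matrix.one_apply, ite_and]
  rw [h1, map_one, mul_one]

theorem norm_matrixUnit_le (Λ : Finset (Site ν)) (ξ η : Λ → Fin D) :
    ‖matrixUnit (D := D) Λ ξ η‖ ≤ 1 := by
  refine ContinuousLinearMap.opNorm_le_bound _ zero_le_one fun ψ => ?_
  rw [one_mul]
  exact lp.norm_le_of_tsum_le (by norm_num) (norm_nonneg _)
    (memℓp_partialShift (override_injOn Λ ξ η) ψ).2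

instance instFunLikeObs (Λ : Finset (Site ν)) :
    FunLike (Matrix (Λ → Fin D) (Λ → Fin D) ℂ →⋆ₐ[ℂ] QuasilocalAlg ν D)
      (Matrix (Λ → Fin D) (Λ → Fin D) ℂ) (QuasilocalAlg ν D) := StarAlgHom.instFunLike

instance instCoeFunObs (Λ : Finset (Site ν)) :
    CoeFun (Matrix (Λ → Fin D) (Λ → Fin D) ℂ →⋆ₐ[ℂ] QuasilocalAlg ν D)
      (fun _ => Matrix (Λ → Fin D) (Λ → Fin D) ℂ → QuasilocalAlg ν D) := ⟨DFunLike.coe⟩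

/-- The embedding of the matrices over `Λ` into the quasilocal algebra. -/
def obs (Λ : Finset (Site ν)) :
    Matrix (Λ → Fin D) (Λ → Fin D) ℂ →⋆ₐ[ℂ] QuasilocalAlg ν D :=
  (localEmbed Λ).codRestrict (quasilocal ν D) fun M => localAlg_le_quasilocal Λ ⟨M, rfl⟩

theorem obs_injective [NeZero D] (Λ : Finset (Site ν)) : Function.Injective (obs (D := D) Λ) :=
  fun _ _ h => localEmbed_injective Λ (congrArg Subtype.val h)

theorem isLocal_iff {Λ : Finset (Site ν)} {A : QuasilocalAlg ν D} :
    IsLocal Λ A ↔ ∃ M, obs Λ M = A := by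
  constructor
  · rintro ⟨M, hM⟩
    exact ⟨M, Subtype.ext hM⟩
  · rintro ⟨M, rfl⟩
    exact ⟨M, rfl⟩

theorem isLocal_obs (Λ : Finset (Site ν)) (M : Matrix (Λ → Fin D) (Λ → Fin D) ℂ) :
    IsLocal Λ (obs Λ M) := isLocal_iff.2 ⟨M, rfl⟩

theorem IsLocal.mono {Λ Λ' : Finset (Site ν)} (h : Λ ⊆ Λ') {A : QuasilocalAlg ν D}
    (hA : IsLocal Λ A) : IsLocal Λ' A := localAlg_mono h hA

theorem IsLocal.commute {Λ Λ' : Finset (Site ν)} (h : Disjoint Λ Λ') {A B : QuasilocalAlg ν D}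
    (hA : IsLocal Λ A) (hB : IsLocal Λ' B) : Commute A B := by
  obtain ⟨M, rfl⟩ := isLocal_iff.1 hA
  obtain ⟨N, rfl⟩ := isLocal_iff.1 hB
  exact Subtype.ext (commute_localEmbed h M N)

theorem IsLocal.mul {Λ : Finset (Site ν)} {A B : QuasilocalAlg ν D}
    (hA : IsLocal Λ A) (hB : IsLocal Λ B) : IsLocal Λ (A * B) := mul_mem hA hB

theorem IsLocal.sub {Λ : Finset (Site ν)} {A B : QuasilocalAlg ν D}
    (hA : IsLocal Λ A) (hB : IsLocal Λ B) : IsLocal Λ (A - B) := sub_mem hA hB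

theorem norm_obs_single_le (Λ : Finset (Site ν)) (ξ η : Λ → Fin D) :
    ‖obs (D := D) Λ (Matrix.single ξ η 1)‖ ≤ 1 := by
  change ‖localEmbed Λ (Matrix.single ξ η 1)‖ ≤ 1
  rw [localEmbed_single]
  exact norm_matrixUnit_le Λ ξ η

theorem star_obs_single (Λ : Finset (Site ν)) (ξ η : Λ → Fin D) :
    star (obs (D := D) Λ (Matrix.single ξ η 1)) = obs Λ (Matrix.single η ξ 1) := by
  rw [← map_star, Matrix.star_eq_conjTranspose, Matrix.conjTranspose_single, star_one]

theorem obs_union {Λ₁ Λ₂ : Finset (Site ν)} (h : Disjoint Λ₁ Λ₂)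
    (M : Matrix ((Λ₁ ∪ Λ₂ : Finset (Site ν)) → Fin D) ((Λ₁ ∪ Λ₂ : Finset (Site ν)) → Fin D) ℂ) :
    obs (Λ₁ ∪ Λ₂) M = ∑ c, ∑ d,
      obs Λ₁ (Matrix.of fun ξ η => M (glue ξ c) (glue η d)) * obs Λ₂ (Matrix.single c d 1) := by
  apply Subtype.ext
  push_cast
  exact localEmbed_union h M

theorem sum_obs_single (Λ : Finset (Site ν)) :
    ∑ c, obs (D := D) Λ (Matrix.single c c 1) = 1 := by
  rw [← map_sum]
  have h1 : ∑ c : Λ → Fin D, Matrix.single c c (1 : ℂ) = 1 := by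
    ext ξ η
    simp [Matrix.sum_apply, Matrix.single_apply, Matrix.one_apply, ite_and]
  rw [h1, map_one]

theorem dense_isLocal : Dense {A : QuasilocalAlg ν D | ∃ Λ, IsLocal Λ A} := by
  have hdir : Directed (· ≤ ·) (localAlg ν D) := fun Λ Λ' =>
    ⟨Λ ∪ Λ', localAlg_mono Finset.subset_union_left, localAlg_mono Finset.subset_union_right⟩
  intro A
  have hA : (A : Op ν D) ∈ closure ((⨆ Λ : Finset (Site ν), localAlg ν D Λ : StarSubalgebra ℂ (Op ν D)) : Set (Op ν D)) := A.2
  rw [StarSubalgebra.coe_iSup_of_directed hdir] at hA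
  rw [closure_subtype]
  refine closure_mono ?_ hA
  intro B hB
  obtain ⟨Λ, hΛ⟩ := Set.mem_iUnion.1 hB
  exact ⟨⟨B, localAlg_le_quasilocal Λ hΛ⟩, ⟨Λ, hΛ⟩, rfl⟩

/-! ### The von Neumann entropy of matrices -/

section Entropy

variable {n m : Type*} [Fintype n] [DecidableEq n] [Fintype m] [DecidableEq m]

open Matrix

theorem cfc_eq_conj {ρ : Matrix n n ℂ} (hρ : ρ.IsHermitian) (f : ℝ → ℝ) :
    cfc f ρ = (hρ.eigenvectorUnitary : Matrix n n ℂ) *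
      diagonal (fun i => (f (hρ.eigenvalues i) : ℂ)) *
      star (hρ.eigenvectorUnitary : Matrix n n ℂ) := by
  rw [hρ.cfc_eq, Matrix.IsHermitian.cfc, Unitary.conjStarAlgAut_apply]
  rfl

theorem eq_conj_eigenvalues {ρ : Matrix n n ℂ} (hρ : ρ.IsHermitian) :
    ρ = (hρ.eigenvectorUnitary : Matrix n n ℂ) *
      diagonal (fun i => (hρ.eigenvalues i : ℂ)) *
      star (hρ.eigenvectorUnitary : Matrix n n ℂ) := by
  conv_lhs => rw [← cfc_id ℝ ρ hρ.isSelfAdjoint]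
  exact cfc_eq_conj hρ id

theorem trace_mul_cfc {ρ : Matrix n n ℂ} (hρ : ρ.IsHermitian) (f : ℝ → ℝ) (M : Matrix n n ℂ) :
    (M * cfc f ρ).trace = ∑ i, (f (hρ.eigenvalues i) : ℂ) *
      (star (hρ.eigenvectorUnitary : Matrix n n ℂ) * M *
        (hρ.eigenvectorUnitary : Matrix n n ℂ)) i i := by
  rw [cfc_eq_conj hρ, mul_assoc, ← mul_assoc, trace_mul_comm, ← mul_assoc, trace]
  refine Finset.sum_congr rfl fun i _ => ?_
  rw [diag_apply, mul_assoc, mul_assoc, diagonal_mul, ← mul_assoc]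

theorem trace_cfc {ρ : Matrix n n ℂ} (hρ : ρ.IsHermitian) (f : ℝ → ℝ) :
    (cfc f ρ).trace = ∑ i, (f (hρ.eigenvalues i) : ℂ) := by
  have h := trace_mul_cfc hρ f 1
  simpa using h

/-- The spectrum of a matrix is finite, so even `Real.log`, discontinuous at `0`, is admissible in
the functional calculus. -/
theorem continuousOn_spectrum (ρ : Matrix n n ℂ) (f : ℝ → ℝ) :
    ContinuousOn f (spectrum ℝ ρ) := by
  have : (spectrum ℝ ρ).Finite := Matrix.finite_real_spectrum
  exact this.continuousOn f

theorem vonNeumannEntropy_eq_trace {ρ : Matrix n n ℂ} (hρ : ρ.IsHermitian) :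
    vonNeumannEntropy ρ = (cfc Real.negMulLog ρ).trace.re := by
  have h : ρ * cfc Real.log ρ = cfc (fun x => x * Real.log x) ρ := by
    conv_lhs => enter [1]; rw [← cfc_id ℝ ρ hρ.isSelfAdjoint]
    exact (cfc_mul id Real.log ρ (continuousOn_spectrum _ _) (continuousOn_spectrum _ _)).symm
  rw [vonNeumannEntropy, h, ← trace_neg, ← cfc_neg]
  congr 3
  funext x
  simp [Real.negMulLog]

theorem vonNeumannEntropy_eq_sum {ρ : Matrix n n ℂ} (hρ : ρ.IsHermitian) :
    vonNeumannEntropy ρ = ∑ i, Real.negMulLog (hρ.eigenvalues i) := by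
  rw [vonNeumannEntropy_eq_trace hρ, trace_cfc hρ]
  simp

theorem sum_eigenvalues_eq_one {ρ : Matrix n n ℂ} (hρ : ρ.PosSemidef) (htr : ρ.trace = 1) :
    ∑ i, hρ.isHermitian.eigenvalues i = 1 := by
  have h := hρ.isHermitian.trace_eq_sum_eigenvalues
  rw [htr] at h
  have h' := congrArg Complex.re h
  simpa using h'.symm

theorem eigenvalues_le_one {ρ : Matrix n n ℂ} (hρ : ρ.PosSemidef) (htr : ρ.trace = 1) (i : n) :
    hρ.isHermitian.eigenvalues i ≤ 1 := by
  rw [← sum_eigenvalues_eq_one hρ htr]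
  exact Finset.single_le_sum (fun j _ => hρ.eigenvalues_nonneg j) (Finset.mem_univ i)

theorem vonNeumannEntropy_nonneg {ρ : Matrix n n ℂ} (hρ : ρ.PosSemidef) (htr : ρ.trace = 1) :
    0 ≤ vonNeumannEntropy ρ := by
  rw [vonNeumannEntropy_eq_sum hρ.isHermitian]
  exact Finset.sum_nonneg fun i _ =>
    Real.negMulLog_nonneg (hρ.eigenvalues_nonneg i) (eigenvalues_le_one hρ htr i)

theorem spectrum_subset_Icc {ρ : Matrix n n ℂ} (hρ : ρ.PosSemidef) (htr : ρ.trace = 1) :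
    spectrum ℝ ρ ⊆ Set.Icc 0 1 := by
  rw [hρ.isHermitian.spectrum_real_eq_range_eigenvalues]
  rintro _ ⟨i, rfl⟩
  exact ⟨hρ.eigenvalues_nonneg i, eigenvalues_le_one hρ htr i⟩

-- The function `-x log x`, unlike the logarithm, is continuous on `[0, 1]`, and this interval
-- contains the spectra of all density matrices.
open scoped Matrix.Norms.L2Operator in
theorem tendsto_vonNeumannEntropy {X : Type*} {l : Filter X} {ρ : X → Matrix n n ℂ}
    {ρ₀ : Matrix n n ℂ} (h : Tendsto ρ l (𝓝 ρ₀)) (hρ : ∀ x, (ρ x).PosSemidef)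
    (htr : ∀ x, (ρ x).trace = 1) (hρ₀ : ρ₀.PosSemidef) (htr₀ : ρ₀.trace = 1) :
    Tendsto (fun x => vonNeumannEntropy (ρ x)) l (𝓝 (vonNeumannEntropy ρ₀)) := by
  have h1 : Tendsto (fun x => cfc Real.negMulLog (ρ x)) l (𝓝 (cfc Real.negMulLog ρ₀)) :=
    Filter.Tendsto.cfc (isCompact_Icc (a := (0 : ℝ)) (b := 1)) Real.negMulLog h
      (Eventually.of_forall fun x => spectrum_subset_Icc (hρ x) (htr x))
      (Eventually.of_forall fun x => (hρ x).isHermitian.isSelfAdjoint)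
      (spectrum_subset_Icc hρ₀ htr₀) hρ₀.isHermitian.isSelfAdjoint
      Real.continuous_negMulLog.continuousOn
  simp only [vonNeumannEntropy_eq_trace (hρ _).isHermitian,
    vonNeumannEntropy_eq_trace hρ₀.isHermitian]
  have h2 : Continuous fun M : Matrix n n ℂ => M.trace.re :=
    Complex.continuous_re.comp (continuous_id.matrix_trace)
  exact (h2.tendsto _).comp h1

/-- Real linearity of `θ` suffices because `Real.negMulLog` is a real function and only the real
part of the trace enters. Antilinear maps, as in time reversal, are thereby covered. -/
theorem vonNeumannEntropy_map {ρ : Matrix m m ℂ} (hρ : ρ.IsHermitian)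
    (θ : Matrix m m ℂ →⋆ₐ[ℝ] Matrix n n ℂ) (hθ : ∀ M, (θ M).trace.re = M.trace.re) :
    vonNeumannEntropy (θ ρ) = vonNeumannEntropy ρ := by
  have hsa : IsSelfAdjoint (θ ρ) := hρ.isSelfAdjoint.map θ
  have hc : Continuous θ :=
    LinearMap.continuous_of_finiteDimensional (θ : Matrix m m ℂ →ₗ[ℝ] Matrix n n ℂ)
  rw [vonNeumannEntropy_eq_trace hρ, vonNeumannEntropy_eq_trace hsa, ← hθ]
  rw [StarAlgHomClass.map_cfc (S := ℝ) θ Real.negMulLog ρ (continuousOn_spectrum _ _) hc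
    hρ.isSelfAdjoint hsa]

end Entropy

/-! ### Relative entropy and its monotonicity -/

section RelativeEntropy

open Matrix

theorem hasDerivAt_sum_log {ι : Type*} [Fintype ι] (a : ι → ℝ) {p q : ι → ℝ} (hp : ∀ i, 0 < p i)
    (hq : ∀ i, 0 < q i) {t : ℝ} (ht : 0 ≤ t) : HasDerivAt
      (fun t => ∑ i, a i * (p i * (Real.log (q i + t * p i) - Real.log (q i))))
      (∑ i, a i * (p i ^ 2 / (q i + t * p i))) t := by
  refine HasDerivAt.fun_sum fun i _ => ?_
  have hpos : 0 < q i + t * p i := add_pos_of_pos_of_nonneg (hq i) (mul_nonneg ht (hp i).le)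
  have h1 : HasDerivAt (fun t => q i + t * p i) (p i) t := by
    simpa using ((hasDerivAt_id t).mul_const (p i)).const_add (q i)
  have h2 := (((h1.log hpos.ne').sub_const (Real.log (q i))).const_mul (p i)).const_mul (a i)
  have h3 : a i * (p i ^ 2 / (q i + t * p i)) = a i * (p i * (p i / (q i + t * p i))) := by ring
  rw [h3]
  exact h2

theorem tendsto_sum_log_sub_log {ι : Type*} [Fintype ι] {a p q : ι → ℝ} (hp : ∀ i, 0 < p i)
    (hq : ∀ i, 0 < q i) (hs : ∑ i, a i * p i = 1) : Tendsto
      (fun t => ∑ i, a i * (p i * (Real.log (q i + t * p i) - Real.log (q i))) - Real.log t)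
      atTop (𝓝 (∑ i, a i * (p i * (Real.log (p i) - Real.log (q i))))) := by
  have h0 : Tendsto (fun t => ∑ i, a i * (p i * (Real.log (q i * t⁻¹ + p i) - Real.log (q i))))
      atTop (𝓝 (∑ i, a i * (p i * (Real.log (p i) - Real.log (q i))))) := by
    refine tendsto_finsetSum _ fun i _ => ?_
    have h1 : Tendsto (fun t : ℝ => q i * t⁻¹ + p i) atTop (𝓝 (p i)) := by
      simpa using (tendsto_inv_atTop_zero.const_mul (q i)).add_const (p i)
    exact (((h1.log (hp i).ne').sub_const _).const_mul _).const_mul _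
  refine h0.congr' ?_
  filter_upwards [eventually_gt_atTop 0] with t ht
  have h2 : ∀ i, Real.log (q i * t⁻¹ + p i) = Real.log (q i + t * p i) - Real.log t := by
    intro i
    have hpos : 0 < q i + t * p i :=
      add_pos_of_pos_of_nonneg (hq i) (mul_nonneg ht.le (hp i).le)
    rw [← Real.log_div hpos.ne' ht.ne']
    congr 1
    field_simp
  have h3 : Real.log t = ∑ i, a i * p i * Real.log t := by rw [← Finset.sum_mul, hs, one_mul]
  rw [h3, ← Finset.sum_sub_distrib]
  refine Finset.sum_congr rfl fun i _ => ?_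
  rw [h2 i]
  ring

/-- Integrating `p ^ 2 / (q + t * p)` over `[0, T]` gives `p (log (q + T p) - log q)`, which is `p
(log p - log q) + p log T` up to `o(1)`. The normalisations `∑ a p = 1` make the divergence exactly
`log T` on both sides, so an inequality between the integrands for all `t ≥ 0` passes to the
logarithms. -/
theorem sum_log_le_of_sum_inv_le {ι κ : Type*} [Fintype ι] [Fintype κ]
    {a p q : ι → ℝ} {a' p' q' : κ → ℝ} (hp : ∀ i, 0 < p i)
    (hq : ∀ i, 0 < q i) (hp' : ∀ i, 0 < p' i) (hq' : ∀ i, 0 < q' i)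
    (hs : ∑ i, a i * p i = 1) (hs' : ∑ i, a' i * p' i = 1)
    (h : ∀ t, 0 ≤ t → ∑ i, a i * (p i ^ 2 / (q i + t * p i)) ≤
      ∑ i, a' i * (p' i ^ 2 / (q' i + t * p' i))) :
    ∑ i, a i * (p i * (Real.log (p i) - Real.log (q i))) ≤
      ∑ i, a' i * (p' i * (Real.log (p' i) - Real.log (q' i))) := by
  refine le_of_tendsto_of_tendsto (tendsto_sum_log_sub_log hp hq hs)
    (tendsto_sum_log_sub_log hp' hq' hs') ?_
  filter_upwards [eventually_ge_atTop 0] with T hT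
  refine sub_le_sub_right ?_ _
  have hmono : MonotoneOn (fun t => ∑ i, a' i * (p' i * (Real.log (q' i + t * p' i) - Real.log (q' i)))
      - ∑ i, a i * (p i * (Real.log (q i + t * p i) - Real.log (q i)))) (Set.Ici 0) := by
    have hd : ∀ t ∈ Set.Ici (0 : ℝ), HasDerivAt _ _ t := fun t ht =>
      (hasDerivAt_sum_log a' hp' hq' ht).fun_sub (hasDerivAt_sum_log a hp hq ht)
    refine monotoneOn_of_deriv_nonneg (convex_Ici 0)
      (fun t ht => (hd t ht).continuousAt.continuousWithinAt)
      (fun t ht => (hd t (interior_subset ht)).differentiableAt.differentiableWithinAt) ?_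
    intro t ht
    rw [(hd t (interior_subset ht)).deriv]
    exact sub_nonneg.2 (h t (interior_subset ht))
  have := hmono (Set.self_mem_Ici) (Set.mem_Ici.2 hT) hT
  simpa using this

variable {n m : Type*} [Fintype n] [DecidableEq n] [Fintype m] [DecidableEq m]

/-- The Umegaki relative entropy `Tr ρ (log ρ - log σ)`. -/
def relativeEntropy (ρ σ : Matrix n n ℂ) : ℝ :=
  -vonNeumannEntropy ρ - (ρ * cfc Real.log σ).trace.re

/-- The overlaps of the eigenvectors of two Hermitian matrices. -/
def overlap {ρ σ : Matrix n n ℂ} (hρ : ρ.IsHermitian) (hσ : σ.IsHermitian) : Matrix n n ℂ :=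
  star (hρ.eigenvectorUnitary : Matrix n n ℂ) * (hσ.eigenvectorUnitary : Matrix n n ℂ)

theorem overlap_mul_star {ρ σ : Matrix n n ℂ} (hρ : ρ.IsHermitian) (hσ : σ.IsHermitian) :
    overlap hρ hσ * star (overlap hρ hσ) = 1 := by
  rw [overlap, star_mul, star_star]
  calc _ = star (hρ.eigenvectorUnitary : Matrix n n ℂ) *
        ((hσ.eigenvectorUnitary : Matrix n n ℂ) * star (hσ.eigenvectorUnitary : Matrix n n ℂ)) *
        (hρ.eigenvectorUnitary : Matrix n n ℂ) := by simp only [mul_assoc]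
    _ = 1 := by simp

theorem star_mul_overlap {ρ σ : Matrix n n ℂ} (hρ : ρ.IsHermitian) (hσ : σ.IsHermitian) :
    star (overlap hρ hσ) * overlap hρ hσ = 1 := by
  rw [overlap, star_mul, star_star]
  calc _ = star (hσ.eigenvectorUnitary : Matrix n n ℂ) *
        ((hρ.eigenvectorUnitary : Matrix n n ℂ) * star (hρ.eigenvectorUnitary : Matrix n n ℂ)) *
        (hσ.eigenvectorUnitary : Matrix n n ℂ) := by simp only [mul_assoc]
    _ = 1 := by simp

theorem sum_normSq_overlap_right {ρ σ : Matrix n n ℂ} (hρ : ρ.IsHermitian) (hσ : σ.IsHermitian)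
    (i : n) : ∑ k, Complex.normSq (overlap hρ hσ i k) = 1 := by
  have h := congrFun (congrFun (overlap_mul_star hρ hσ) i) i
  rw [mul_apply, one_apply_eq] at h
  have h' := congrArg Complex.re h
  simp only [star_apply, Complex.re_sum, RCLike.star_def, Complex.mul_conj, Complex.ofReal_re,
    Complex.one_re] at h'
  exact h'

theorem sum_normSq_overlap_left {ρ σ : Matrix n n ℂ} (hρ : ρ.IsHermitian) (hσ : σ.IsHermitian)
    (k : n) : ∑ i, Complex.normSq (overlap hρ hσ i k) = 1 := by
  have h := congrFun (congrFun (star_mul_overlap hρ hσ) k) k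
  rw [mul_apply, one_apply_eq] at h
  have h' := congrArg Complex.re h
  simp only [star_apply, Complex.re_sum, RCLike.star_def, mul_comm ((starRingEnd ℂ) _),
    Complex.mul_conj, Complex.ofReal_re, Complex.one_re] at h'
  exact h'

/-- In the two eigenbases the relative entropy becomes a classical sum, weighted by the doubly
stochastic matrix of squared overlaps. -/
theorem relativeEntropy_eq_sum {ρ σ : Matrix n n ℂ} (hρ : ρ.IsHermitian) (hσ : σ.IsHermitian) :
    relativeEntropy ρ σ = ∑ x : n × n, Complex.normSq (overlap hρ hσ x.1 x.2) *
      (hρ.eigenvalues x.1 *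
        (Real.log (hρ.eigenvalues x.1) - Real.log (hσ.eigenvalues x.2))) := by
  have h1 : vonNeumannEntropy ρ = -∑ i, ∑ k, Complex.normSq (overlap hρ hσ i k) *
      (hρ.eigenvalues i * Real.log (hρ.eigenvalues i)) := by
    rw [vonNeumannEntropy_eq_sum hρ, ← Finset.sum_neg_distrib]
    refine Finset.sum_congr rfl fun i _ => ?_
    rw [← Finset.sum_mul, sum_normSq_overlap_right, Real.negMulLog]
    ring
  have h2 : (ρ * cfc Real.log σ).trace.re = ∑ i, ∑ k, Complex.normSq (overlap hρ hσ i k) *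
      (hρ.eigenvalues i * Real.log (hσ.eigenvalues k)) := by
    rw [trace_mul_cfc hσ, Complex.re_sum, Finset.sum_comm]
    refine Finset.sum_congr rfl fun k _ => ?_
    have h3 : star (hσ.eigenvectorUnitary : Matrix n n ℂ) * ρ *
        (hσ.eigenvectorUnitary : Matrix n n ℂ) = star (overlap hρ hσ) *
          diagonal (fun i => (hρ.eigenvalues i : ℂ)) * overlap hρ hσ := by
      conv_lhs => enter [1, 2]; rw [eq_conj_eigenvalues hρ]
      simp only [overlap, star_mul, star_star, mul_assoc]
    rw [h3, mul_apply, Finset.mul_sum, Complex.re_sum]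
    refine Finset.sum_congr rfl fun i _ => ?_
    rw [mul_diagonal, star_apply]
    have : (Real.log (hσ.eigenvalues k) : ℂ) * (star (overlap hρ hσ i k) * (hρ.eigenvalues i : ℂ) *
        overlap hρ hσ i k) = ((Complex.normSq (overlap hρ hσ i k) *
          (hρ.eigenvalues i * Real.log (hσ.eigenvalues k)) : ℝ) : ℂ) := by
      push_cast
      rw [← Complex.mul_conj, RCLike.star_def]
      ring
    rw [this, Complex.ofReal_re]
  rw [relativeEntropy, h1, h2, neg_neg, Fintype.sum_prod_type, ← Finset.sum_sub_distrib]
  refine Finset.sum_congr rfl fun i _ => ?_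
  rw [← Finset.sum_sub_distrib]
  refine Finset.sum_congr rfl fun k _ => ?_
  ring

theorem sum_normSq_overlap_mul_eigenvalues {ρ σ : Matrix n n ℂ} (hρ : ρ.PosSemidef)
    (htr : ρ.trace = 1) (hσ : σ.IsHermitian) :
    ∑ x : n × n, Complex.normSq (overlap hρ.isHermitian hσ x.1 x.2) *
      hρ.isHermitian.eigenvalues x.1 = 1 := by
  rw [Fintype.sum_prod_type, ← sum_eigenvalues_eq_one hρ htr]
  refine Finset.sum_congr rfl fun i _ => ?_
  dsimp only
  rw [← Finset.sum_mul, sum_normSq_overlap_right, one_mul]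

/-- Klein's inequality. -/
theorem relativeEntropy_nonneg {ρ σ : Matrix n n ℂ} (hρ : ρ.PosSemidef) (htr : ρ.trace = 1)
    (hσ : σ.PosDef) (htr' : σ.trace = 1) : 0 ≤ relativeEntropy ρ σ := by
  rw [relativeEntropy_eq_sum hρ.isHermitian hσ.isHermitian]
  -- Both eigenvalue families have total weight one, so a vanishing sum of `p - q` may be
  -- subtracted; it remains to see `p (log p - log q) ≥ p - q` termwise.
  have h0 : ∑ x : n × n, Complex.normSq (overlap hρ.isHermitian hσ.isHermitian x.1 x.2) *
      (hρ.isHermitian.eigenvalues x.1 - hσ.isHermitian.eigenvalues x.2) = 0 := by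
    simp only [mul_sub, Finset.sum_sub_distrib]
    rw [sum_normSq_overlap_mul_eigenvalues hρ htr, Fintype.sum_prod_type_right, sub_eq_zero,
      ← sum_eigenvalues_eq_one hσ.posSemidef htr']
    refine Finset.sum_congr rfl fun k _ => ?_
    dsimp only
    rw [← Finset.sum_mul, sum_normSq_overlap_left, one_mul]
  rw [← h0]
  refine Finset.sum_le_sum fun x _ => mul_le_mul_of_nonneg_left ?_ (Complex.normSq_nonneg _)
  have hq := hσ.eigenvalues_pos x.2
  generalize hσ.isHermitian.eigenvalues x.2 = q at *
  rcases (hρ.eigenvalues_nonneg x.1).eq_or_lt with h | hp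
  · rw [← h]; simpa using hq.le
  · generalize hρ.isHermitian.eigenvalues x.1 = p at *
    have h1 := Real.log_le_sub_one_of_pos (div_pos hq hp)
    rw [Real.log_div hq.ne' hp.ne'] at h1
    have h2 : p * (q / p - 1) = q - p := by field_simp
    nlinarith [mul_le_mul_of_nonneg_left h1 hp.le]

/-- The functional whose maximum over `X` is the resolvent form of the relative modular
operator of `ρ` and `σ`. -/
def resolventForm (ρ σ : Matrix n n ℂ) (t : ℝ) (X : Matrix n n ℂ) : ℝ :=
  2 * (ρ * X).trace.re - (σ * (X * star X)).trace.re - t * (ρ * (star X * X)).trace.re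

/-- Between the eigenbases of `σ` and `ρ` the form decouples: each entry of `Y` has its own
quadratic polynomial, with leading coefficient `-(q + t * p)`. -/
theorem resolventForm_conj {ρ σ : Matrix n n ℂ} (hρ : ρ.IsHermitian) (hσ : σ.IsHermitian) (t : ℝ)
    (Y : Matrix n n ℂ) :
    resolventForm ρ σ t ((hσ.eigenvectorUnitary : Matrix n n ℂ) * Y *
      star (hρ.eigenvectorUnitary : Matrix n n ℂ)) =
    ∑ x : n × n, (2 * (hρ.eigenvalues x.1 * (overlap hρ hσ x.1 x.2 * Y x.2 x.1).re) -
      (hσ.eigenvalues x.2 + t * hρ.eigenvalues x.1) * Complex.normSq (Y x.2 x.1)) := by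
  set U := (hρ.eigenvectorUnitary : Matrix n n ℂ) with hU
  set V := (hσ.eigenvectorUnitary : Matrix n n ℂ) with hV
  have hUU : star U * U = 1 := by simp [hU]
  have hVV : star V * V = 1 := by simp [hV]
  have h1 : (ρ * (V * Y * star U)).trace.re =
      ∑ i, ∑ k, hρ.eigenvalues i * (overlap hρ hσ i k * Y k i).re := by
    have : (ρ * (V * Y * star U)).trace =
        (diagonal (fun i => (hρ.eigenvalues i : ℂ)) * (overlap hρ hσ * Y)).trace := by
      conv_lhs => enter [1, 1]; rw [eq_conj_eigenvalues hρ]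
      rw [← hU, trace_mul_comm (U * diagonal _ * star U)]
      rw [show V * Y * star U * (U * diagonal (fun i => (hρ.eigenvalues i : ℂ)) * star U) =
        (V * Y) * ((star U * U) * diagonal (fun i => (hρ.eigenvalues i : ℂ)) * star U) by
          simp only [mul_assoc], hUU, one_mul, trace_mul_comm, overlap]
      simp only [mul_assoc, ← hU, ← hV]
    rw [this, trace, Complex.re_sum]
    refine Finset.sum_congr rfl fun i _ => ?_
    rw [diag_apply, diagonal_mul, Complex.re_ofReal_mul, mul_apply, Complex.re_sum, Finset.mul_sum]
  have h2 : (σ * (V * Y * star U * star (V * Y * star U))).trace.re =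
      ∑ i, ∑ k, hσ.eigenvalues k * Complex.normSq (Y k i) := by
    have : (σ * (V * Y * star U * star (V * Y * star U))).trace =
        (diagonal (fun i => (hσ.eigenvalues i : ℂ)) * (Y * star Y)).trace := by
      conv_lhs => enter [1, 1]; rw [eq_conj_eigenvalues hσ]
      rw [← hV, show V * diagonal (fun i => (hσ.eigenvalues i : ℂ)) * star V *
        (V * Y * star U * star (V * Y * star U)) =
        V * (diagonal (fun i => (hσ.eigenvalues i : ℂ)) * (star V * V) * Y * (star U * U) * star Y *
          star V) by simp only [star_mul, star_star, mul_assoc], hUU, hVV, trace_mul_comm]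
      rw [show ∀ Z W : Matrix n n ℂ, Z * star V * V = Z * (star V * V) from
        fun Z _ => mul_assoc _ _ _, hVV]
      · simp only [mul_one, mul_assoc]
      · exact 1
    rw [this, trace, Complex.re_sum, Finset.sum_comm]
    refine Finset.sum_congr rfl fun k _ => ?_
    rw [diag_apply, diagonal_mul, Complex.re_ofReal_mul, mul_apply, Complex.re_sum, Finset.mul_sum]
    refine Finset.sum_congr rfl fun i _ => ?_
    rw [star_apply, RCLike.star_def, Complex.mul_conj, Complex.ofReal_re]
  have h3 : (ρ * (star (V * Y * star U) * (V * Y * star U))).trace.re =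
      ∑ i, ∑ k, hρ.eigenvalues i * Complex.normSq (Y k i) := by
    have : (ρ * (star (V * Y * star U) * (V * Y * star U))).trace =
        (diagonal (fun i => (hρ.eigenvalues i : ℂ)) * (star Y * Y)).trace := by
      conv_lhs => enter [1, 1]; rw [eq_conj_eigenvalues hρ]
      rw [← hU, show U * diagonal (fun i => (hρ.eigenvalues i : ℂ)) * star U *
        (star (V * Y * star U) * (V * Y * star U)) =
        U * (diagonal (fun i => (hρ.eigenvalues i : ℂ)) * (star U * U) * star Y * (star V * V) * Y *
          star U) by simp only [star_mul, star_star, mul_assoc], hUU, hVV, trace_mul_comm]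
      rw [show ∀ Z W : Matrix n n ℂ, Z * star U * U = Z * (star U * U) from
        fun Z _ => mul_assoc _ _ _, hUU]
      · simp only [mul_one, mul_assoc]
      · exact 1
    rw [this, trace, Complex.re_sum]
    refine Finset.sum_congr rfl fun i _ => ?_
    rw [diag_apply, diagonal_mul, Complex.re_ofReal_mul, mul_apply, Complex.re_sum, Finset.mul_sum]
    refine Finset.sum_congr rfl fun k _ => ?_
    rw [star_apply, RCLike.star_def, mul_comm ((starRingEnd ℂ) _), Complex.mul_conj,
      Complex.ofReal_re]
  rw [resolventForm, h1, h2, h3, Fintype.sum_prod_type]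
  simp only [Finset.mul_sum, ← Finset.sum_sub_distrib]
  refine Finset.sum_congr rfl fun i _ => Finset.sum_congr rfl fun k _ => ?_
  ring

theorem resolventForm_le {ρ σ : Matrix n n ℂ} (hρ : ρ.PosDef) (hσ : σ.PosDef) {t : ℝ}
    (ht : 0 ≤ t) (X : Matrix n n ℂ) :
    resolventForm ρ σ t X ≤ ∑ x : n × n,
      Complex.normSq (overlap hρ.isHermitian hσ.isHermitian x.1 x.2) *
      (hρ.isHermitian.eigenvalues x.1 ^ 2 /
        (hσ.isHermitian.eigenvalues x.2 + t * hρ.isHermitian.eigenvalues x.1)) := by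
  have hX : X = (hσ.isHermitian.eigenvectorUnitary : Matrix n n ℂ) *
      (star (hσ.isHermitian.eigenvectorUnitary : Matrix n n ℂ) * X *
        (hρ.isHermitian.eigenvectorUnitary : Matrix n n ℂ)) *
      star (hρ.isHermitian.eigenvectorUnitary : Matrix n n ℂ) := by
    calc X = ((hσ.isHermitian.eigenvectorUnitary : Matrix n n ℂ) *
        star (hσ.isHermitian.eigenvectorUnitary : Matrix n n ℂ)) * X *
        ((hρ.isHermitian.eigenvectorUnitary : Matrix n n ℂ) *
        star (hρ.isHermitian.eigenvectorUnitary : Matrix n n ℂ)) := by simp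
      _ = _ := by simp only [mul_assoc]
  rw [hX, resolventForm_conj]
  refine Finset.sum_le_sum fun x _ => ?_
  have hp := hρ.eigenvalues_pos x.1
  have hq := hσ.eigenvalues_pos x.2
  generalize hρ.isHermitian.eigenvalues x.1 = p at *
  generalize hσ.isHermitian.eigenvalues x.2 = q at *
  generalize overlap _ _ x.1 x.2 = w
  generalize (star (hσ.isHermitian.eigenvectorUnitary : Matrix n n ℂ) * X *
        (hρ.isHermitian.eigenvectorUnitary : Matrix n n ℂ)) x.2 x.1 = y
  have hr : 0 < q + t * p := by positivity
  generalize q + t * p = r at *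
  rw [← mul_div_assoc, le_div_iff₀ hr]
  simp only [Complex.normSq_apply, Complex.mul_re]
  -- The square completed here is `|p * conj w - r * y| ^ 2 ≥ 0`.
  nlinarith [sq_nonneg (p * w.re - r * y.re), sq_nonneg (p * w.im + r * y.im)]

theorem exists_resolventForm_eq {ρ σ : Matrix n n ℂ} (hρ : ρ.PosDef) (hσ : σ.PosDef) {t : ℝ}
    (ht : 0 ≤ t) : ∃ X, resolventForm ρ σ t X = ∑ x : n × n,
      Complex.normSq (overlap hρ.isHermitian hσ.isHermitian x.1 x.2) *
      (hρ.isHermitian.eigenvalues x.1 ^ 2 /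
        (hσ.isHermitian.eigenvalues x.2 + t * hρ.isHermitian.eigenvalues x.1)) := by
  -- The maximiser of each decoupled quadratic is `p / (q + t * p)` times the conjugate overlap.
  refine ⟨(hσ.isHermitian.eigenvectorUnitary : Matrix n n ℂ) *
    (Matrix.of fun k i => ((hρ.isHermitian.eigenvalues i / (hσ.isHermitian.eigenvalues k +
      t * hρ.isHermitian.eigenvalues i) : ℝ) : ℂ) *
      star (overlap hρ.isHermitian hσ.isHermitian i k)) *
    star (hρ.isHermitian.eigenvectorUnitary : Matrix n n ℂ), ?_⟩
  rw [resolventForm_conj]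
  refine Finset.sum_congr rfl fun x _ => ?_
  have hp := hρ.eigenvalues_pos x.1
  have hq := hσ.eigenvalues_pos x.2
  rw [of_apply]
  generalize hρ.isHermitian.eigenvalues x.1 = p at *
  generalize hσ.isHermitian.eigenvalues x.2 = q at *
  generalize overlap _ _ x.1 x.2 = w
  have hr : 0 < q + t * p := by positivity
  generalize q + t * p = r at *
  have h1 : (w * (((p / r : ℝ) : ℂ) * star w)).re = p / r * Complex.normSq w := by
    rw [mul_left_comm, Complex.re_ofReal_mul, RCLike.star_def, Complex.mul_conj, Complex.ofReal_re]
  rw [h1, Complex.normSq_mul, Complex.normSq_ofReal, RCLike.star_def, Complex.normSq_conj]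
  field_simp
  ring

/-- Monotonicity of the relative entropy under restriction to a subalgebra. -/
theorem relativeEntropy_le_of_restrict {ρ σ : Matrix m m ℂ} {ρ' σ' : Matrix n n ℂ} (hρ : ρ.PosDef)
    (hσ : σ.PosDef) (hρ' : ρ'.PosDef) (hσ' : σ'.PosDef) (htr : ρ.trace = 1) (htr' : ρ'.trace = 1)
    (ι : Matrix m m ℂ → Matrix n n ℂ) (hmul : ∀ X Y, ι (X * Y) = ι X * ι Y)
    (hstar : ∀ X, ι (star X) = star (ι X)) (hρι : ∀ X, (ρ' * ι X).trace = (ρ * X).trace)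
    (hσι : ∀ X, (σ' * ι X).trace = (σ * X).trace) :
    relativeEntropy ρ σ ≤ relativeEntropy ρ' σ' := by
  rw [relativeEntropy_eq_sum hρ.isHermitian hσ.isHermitian,
    relativeEntropy_eq_sum hρ'.isHermitian hσ'.isHermitian]
  refine sum_log_le_of_sum_inv_le (fun x => hρ.eigenvalues_pos _) (fun x => hσ.eigenvalues_pos _)
    (fun x => hρ'.eigenvalues_pos _) (fun x => hσ'.eigenvalues_pos _)
    (sum_normSq_overlap_mul_eigenvalues hρ.posSemidef htr _)
    (sum_normSq_overlap_mul_eigenvalues hρ'.posSemidef htr' _) fun t ht => ?_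
  -- The maximiser for the small algebra is only a competitor in the large one, where `ι X` gives
  -- the form the same value; the maximum can only grow.
  obtain ⟨X, hX⟩ := exists_resolventForm_eq hρ hσ ht
  rw [← hX]
  refine le_trans (le_of_eq ?_) (resolventForm_le hρ' hσ' ht (ι X))
  rw [resolventForm, resolventForm, ← hstar, ← hmul, ← hmul, hρι, hσι, hρι]

end RelativeEntropy

/-! ### States -/

/-- This puts `a* a ≤ ‖a‖²` in the form to which positivity of a state applies, since a `State` is
only assumed nonnegative on elements `star b * b`. -/
theorem exists_star_mul_self_eq_norm_sq_sub {A : Type*} [CStarAlgebra A] (a : A) :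
    ∃ b : A, star b * b = algebraMap ℝ A (‖a‖ ^ 2) - star a * a := by
  let _ := CStarAlgebra.spectralOrder A
  have _ := CStarAlgebra.spectralOrderedRing A
  obtain ⟨b, hb⟩ := CStarAlgebra.nonneg_iff_eq_star_mul_self.1
    (sub_nonneg.2 (CStarAlgebra.star_mul_le_algebraMap_norm_sq (a := a)))
  exact ⟨b, hb.symm⟩

namespace State

variable (ω : State ν D)

theorem ext {ω ω' : State ν D} (h : ∀ A, ω A = ω' A) : ω = ω' := by
  obtain ⟨f, _, _⟩ := ω
  obtain ⟨g, _, _⟩ := ω'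
  have : f = g := LinearMap.ext h
  subst this
  rfl

theorem re_nonneg (A : QuasilocalAlg ν D) : 0 ≤ (ω (star A * A)).re :=
  (Complex.nonneg_iff.1 (ω.nonneg A)).1

theorem im_eq_zero (A : QuasilocalAlg ν D) : (ω (star A * A)).im = 0 :=
  (Complex.nonneg_iff.1 (ω.nonneg A)).2.symm

/-- Polarisation: `ω` is real on `star B * B` for `B = A`, `A + 1` and `A + i`, and the two
resulting equations identify the real and imaginary parts. -/
theorem apply_star (A : QuasilocalAlg ν D) : ω (star A) = star (ω A) := by
  have h1 := ω.im_eq_zero (A + 1)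
  have h2 := ω.im_eq_zero (A + Complex.I • (1 : QuasilocalAlg ν D))
  have h0 := ω.im_eq_zero A
  have e1 : star (A + 1) * (A + 1) = star A * A + star A + A + 1 := by
    rw [star_add, star_one]; noncomm_ring
  have e2 : star (A + Complex.I • (1 : QuasilocalAlg ν D)) * (A + Complex.I • (1 : QuasilocalAlg ν D))
      = star A * A + Complex.I • star A - Complex.I • A + 1 := by
    rw [star_add, star_smul, star_one, add_mul, mul_add, mul_add, mul_smul_comm, mul_one,
      smul_mul_assoc, one_mul, smul_mul_smul_comm, mul_one]
    simp only [RCLike.star_def, Complex.conj_I, neg_mul, Complex.I_mul_I, neg_neg, one_smul,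
      neg_smul]
    abel
  rw [e1, map_add, map_add, map_add] at h1
  rw [e2, map_add, map_sub, map_add, map_smul, map_smul] at h2
  simp only [Complex.add_im, Complex.sub_im, smul_eq_mul, Complex.mul_im, Complex.I_re,
    Complex.I_im, ω.normalized, Complex.one_im, h0] at h1 h2
  apply Complex.ext
  · simp only [RCLike.star_def, Complex.conj_re]; linarith
  · simp only [RCLike.star_def, Complex.conj_im]; linarith

/-- The Gelfand-Naimark-Segal sesquilinear form. -/
abbrev gnsCore : PreInnerProductSpace.Core ℂ (QuasilocalAlg ν D) where
  inner A B := ω (star A * B)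
  conj_inner_symm A B := by
    change star (ω (star B * A)) = ω (star A * B)
    rw [← apply_star, star_mul, star_star]
  re_inner_nonneg A := ω.re_nonneg A
  add_left A B E := by
    change ω (star (A + B) * E) = ω (star A * E) + ω (star B * E)
    rw [star_add, add_mul, map_add]
  smul_left A B c := by
    change ω (star (c • A) * B) = star c * ω (star A * B)
    rw [star_smul, smul_mul_assoc, map_smul, smul_eq_mul]

theorem cauchy_schwarz (A B : QuasilocalAlg ν D) :
    ‖ω (star A * B)‖ ^ 2 ≤ (ω (star A * A)).re * (ω (star B * B)).re := by
  have h := @InnerProductSpace.Core.inner_mul_inner_self_le ℂ _ _ _ _ ω.gnsCore A B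
  have h' : ‖ω (star B * A)‖ = ‖ω (star A * B)‖ := by
    rw [← norm_star (ω (star A * B)), ← apply_star, star_mul, star_star]
  change ‖ω (star A * B)‖ * ‖ω (star B * A)‖ ≤ _ at h
  rw [h', ← sq] at h
  exact h

theorem re_star_mul_self_le (A : QuasilocalAlg ν D) : (ω (star A * A)).re ≤ ‖A‖ ^ 2 := by
  obtain ⟨B, hB⟩ := exists_star_mul_self_eq_norm_sq_sub A
  have h := ω.re_nonneg B
  rw [hB, map_sub, Complex.sub_re, Algebra.algebraMap_eq_smul_one] at h
  have h1 : (‖A‖ ^ 2) • (1 : QuasilocalAlg ν D) = ((‖A‖ ^ 2 : ℝ) : ℂ) • 1 := by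
    rw [Complex.coe_smul]
  rw [h1, map_smul, ω.normalized, smul_eq_mul, mul_one, Complex.ofReal_re] at h
  linarith

theorem norm_apply_le (A : QuasilocalAlg ν D) : ‖ω A‖ ≤ ‖A‖ := by
  have h := ω.cauchy_schwarz 1 A
  rw [star_one, one_mul, one_mul, ω.normalized, Complex.one_re, one_mul] at h
  exact le_of_sq_le_sq (h.trans (ω.re_star_mul_self_le A)) (norm_nonneg _)

theorem continuous : Continuous ω.toFun :=
  AddMonoidHomClass.continuous_of_bound ω.toFun 1 fun A => by
    simpa using ω.norm_apply_le A

/-- The state as a continuous functional. -/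
def toCLM : QuasilocalAlg ν D →L[ℂ] ℂ := ⟨ω.toFun, ω.continuous⟩

/-- The convex combination `(1 - ε) ω + ε ω'`. -/
def mix (ω ω' : State ν D) (ε : ℝ) (h0 : 0 ≤ ε) (h1 : ε ≤ 1) : State ν D where
  toFun := ((1 - ε : ℝ) : ℂ) • ω.toFun + (ε : ℂ) • ω'.toFun
  nonneg A := by
    have h := ω.nonneg A
    have h' := ω'.nonneg A
    simp only [LinearMap.add_apply, LinearMap.smul_apply, smul_eq_mul]
    exact add_nonneg (mul_nonneg (Complex.zero_le_real.2 (sub_nonneg.2 h1)) h)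
      (mul_nonneg (Complex.zero_le_real.2 h0) h')
  normalized := by
    simp [ω.normalized, ω'.normalized]

theorem mix_apply (ω ω' : State ν D) (ε : ℝ) (h0 : 0 ≤ ε) (h1 : ε ≤ 1) (A : QuasilocalAlg ν D) :
    ω.mix ω' ε h0 h1 A = ((1 - ε : ℝ) : ℂ) * ω A + (ε : ℂ) * ω' A := rfl

theorem sum_apply_obs_single (Λ : Finset (Site ν)) :
    ∑ c, ω (obs Λ (Matrix.single c c 1)) = 1 := by
  rw [← map_sum, sum_obs_single, ω.normalized]

/-! #### Density matrices -/

theorem apply_obs (Λ : Finset (Site ν)) (M : Matrix (Λ → Fin D) (Λ → Fin D) ℂ) :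
    ω (obs Λ M) = (ω.density Λ * M).trace := by
  conv_lhs => rw [Matrix.matrix_eq_sum_single M]
  have h : ∀ i j, ω (obs Λ (Matrix.single i j (M i j))) = ω.density Λ j i * M i j := by
    intro i j
    have : Matrix.single i j (M i j) = M i j • Matrix.single i j (1 : ℂ) := by
      rw [Matrix.smul_single, smul_eq_mul, mul_one]
    rw [this, _root_.map_smul, _root_.map_smul, smul_eq_mul, mul_comm]
    rfl
  simp only [map_sum, h, Matrix.trace, Matrix.diag_apply, Matrix.mul_apply]
  rw [Finset.sum_comm]

theorem eq_density {Λ : Finset (Site ν)} {ρ : Matrix (Λ → Fin D) (Λ → Fin D) ℂ}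
    (h : ∀ M, ω (obs Λ M) = (ρ * M).trace) : ω.density Λ = ρ := by
  ext ξ η
  change ω (obs Λ (Matrix.single η ξ 1)) = _
  rw [h, Matrix.trace_mul_single]
  simp

theorem trace_density (Λ : Finset (Site ν)) : (ω.density Λ).trace = 1 := by
  have h := ω.apply_obs Λ 1
  rw [map_one, ω.normalized, mul_one] at h
  exact h.symm

theorem isHermitian_density (Λ : Finset (Site ν)) : (ω.density Λ).IsHermitian := by
  ext ξ η
  change star (ω (obs Λ (Matrix.single ξ η 1))) = ω (obs Λ (Matrix.single η ξ 1))
  rw [← apply_star, star_obs_single]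

/-- The rank-one matrix `e₀ x*` has `(e₀ x*)* (e₀ x*) = x x*`, so the quadratic form of the density
matrix is a value of `ω` on a positive element. -/
theorem dotProduct_density [NeZero D] (Λ : Finset (Site ν)) (x : (Λ → Fin D) → ℂ) :
    star x ⬝ᵥ (ω.density Λ).mulVec x =
      ω (star (obs Λ (Matrix.vecMulVec (Pi.single 0 1) (star x))) *
        obs Λ (Matrix.vecMulVec (Pi.single 0 1) (star x))) := by
  rw [← StarHomClass.map_star, ← map_mul, apply_obs, Matrix.star_eq_conjTranspose,
    Matrix.conjTranspose_vecMulVec, star_star, Matrix.vecMulVec_mul_vecMulVec,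
    Matrix.mul_vecMulVec, Matrix.trace_vecMulVec, dotProduct_comm]
  have : star (Pi.single 0 1 : (Λ → Fin D) → ℂ) ⬝ᵥ Pi.single 0 1 = 1 := by simp
  rw [this, one_smul]

theorem posSemidef_density [NeZero D] (Λ : Finset (Site ν)) : (ω.density Λ).PosSemidef := by
  refine Matrix.PosSemidef.of_dotProduct_mulVec_nonneg (ω.isHermitian_density Λ) fun x => ?_
  rw [dotProduct_density]
  exact ω.nonneg _

theorem localEntropy_nonneg [NeZero D] (Λ : Finset (Site ν)) : 0 ≤ ω.localEntropy Λ :=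
  vonNeumannEntropy_nonneg (ω.posSemidef_density Λ) (ω.trace_density Λ)

theorem tendsto_localEntropy [NeZero D] {X : Type*} {l : Filter X} {φ : X → State ν D}
    {ω : State ν D} {Λ : Finset (Site ν)}
    (h : ∀ A, IsLocal Λ A → Tendsto (fun x => φ x A) l (𝓝 (ω A))) :
    Tendsto (fun x => (φ x).localEntropy Λ) l (𝓝 (ω.localEntropy Λ)) := by
  refine tendsto_vonNeumannEntropy ?_ (fun x => (φ x).posSemidef_density Λ)
    (fun x => (φ x).trace_density Λ) (ω.posSemidef_density Λ) (ω.trace_density Λ)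
  refine tendsto_pi_nhds.2 fun ξ => tendsto_pi_nhds.2 fun η => ?_
  exact h _ (isLocal_obs Λ _)

/-- The restriction of `ω` to `𝒜(Λ)` is faithful. -/
def FaithfulOn (Λ : Finset (Site ν)) : Prop :=
  ∀ A, IsLocal Λ A → A ≠ 0 → 0 < (ω (star A * A)).re

variable {ω}

theorem FaithfulOn.mono {Λ Λ' : Finset (Site ν)} (h : ω.FaithfulOn Λ') (hΛ : Λ ⊆ Λ') :
    ω.FaithfulOn Λ := fun A hA => h A (hA.mono hΛ)

theorem FaithfulOn.posDef [NeZero D] {Λ : Finset (Site ν)} (h : ω.FaithfulOn Λ) :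
    (ω.density Λ).PosDef := by
  refine Matrix.PosDef.of_dotProduct_mulVec_pos (ω.isHermitian_density Λ) fun x hx => ?_
  rw [dotProduct_density]
  rw [Complex.pos_iff]
  refine ⟨h _ (isLocal_obs Λ _) fun h0 => hx ?_, (ω.im_eq_zero _).symm⟩
  have h1 := obs_injective Λ (h0.trans (map_zero (obs Λ)).symm)
  funext η
  have h2 := congrFun (congrFun h1 0) η
  simpa [Matrix.vecMulVec_apply] using h2

variable (ω)

theorem twirl_aux [NeZero D] (Λ : Finset (Site ν)) (A : QuasilocalAlg ν D) (ξ η : Λ → Fin D) :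
    obs Λ (Matrix.single ξ η 1) * (star A * A) * obs Λ (Matrix.single η ξ 1) =
      star (A * obs Λ (Matrix.single η ξ 1)) * (A * obs Λ (Matrix.single η ξ 1)) := by
  rw [star_mul, star_obs_single]
  simp only [mul_assoc]

/-- The state obtained from `ω` by putting the trace on `𝒜(Λ)`. -/
def twirl [NeZero D] (Λ : Finset (Site ν)) : State ν D where
  toFun :=
    { toFun := fun A => (Fintype.card (Λ → Fin D) : ℂ)⁻¹ * ∑ ξ, ∑ η,
        ω (obs Λ (Matrix.single ξ η 1) * A * obs Λ (Matrix.single η ξ 1))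
      map_add' := fun A B => by
        simp only [mul_add, add_mul, map_add, Finset.sum_add_distrib]
      map_smul' := fun c A => by
        simp only [mul_smul_comm, smul_mul_assoc, map_smul, smul_eq_mul, ← Finset.mul_sum,
          RingHom.id_apply]
        ring }
  nonneg A := by
    refine mul_nonneg (by positivity) (Finset.sum_nonneg fun ξ _ => Finset.sum_nonneg fun η _ => ?_)
    rw [twirl_aux]
    exact ω.nonneg _
  normalized := by
    have h : ∀ ξ η : Λ → Fin D, ω (obs Λ (Matrix.single ξ η 1) * 1 * obs Λ (Matrix.single η ξ 1)) =
        ω (obs Λ (Matrix.single ξ ξ 1)) := by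
      intro ξ η
      rw [mul_one, ← map_mul, Matrix.single_mul_single_same, mul_one]
    change _ * ∑ ξ, ∑ η, ω (obs Λ (Matrix.single ξ η 1) * 1 * obs Λ (Matrix.single η ξ 1)) = 1
    simp only [h]
    rw [Finset.sum_comm]
    simp only [sum_apply_obs_single, Finset.sum_const, Finset.card_univ, nsmul_eq_mul, mul_one]
    exact inv_mul_cancel₀ (Nat.cast_ne_zero.2 Fintype.card_ne_zero)

theorem twirl_apply [NeZero D] (Λ : Finset (Site ν)) (A : QuasilocalAlg ν D) :
    ω.twirl Λ A = (Fintype.card (Λ → Fin D) : ℂ)⁻¹ * ∑ ξ, ∑ η,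
      ω (obs Λ (Matrix.single ξ η 1) * A * obs Λ (Matrix.single η ξ 1)) := rfl

theorem twirl_obs [NeZero D] (Λ : Finset (Site ν)) (M : Matrix (Λ → Fin D) (Λ → Fin D) ℂ) :
    ω.twirl Λ (obs Λ M) = (Fintype.card (Λ → Fin D) : ℂ)⁻¹ * M.trace := by
  rw [twirl_apply]
  congr 1
  have h : ∀ ξ η : Λ → Fin D, ω (obs Λ (Matrix.single ξ η 1) * obs Λ M * obs Λ (Matrix.single η ξ 1))
      = M η η * ω (obs Λ (Matrix.single ξ ξ 1)) := by
    intro ξ η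
    rw [← map_mul, ← map_mul, Matrix.single_mul_mul_single, one_mul, mul_one]
    have : Matrix.single ξ ξ (M η η) = M η η • Matrix.single ξ ξ (1 : ℂ) := by
      rw [Matrix.smul_single, smul_eq_mul, mul_one]
    rw [this, _root_.map_smul, _root_.map_smul, smul_eq_mul]
  simp only [h]
  rw [Finset.sum_comm]
  simp only [← Finset.mul_sum, sum_apply_obs_single, mul_one]
  rfl

theorem faithfulOn_twirl [NeZero D] (Λ : Finset (Site ν)) : (ω.twirl Λ).FaithfulOn Λ := by
  intro A hA hA0
  obtain ⟨M, rfl⟩ := isLocal_iff.1 hA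
  have hM : M ≠ 0 := fun h => hA0 (by rw [h, map_zero])
  rw [← StarHomClass.map_star, ← map_mul, twirl_obs]
  have h1 : ((star M * M).trace).re = ∑ η, ∑ ξ, Complex.normSq (M ξ η) := by
    simp only [Matrix.trace, Matrix.diag_apply, Matrix.mul_apply, Matrix.star_apply, Complex.re_sum,
      RCLike.star_def, mul_comm ((starRingEnd ℂ) _), Complex.mul_conj, Complex.ofReal_re]
  have h2 : ((Fintype.card (Λ → Fin D) : ℂ)⁻¹ * (star M * M).trace).re =
      (Fintype.card (Λ → Fin D) : ℝ)⁻¹ * (star M * M).trace.re := by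
    rw [← Complex.re_ofReal_mul]
    push_cast
    rfl
  rw [h2, h1]
  refine mul_pos (inv_pos.2 (Nat.cast_pos.2 Fintype.card_pos)) ?_
  obtain ⟨ξ, η, h⟩ : ∃ ξ η, M ξ η ≠ 0 := by
    by_contra! h
    exact hM (Matrix.ext h)
  refine Finset.sum_pos' (fun _ _ => Finset.sum_nonneg fun _ _ => Complex.normSq_nonneg _)
    ⟨η, Finset.mem_univ _, Finset.sum_pos' (fun _ _ => Complex.normSq_nonneg _)
      ⟨ξ, Finset.mem_univ _, Complex.normSq_pos.2 h⟩⟩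

variable {ω}

theorem FaithfulOn.twirl [NeZero D] {Λ Λ₀ : Finset (Site ν)} (h : ω.FaithfulOn Λ) (hΛ : Λ₀ ⊆ Λ) :
    (ω.twirl Λ₀).FaithfulOn Λ := by
  intro A hA hA0
  rw [twirl_apply]
  have h2 : ∀ z : ℂ, ((Fintype.card (Λ₀ → Fin D) : ℂ)⁻¹ * z).re =
      (Fintype.card (Λ₀ → Fin D) : ℝ)⁻¹ * z.re := by
    intro z
    rw [← Complex.re_ofReal_mul]
    push_cast
    rfl
  rw [h2]
  simp only [twirl_aux, Complex.re_sum]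
  refine mul_pos (inv_pos.2 (Nat.cast_pos.2 Fintype.card_pos)) ?_
  -- The diagonal matrix units sum to `1`, so they cannot all annihilate `A`; one strictly positive
  -- term of the twirl is enough.
  obtain ⟨ξ, hξ⟩ : ∃ ξ, A * obs Λ₀ (Matrix.single ξ ξ 1) ≠ 0 := by
    by_contra! h0
    apply hA0
    rw [← mul_one A, ← sum_obs_single Λ₀, Finset.mul_sum]
    exact Finset.sum_eq_zero fun ξ _ => h0 ξ
  refine Finset.sum_pos' (fun _ _ => Finset.sum_nonneg fun _ _ => ω.re_nonneg _)
    ⟨ξ, Finset.mem_univ _, Finset.sum_pos' (fun _ _ => ω.re_nonneg _)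
      ⟨ξ, Finset.mem_univ _, h _ (hA.mul ((isLocal_obs _ _).mono hΛ)) hξ⟩⟩

theorem FaithfulOn.mix {ω' : State ν D} {Λ : Finset (Site ν)} (h : ω'.FaithfulOn Λ) {ε : ℝ}
    (h0 : 0 < ε) (h1 : ε ≤ 1) : (ω.mix ω' ε h0.le h1).FaithfulOn Λ := by
  intro A hA hA0
  rw [mix_apply, Complex.add_re, Complex.re_ofReal_mul, Complex.re_ofReal_mul]
  exact add_pos_of_nonneg_of_pos (mul_nonneg (sub_nonneg.2 h1) (ω.re_nonneg A))
    (mul_pos h0 (h A hA hA0))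

theorem FaithfulOn.comp {Λ : Finset (Site ν)} (h : ω.FaithfulOn Λ)
    {θ : QuasilocalAlg ν D ≃⋆ₐ[ℂ] QuasilocalAlg ν D} (hθ : ∀ A, IsLocal Λ A → IsLocal Λ (θ A)) :
    (ω.comp θ).FaithfulOn Λ := by
  intro A hA hA0
  have h1 := h (θ A) (hθ A hA) fun h0 => hA0 (by simpa using h0)
  rw [← StarHomClass.map_star, ← map_mul] at h1
  exact h1

end State

/-! ### Strong subadditivity -/

section Extend

theorem exists_obs_eq {Λ Λ' : Finset (Site ν)} (h : Λ ⊆ Λ')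
    (M : Matrix (Λ → Fin D) (Λ → Fin D) ℂ) : ∃ N, obs Λ' N = obs Λ M :=
  isLocal_iff.1 ((isLocal_obs Λ M).mono h)

theorem trace_union {Λ₁ Λ₂ : Finset (Site ν)} (hd : Disjoint Λ₁ Λ₂)
    (M : Matrix ((Λ₁ ∪ Λ₂ : Finset (Site ν)) → Fin D) ((Λ₁ ∪ Λ₂ : Finset (Site ν)) → Fin D) ℂ) :
    M.trace = ∑ c, (Matrix.of fun ξ η => M (glue ξ c) (glue η c)).trace := by
  rw [Matrix.trace, ← (glueEquiv hd).sum_comp, Fintype.sum_prod_type, Finset.sum_comm]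
  rfl

/-- The matrix over `Λ' ⊇ Λ` of an observable given by a matrix over `Λ`. -/
def extendFun {Λ Λ' : Finset (Site ν)} (h : Λ ⊆ Λ') (M : Matrix (Λ → Fin D) (Λ → Fin D) ℂ) :
    Matrix (Λ' → Fin D) (Λ' → Fin D) ℂ :=
  (exists_obs_eq h M).choose

theorem obs_extendFun {Λ Λ' : Finset (Site ν)} (h : Λ ⊆ Λ')
    (M : Matrix (Λ → Fin D) (Λ → Fin D) ℂ) : obs Λ' (extendFun h M) = obs Λ M :=
  (exists_obs_eq h M).choose_spec

variable [NeZero D]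

/-- The embedding `𝒜(Λ) → 𝒜(Λ')` for `Λ ⊆ Λ'`, in terms of matrices. -/
def extend {Λ Λ' : Finset (Site ν)} (h : Λ ⊆ Λ') :
    Matrix (Λ → Fin D) (Λ → Fin D) ℂ →⋆ₐ[ℂ] Matrix (Λ' → Fin D) (Λ' → Fin D) ℂ where
  toFun := extendFun h
  map_one' := obs_injective Λ' (by rw [obs_extendFun, map_one, map_one])
  map_mul' M N := obs_injective Λ' (by rw [map_mul]; simp only [obs_extendFun, map_mul])
  map_zero' := obs_injective Λ' (by rw [obs_extendFun, map_zero, map_zero])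
  map_add' M N := obs_injective Λ' (by rw [map_add]; simp only [obs_extendFun, map_add])
  commutes' c := obs_injective Λ' (by
    rw [obs_extendFun, AlgHomClass.commutes, AlgHomClass.commutes])
  map_star' M := obs_injective Λ' (by
    rw [obs_extendFun, StarHomClass.map_star, StarHomClass.map_star, obs_extendFun])

theorem obs_extend {Λ Λ' : Finset (Site ν)} (h : Λ ⊆ Λ') (M : Matrix (Λ → Fin D) (Λ → Fin D) ℂ) :
    obs Λ' (extend h M) = obs Λ M :=
  obs_extendFun h M

theorem State.trace_density_mul_extend (ω : State ν D) {Λ Λ' : Finset (Site ν)} (h : Λ ⊆ Λ')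
    (M : Matrix (Λ → Fin D) (Λ → Fin D) ℂ) :
    (ω.density Λ' * extend h M).trace = (ω.density Λ * M).trace := by
  rw [← ω.apply_obs, ← ω.apply_obs, obs_extend]

theorem extend_cfc {Λ Λ' : Finset (Site ν)} (h : Λ ⊆ Λ') {M : Matrix (Λ → Fin D) (Λ → Fin D) ℂ}
    (hM : M.IsHermitian) (f : ℝ → ℝ) : extend h (cfc f M) = cfc f (extend h M) := by
  refine StarAlgHomClass.map_cfc (S := ℂ) (extend h) f M (continuousOn_spectrum _ _) ?_
    hM.isSelfAdjoint (hM.isSelfAdjoint.map (extend h))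
  exact LinearMap.continuous_of_finiteDimensional
    (extend (D := D) h).toAlgHom.toLinearMap

theorem extend_union_apply {Λ₁ Λ₂ : Finset (Site ν)} (hd : Disjoint Λ₁ Λ₂)
    (M : Matrix (Λ₁ → Fin D) (Λ₁ → Fin D) ℂ) (ξ η : Λ₁ → Fin D) (c d : Λ₂ → Fin D) :
    extend (Finset.subset_union_left (s₂ := Λ₂)) M (glue ξ c) (glue η d) =
      if c = d then M ξ η else 0 := by
  classical
  let E : Matrix ((Λ₁ ∪ Λ₂ : Finset (Site ν)) → Fin D) ((Λ₁ ∪ Λ₂ : Finset (Site ν)) → Fin D) ℂ :=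
    Matrix.of fun ξ η => if ((glueEquiv hd).symm ξ).2 = ((glueEquiv hd).symm η).2 then
    M ((glueEquiv hd).symm ξ).1 ((glueEquiv hd).symm η).1 else 0
  have key : ∀ (ξ : Λ₁ → Fin D) (c : Λ₂ → Fin D),
      (glueEquiv hd).symm (glue ξ c) = (ξ, c) := fun ξ c =>
    (glueEquiv hd).symm_apply_apply (ξ, c)
  have hE : obs (Λ₁ ∪ Λ₂) E = obs Λ₁ M := by
    rw [obs_union hd]
    simp only [E, Matrix.of_apply, key]
    have : ∀ c : Λ₂ → Fin D, ∑ d, obs Λ₁ (Matrix.of fun ξ η => if c = d then M ξ η else 0) *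
        obs Λ₂ (Matrix.single c d 1) = obs Λ₁ M * obs Λ₂ (Matrix.single c c 1) := by
      intro c
      rw [Finset.sum_eq_single c]
      · congr 2
        ext ξ η
        simp
      · intro d _ hd
        have : (Matrix.of fun ξ η => if c = d then M ξ η else 0) = 0 := by
          ext ξ η; simp [Ne.symm hd]
        rw [this, map_zero, zero_mul]
      · simp
    rw [Finset.sum_congr rfl fun c _ => this c, ← Finset.mul_sum, sum_obs_single, mul_one]
  have hE' : extend (Finset.subset_union_left (s₂ := Λ₂)) M = E :=
    obs_injective _ ((obs_extend _ M).trans hE.symm)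
  rw [hE']
  simp only [E, Matrix.of_apply, key]

/-- With respect to the trace, the dual of the embedding `extend` is the partial trace over `Λ₂`. -/
theorem trace_extend_mul {Λ₁ Λ₂ : Finset (Site ν)} (hd : Disjoint Λ₁ Λ₂)
    (N : Matrix (Λ₁ → Fin D) (Λ₁ → Fin D) ℂ)
    (M : Matrix ((Λ₁ ∪ Λ₂ : Finset (Site ν)) → Fin D) ((Λ₁ ∪ Λ₂ : Finset (Site ν)) → Fin D) ℂ) :
    (extend (Finset.subset_union_left (s₂ := Λ₂)) N * M).trace =
      ∑ c, (N * Matrix.of fun ξ η => M (glue ξ c) (glue η c)).trace := by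
  rw [trace_union hd]
  refine Finset.sum_congr rfl fun c _ => congrArg Matrix.trace ?_
  ext ξ η
  rw [Matrix.of_apply, Matrix.mul_apply, Matrix.mul_apply, ← (glueEquiv hd).sum_comp,
    Fintype.sum_prod_type]
  refine Finset.sum_congr rfl fun ζ _ => ?_
  have : ∀ d, extend (Finset.subset_union_left (s₂ := Λ₂)) N (glue ξ c) (glueEquiv hd (ζ, d)) *
      M (glueEquiv hd (ζ, d)) (glue η c) = if c = d then N ξ ζ * M (glue ζ c) (glue η c) else 0 := by
    intro d
    change extend _ N (glue ξ c) (glue ζ d) * M (glue ζ d) (glue η c) = _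
    rw [extend_union_apply hd]
    by_cases h : c = d
    · subst h; simp
    · simp [h]
  rw [Finset.sum_congr rfl fun d _ => this d]
  simp

end Extend

/-! ### Twirled states and conditional entropy -/

namespace State

variable [NeZero D] (ω : State ν D)

/-- The matrix units over `Λ₂` commute with the factor over `Λ₁` and average the other factor to its
normalised trace. The twirl is thus `ω` on `Λ₁` tensored with the trace on `Λ₂`. -/
theorem twirl_obs_mul {Λ₁ Λ₂ : Finset (Site ν)} (hd : Disjoint Λ₁ Λ₂)
    (N : Matrix (Λ₁ → Fin D) (Λ₁ → Fin D) ℂ) (c d : Λ₂ → Fin D) :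
    ω.twirl Λ₂ (obs Λ₁ N * obs Λ₂ (Matrix.single c d 1)) =
      if c = d then (Fintype.card (Λ₂ → Fin D) : ℂ)⁻¹ * ω (obs Λ₁ N) else 0 := by
  have hcomm : ∀ M, Commute (obs Λ₁ N) (obs Λ₂ M) := fun M =>
    (isLocal_obs Λ₁ N).commute hd (isLocal_obs Λ₂ M)
  have h : ∀ ξ η : Λ₂ → Fin D, ω (obs Λ₂ (Matrix.single ξ η 1) *
      (obs Λ₁ N * obs Λ₂ (Matrix.single c d 1)) * obs Λ₂ (Matrix.single η ξ 1)) =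
      Matrix.single c d (1 : ℂ) η η * ω (obs Λ₁ N * obs Λ₂ (Matrix.single ξ ξ 1)) := by
    intro ξ η
    rw [← mul_assoc, ← (hcomm _).eq, mul_assoc, mul_assoc, ← mul_assoc (obs Λ₂ _), ← map_mul,
      ← map_mul, Matrix.single_mul_mul_single, one_mul, mul_one]
    have : Matrix.single ξ ξ (Matrix.single c d (1 : ℂ) η η) =
        Matrix.single c d (1 : ℂ) η η • Matrix.single ξ ξ (1 : ℂ) := by
      rw [Matrix.smul_single, smul_eq_mul, mul_one]
    rw [this, _root_.map_smul, mul_smul_comm, _root_.map_smul, smul_eq_mul]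
  rw [twirl_apply]
  simp only [h]
  rw [Finset.sum_comm]
  have h2 : ∑ ξ, ω (obs Λ₁ N * obs Λ₂ (Matrix.single ξ ξ 1)) = ω (obs Λ₁ N) := by
    rw [← map_sum, ← Finset.mul_sum, sum_obs_single, mul_one]
  simp only [← Finset.mul_sum, h2, ← Finset.sum_mul]
  have h3 : ∑ η, Matrix.single c d (1 : ℂ) η η = if c = d then 1 else 0 := by
    by_cases hcd : c = d
    · subst hcd; simp [Matrix.single_apply]
    · rw [if_neg hcd]
      refine Finset.sum_eq_zero fun η _ => ?_
      rw [Matrix.single_apply, if_neg]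
      rintro ⟨rfl, rfl⟩
      exact hcd rfl
  rw [h3]
  by_cases hcd : c = d <;> simp [hcd]

theorem density_twirl_union {Λ₁ Λ₂ : Finset (Site ν)} (hd : Disjoint Λ₁ Λ₂) :
    (ω.twirl Λ₂).density (Λ₁ ∪ Λ₂) = extend Finset.subset_union_left
      ((Fintype.card (Λ₂ → Fin D) : ℝ)⁻¹ • ω.density Λ₁) := by
  refine eq_density _ fun M => ?_
  rw [trace_extend_mul hd, obs_union hd]
  simp only [map_sum, twirl_obs_mul _ hd, Finset.sum_ite_eq, Finset.mem_univ, if_true,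
    ω.apply_obs, Matrix.smul_mul, Matrix.trace_smul]
  refine Finset.sum_congr rfl fun c _ => ?_
  rw [Complex.real_smul]
  push_cast
  rfl

end State

theorem cfc_log_smul {n : Type*} [Fintype n] [DecidableEq n] {ρ : Matrix n n ℂ} (hρ : ρ.PosDef)
    {c : ℝ} (hc : 0 < c) :
    cfc Real.log (c • ρ) = cfc Real.log ρ + algebraMap ℝ (Matrix n n ℂ) (Real.log c) := by
  rw [← cfc_comp_smul c Real.log ρ ?_ hρ.isHermitian.isSelfAdjoint,
    ← cfc_add_const (Real.log c) Real.log ρ (continuousOn_spectrum _ _) hρ.isHermitian.isSelfAdjoint]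
  · refine cfc_congr fun x hx => ?_
    rw [hρ.isHermitian.spectrum_real_eq_range_eigenvalues] at hx
    obtain ⟨i, rfl⟩ := hx
    simp only [smul_eq_mul]
    rw [Real.log_mul hc.ne' (hρ.eigenvalues_pos i).ne', add_comm]
  · exact (Matrix.finite_real_spectrum.image _).continuousOn _

namespace State

variable [NeZero D] {ω : State ν D}

/-- The logarithm of `ρ ⊗ d⁻¹ 1` is `log ρ ⊗ 1 - log d`, so up to the constant `log d` this relative
entropy is minus the conditional entropy of `Λ₂` given `Λ₁`. Klein's inequality then bounds the
conditional entropy, and monotonicity gives strong subadditivity. -/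
theorem relativeEntropy_twirl {Λ₁ Λ₂ : Finset (Site ν)} (hd : Disjoint Λ₁ Λ₂)
    (h : ω.FaithfulOn (Λ₁ ∪ Λ₂)) :
    relativeEntropy (ω.density (Λ₁ ∪ Λ₂)) ((ω.twirl Λ₂).density (Λ₁ ∪ Λ₂)) =
      ω.localEntropy Λ₁ - ω.localEntropy (Λ₁ ∪ Λ₂) + Real.log (Fintype.card (Λ₂ → Fin D)) := by
  have h1 : ω.FaithfulOn Λ₁ := h.mono Finset.subset_union_left
  have hc : (0 : ℝ) < (Fintype.card (Λ₂ → Fin D) : ℝ)⁻¹ :=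
    inv_pos.2 (Nat.cast_pos.2 Fintype.card_pos)
  have hsm : ((Fintype.card (Λ₂ → Fin D) : ℝ)⁻¹ • ω.density Λ₁).IsHermitian :=
    (IsSelfAdjoint.all _).smul (ω.isHermitian_density Λ₁).isSelfAdjoint
  rw [relativeEntropy, density_twirl_union _ hd, ← extend_cfc _ hsm, trace_density_mul_extend,
    cfc_log_smul h1.posDef hc, mul_add, Matrix.trace_add, Complex.add_re,
    Algebra.algebraMap_eq_smul_one, mul_smul_comm, mul_one, Matrix.trace_smul, trace_density,
    localEntropy, localEntropy, Real.log_inv]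
  have h2 : (ω.density Λ₁ * cfc Real.log (ω.density Λ₁)).trace.re =
      -vonNeumannEntropy (ω.density Λ₁) := by
    rw [vonNeumannEntropy, Complex.neg_re, neg_neg]
  rw [h2, Complex.real_smul, mul_one, Complex.ofReal_re]
  ring

theorem FaithfulOn.localEntropy_union_sub_le_log {Λ₁ Λ₂ : Finset (Site ν)} (hd : Disjoint Λ₁ Λ₂)
    (h : ω.FaithfulOn (Λ₁ ∪ Λ₂)) :
    ω.localEntropy (Λ₁ ∪ Λ₂) - ω.localEntropy Λ₁ ≤ Real.log (Fintype.card (Λ₂ → Fin D)) := by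
  have h1 := relativeEntropy_nonneg h.posDef.posSemidef (ω.trace_density _)
    (h.twirl Finset.subset_union_right).posDef ((ω.twirl Λ₂).trace_density _)
  rw [relativeEntropy_twirl hd h] at h1
  linarith

theorem FaithfulOn.localEntropy_union_sub_le {Λ₁ Λ₂ Λ : Finset (Site ν)} (hd : Disjoint Λ₁ Λ)
    (h : ω.FaithfulOn (Λ₁ ∪ Λ)) (hsub : Λ₂ ⊆ Λ₁) :
    ω.localEntropy (Λ₁ ∪ Λ) - ω.localEntropy Λ₁ ≤
      ω.localEntropy (Λ₂ ∪ Λ) - ω.localEntropy Λ₂ := by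
  have hsub' : Λ₂ ∪ Λ ⊆ Λ₁ ∪ Λ := Finset.union_subset_union_left hsub
  have h' := h.mono hsub'
  -- The same region `Λ` is twirled on both sides, so the two constants `log d` cancel.
  have key := relativeEntropy_le_of_restrict h'.posDef (h'.twirl Finset.subset_union_right).posDef
    h.posDef (h.twirl Finset.subset_union_right).posDef (ω.trace_density _) (ω.trace_density _)
    (extend hsub') (map_mul _) (StarHomClass.map_star _)
    (fun X => ω.trace_density_mul_extend hsub' X)
    (fun X => (ω.twirl Λ).trace_density_mul_extend hsub' X)
  rw [relativeEntropy_twirl hd h, relativeEntropy_twirl (hd.mono_left hsub) h'] at key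
  linarith

variable (ω)

/-- Every state is a limit of states that are faithful on a given local algebra. -/
theorem tendsto_localEntropy_mix (ω ω' : State ν D) (Λ : Finset (Site ν)) :
    Tendsto (fun n : ℕ => (ω.mix ω' (1 / ((n : ℝ) + 1)) (by positivity)
      (div_le_one_of_le₀ (by linarith [n.cast_nonneg (α := ℝ)]) (by positivity))).localEntropy Λ)
      atTop (𝓝 (ω.localEntropy Λ)) := by
  refine tendsto_localEntropy fun A _ => ?_
  simp only [mix_apply]
  have h : Tendsto (fun n : ℕ => ((1 / ((n : ℝ) + 1) : ℝ) : ℂ)) atTop (𝓝 0) := by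
    rw [← Complex.ofReal_zero]
    exact (Complex.continuous_ofReal.tendsto _).comp tendsto_one_div_add_atTop_nhds_zero_nat
  have h' : Tendsto (fun n : ℕ => ((1 - 1 / ((n : ℝ) + 1) : ℝ) : ℂ)) atTop (𝓝 1) := by
    simpa using h.const_sub 1
  simpa using (h'.mul_const (ω A)).add (h.mul_const (ω' A))

/-- Subadditivity of the entropy, with the bound by the dimension. -/
theorem localEntropy_union_sub_le_log {Λ₁ Λ₂ : Finset (Site ν)} (hd : Disjoint Λ₁ Λ₂) :
    ω.localEntropy (Λ₁ ∪ Λ₂) - ω.localEntropy Λ₁ ≤ Real.log (Fintype.card (Λ₂ → Fin D)) := by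
  refine le_of_tendsto ((tendsto_localEntropy_mix ω (ω.twirl (Λ₁ ∪ Λ₂)) (Λ₁ ∪ Λ₂)).sub
    (tendsto_localEntropy_mix ω (ω.twirl (Λ₁ ∪ Λ₂)) Λ₁)) (Eventually.of_forall fun n => ?_)
  exact FaithfulOn.localEntropy_union_sub_le_log hd
    ((faithfulOn_twirl ω (Λ₁ ∪ Λ₂)).mix (by positivity) _)

/-- Strong subadditivity of the entropy. -/
theorem localEntropy_union_sub_le {Λ₁ Λ₂ Λ : Finset (Site ν)} (hd : Disjoint Λ₁ Λ)
    (hsub : Λ₂ ⊆ Λ₁) :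
    ω.localEntropy (Λ₁ ∪ Λ) - ω.localEntropy Λ₁ ≤
      ω.localEntropy (Λ₂ ∪ Λ) - ω.localEntropy Λ₂ := by
  refine le_of_tendsto_of_tendsto ((tendsto_localEntropy_mix ω (ω.twirl (Λ₁ ∪ Λ)) (Λ₁ ∪ Λ)).sub
    (tendsto_localEntropy_mix ω (ω.twirl (Λ₁ ∪ Λ)) Λ₁))
    ((tendsto_localEntropy_mix ω (ω.twirl (Λ₁ ∪ Λ)) (Λ₂ ∪ Λ)).sub
    (tendsto_localEntropy_mix ω (ω.twirl (Λ₁ ∪ Λ)) Λ₂)) (Eventually.of_forall fun n => ?_)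
  exact FaithfulOn.localEntropy_union_sub_le hd
    ((faithfulOn_twirl ω (Λ₁ ∪ Λ)).mix (by positivity) _) hsub

end State

/-! ### The van Hove limit -/

/-- The index of the cell that contains a given site. -/
def cellIndex (a : Fin ν → ℕ) (x : Site ν) : Site ν := fun i => x i / a i

theorem mem_cell {a : Fin ν → ℕ} (ha : ∀ i, 0 < a i) {x n : Site ν} :
    x ∈ cell a n ↔ cellIndex a x = n := by
  rw [cell, Fintype.mem_piFinset, funext_iff]
  refine forall_congr' fun i => ?_
  have h : (0 : ℤ) < a i := by exact_mod_cast ha i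
  rw [Finset.mem_Ico, cellIndex, ← Int.le_ediv_iff_mul_le h, ← Int.ediv_lt_iff_lt_mul h]
  omega

theorem card_cell (a : Fin ν → ℕ) (n : Site ν) : (cell a n).card = ∏ i, a i := by
  rw [cell, Fintype.card_piFinset]
  refine Finset.prod_congr rfl fun i _ => ?_
  rw [Int.card_Ico, add_mul, one_mul, add_sub_cancel_left, Int.toNat_natCast]

theorem cell_nonempty {a : Fin ν → ℕ} (ha : ∀ i, 0 < a i) (n : Site ν) : (cell a n).Nonempty := by
  rw [← Finset.card_pos, card_cell]
  exact Finset.prod_pos fun i _ => ha i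

theorem setOf_cell_inter_nonempty {a : Fin ν → ℕ} (ha : ∀ i, 0 < a i) (Λ : Finset (Site ν)) :
    {n : Site ν | (cell a n ∩ Λ).Nonempty} = (Λ.image (cellIndex a) : Finset (Site ν)) := by
  ext n
  simp only [Set.mem_ofPred_eq, Finset.coe_image, Set.mem_image, Finset.mem_coe]
  constructor
  · rintro ⟨x, hx⟩
    rw [Finset.mem_inter, mem_cell ha] at hx
    exact ⟨x, hx.2, hx.1⟩
  · rintro ⟨x, hx, rfl⟩
    exact ⟨x, Finset.mem_inter.2 ⟨(mem_cell ha).2 rfl, hx⟩⟩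

theorem outerCells_eq {a : Fin ν → ℕ} (ha : ∀ i, 0 < a i) (Λ : Finset (Site ν)) :
    outerCells a Λ = (Λ.image (cellIndex a)).card := by
  rw [outerCells, setOf_cell_inter_nonempty ha, Set.ncard_coe_finset]

/-- The indices of the cells contained in `Λ`. -/
def innerIndices (a : Fin ν → ℕ) (Λ : Finset (Site ν)) : Finset (Site ν) :=
  (Λ.image (cellIndex a)).filter fun n => cell a n ⊆ Λ

theorem mem_innerIndices {a : Fin ν → ℕ} (ha : ∀ i, 0 < a i) {Λ : Finset (Site ν)} {n : Site ν} :
    n ∈ innerIndices a Λ ↔ cell a n ⊆ Λ := by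
  rw [innerIndices, Finset.mem_filter, and_iff_right_iff_imp]
  intro h
  obtain ⟨x, hx⟩ := cell_nonempty ha n
  exact Finset.mem_image.2 ⟨x, h hx, (mem_cell ha).1 hx⟩

theorem innerCells_eq {a : Fin ν → ℕ} (ha : ∀ i, 0 < a i) (Λ : Finset (Site ν)) :
    innerCells a Λ = (innerIndices a Λ).card := by
  rw [innerCells, ← Set.ncard_coe_finset]
  congr 1
  ext n
  rw [Finset.mem_coe, mem_innerIndices ha, Set.mem_ofPred_eq]

theorem innerCells_le_outerCells {a : Fin ν → ℕ} (ha : ∀ i, 0 < a i) (Λ : Finset (Site ν)) :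
    innerCells a Λ ≤ outerCells a Λ := by
  rw [innerCells_eq ha, outerCells_eq ha]
  exact Finset.card_le_card (Finset.filter_subset _ _)

theorem card_le_outerCells_mul {a : Fin ν → ℕ} (ha : ∀ i, 0 < a i) (Λ : Finset (Site ν)) :
    Λ.card ≤ outerCells a Λ * ∏ i, a i := by
  rw [outerCells_eq ha, mul_comm]
  refine Finset.card_le_mul_card_image Λ _ fun n _ => ?_
  rw [← card_cell a n]
  refine Finset.card_le_card fun x hx => ?_
  exact (mem_cell ha).2 (Finset.mem_filter.1 hx).2

/-- Distinct cells are disjoint, so their cores `t n` are counted without overlap. Whole cells give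
a bound on the volume, shrunken cells a bound on the bulk. -/
theorem innerCells_mul_le_of_cores {a : Fin ν → ℕ} (ha : ∀ i, 0 < a i) {Λ Λ' : Finset (Site ν)}
    {k : ℕ} {t : Site ν → Finset (Site ν)} (ht : ∀ n, t n ⊆ cell a n) (hk : ∀ n, (t n).card = k)
    (h : ∀ n, cell a n ⊆ Λ → t n ⊆ Λ') : innerCells a Λ * k ≤ Λ'.card := by
  classical
  have hd : (innerIndices a Λ : Set (Site ν)).PairwiseDisjoint t := by
    intro n _ m _ hnm
    refine Finset.disjoint_left.2 fun x hx hx' => hnm ?_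
    rw [← (mem_cell ha).1 (ht n hx), (mem_cell ha).1 (ht m hx')]
  have h1 : (innerIndices a Λ).biUnion t ⊆ Λ' := by
    intro x hx
    obtain ⟨n, hn, hx⟩ := Finset.mem_biUnion.1 hx
    exact h n ((mem_innerIndices ha).1 hn) hx
  have h2 := Finset.card_le_card h1
  rw [Finset.card_biUnion hd, Finset.sum_congr rfl fun n _ => hk n, Finset.sum_const,
    smul_eq_mul] at h2
  rwa [innerCells_eq ha]

theorem innerCells_mul_le_card {a : Fin ν → ℕ} (ha : ∀ i, 0 < a i) (Λ : Finset (Site ν)) :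
    innerCells a Λ * ∏ i, a i ≤ Λ.card :=
  innerCells_mul_le_of_cores ha (fun _ => subset_rfl) (card_cell a) fun _ h => h

/-- The cube of the sites with all coordinates in `[-r, r]`. -/
def cube (ν r : ℕ) : Finset (Site ν) := Fintype.piFinset fun _ => Finset.Icc (-(r : ℤ)) r

theorem mem_cube {r : ℕ} {x : Site ν} : x ∈ cube ν r ↔ ∀ i, -(r : ℤ) ≤ x i ∧ x i ≤ r := by
  simp [cube, Fintype.mem_piFinset]

theorem mem_translateSet {x y : Site ν} {Λ : Finset (Site ν)} :
    y ∈ translateSet x Λ ↔ y - x ∈ Λ := by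
  simp only [translateSet, Finset.mem_map, addRightEmbedding_apply]
  constructor
  · rintro ⟨z, hz, rfl⟩
    simpa using hz
  · intro h
    exact ⟨_, h, by simp⟩

/-- The sites of `Λ` whose `r`-neighbourhood is contained in `Λ`. -/
def bulk (r : ℕ) (Λ : Finset (Site ν)) : Finset (Site ν) :=
  Λ.filter fun x => translateSet x (cube ν r) ⊆ Λ

/-- The core is the cell with a margin `r` removed on every side; the `r`-neighbourhood of each of
its points stays in the cell. -/
theorem innerCells_mul_le_card_bulk {L r : ℕ} (hL : 2 * r < L) (Λ : Finset (Site ν)) :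
    innerCells (fun _ => L) Λ * (L - 2 * r) ^ ν ≤ (bulk r Λ).card := by
  have hL0 : ∀ _ : Fin ν, 0 < L := fun _ => by omega
  refine innerCells_mul_le_of_cores (t := fun n => Fintype.piFinset fun i =>
    Finset.Ico (n i * L + r) ((n i + 1) * L - r)) hL0 ?_ ?_ ?_
  · intro n x hx
    rw [cell, Fintype.mem_piFinset]
    rw [Fintype.mem_piFinset] at hx
    intro i
    have := Finset.mem_Ico.1 (hx i)
    exact Finset.mem_Ico.2 ⟨by omega, by omega⟩
  · intro n
    rw [Fintype.card_piFinset]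
    simp only [Int.card_Ico]
    rw [Finset.prod_congr rfl (g := fun _ => L - 2 * r), Finset.prod_const, Finset.card_univ,
      Fintype.card_fin]
    intro i _
    have : (n i + 1) * (L : ℤ) - r - (n i * L + r) = L - 2 * r := by ring
    rw [this]
    omega
  · intro n hn x hx
    rw [Fintype.mem_piFinset] at hx
    have key : translateSet x (cube ν r) ⊆ Λ := by
      intro y hy
      rw [mem_translateSet, mem_cube] at hy
      refine hn ?_
      rw [cell, Fintype.mem_piFinset]
      intro i
      have h1 := hy i
      have h2 := Finset.mem_Ico.1 (hx i)
      simp only [Pi.sub_apply] at h1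
      exact Finset.mem_Ico.2 ⟨by omega, by omega⟩
    refine Finset.mem_filter.2 ⟨key ?_, key⟩
    rw [mem_translateSet, sub_self, mem_cube]
    intro i
    simp

theorem tendsto_innerCells {a : Fin ν → ℕ} (ha : ∀ i, 0 < a i) :
    Tendsto (innerCells a) (vanHove ν) atTop :=
  tendsto_comap.mono_left ((iInf₂_le a ha).trans inf_le_left)

theorem tendsto_innerCells_div_outerCells {a : Fin ν → ℕ} (ha : ∀ i, 0 < a i) :
    Tendsto (fun Λ => (innerCells a Λ : ℝ) / (outerCells a Λ : ℝ)) (vanHove ν) (𝓝 1) :=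
  tendsto_comap.mono_left ((iInf₂_le a ha).trans inf_le_right)

theorem tendsto_card_vanHove : Tendsto (fun Λ : Finset (Site ν) => Λ.card) (vanHove ν) atTop := by
  refine tendsto_atTop_mono (fun Λ => ?_) (tendsto_innerCells (a := fun _ => 1) fun _ => one_pos)
  have h := innerCells_mul_le_card (a := fun _ => 1) (fun _ => one_pos) Λ
  simpa using h

/-- With cells of side `L`, the bulk contains at least the fraction `(1 - 2r/L)^ν ≥ 1 - 2νr/L` of
every inner cell (Bernoulli). The choice of `L` makes this loss less than `ε/2`; the remaining loss
comes from the ratio of outer to inner cells, which tends to one. -/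
theorem tendsto_bulk_vanHove (r : ℕ) :
    Tendsto (fun Λ : Finset (Site ν) => ((Λ.card : ℝ) - ((bulk r Λ).card : ℝ)) / (Λ.card : ℝ))
      (vanHove ν) (𝓝 0) := by
  rw [Metric.tendsto_nhds]
  intro ε hε
  obtain ⟨L, hL⟩ : ∃ L : ℕ, 2 * r < L ∧ (ν : ℝ) * (2 * r / L) < ε / 2 := by
    have h1 : Tendsto (fun L : ℕ => (ν : ℝ) * (2 * r / (L : ℝ))) atTop (𝓝 0) := by
      simpa using (tendsto_const_div_atTop_nhds_zero_nat (2 * (r : ℝ))).const_mul (ν : ℝ)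
    obtain ⟨L, h, h'⟩ := ((eventually_gt_atTop (2 * r)).and
      (h1.eventually_lt_const (half_pos hε))).exists
    exact ⟨L, h, h'⟩
  have hL0 : ∀ _ : Fin ν, 0 < L := fun _ => by omega
  have hLpos : (0 : ℝ) < L := by exact_mod_cast (by omega : 0 < L)
  have h2 : Tendsto (fun Λ : Finset (Site ν) => (outerCells (fun _ => L) Λ : ℝ) /
      (innerCells (fun _ => L) Λ : ℝ)) (vanHove ν) (𝓝 1) := by
    have := (tendsto_innerCells_div_outerCells hL0).inv₀ one_ne_zero
    simpa using this
  filter_upwards [h2.eventually_lt_const (show (1 : ℝ) < 1 + ε / 2 by linarith),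
    (tendsto_innerCells hL0).eventually_gt_atTop 0] with Λ h3 h4
  set I := innerCells (fun _ => L) Λ with hI
  set O := outerCells (fun _ => L) Λ with hO
  have c1 : (I : ℝ) * (L : ℝ) ^ ν ≤ Λ.card := by
    have := innerCells_mul_le_card hL0 Λ
    rw [Finset.prod_const, Finset.card_univ, Fintype.card_fin] at this
    exact_mod_cast this
  have c2 : (Λ.card : ℝ) ≤ O * (L : ℝ) ^ ν := by
    have := card_le_outerCells_mul hL0 Λ
    rw [Finset.prod_const, Finset.card_univ, Fintype.card_fin] at this
    exact_mod_cast this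
  have c3 : (I : ℝ) * ((L : ℝ) - 2 * r) ^ ν ≤ (bulk r Λ).card := by
    have h := innerCells_mul_le_card_bulk hL.1 Λ
    have h' : ((I * (L - 2 * r) ^ ν : ℕ) : ℝ) ≤ (bulk r Λ).card := by exact_mod_cast h
    rw [Nat.cast_mul, Nat.cast_pow, Nat.cast_sub hL.1.le] at h'
    simpa using h'
  have hI0 : (0 : ℝ) < I := by exact_mod_cast h4
  have hLν : (0 : ℝ) < (L : ℝ) ^ ν := by positivity
  have hcard : (0 : ℝ) < Λ.card := lt_of_lt_of_le (by positivity) c1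
  have c4 : 1 - ν * (2 * r / L) ≤ (1 - 2 * r / L : ℝ) ^ ν := by
    have hle : (2 * r / L : ℝ) ≤ 1 := by
      rw [div_le_one hLpos]
      exact_mod_cast hL.1.le
    have := one_add_mul_le_pow (a := (-(2 * r / L) : ℝ)) (by linarith) ν
    calc _ = 1 + (ν : ℝ) * (-(2 * r / L)) := by ring
      _ ≤ _ := this
      _ = _ := by ring
  have c5 : ((L : ℝ) - 2 * r) ^ ν = (1 - 2 * r / L : ℝ) ^ ν * (L : ℝ) ^ ν := by
    rw [← mul_pow]
    congr 1
    field_simp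
  have c6 : (O : ℝ) < (1 + ε / 2) * I := by rwa [div_lt_iff₀ hI0] at h3
  have hsub : ((bulk r Λ).card : ℝ) ≤ Λ.card := by
    exact_mod_cast Finset.card_le_card (Finset.filter_subset _ _)
  rw [Real.dist_eq, sub_zero, abs_of_nonneg (div_nonneg (sub_nonneg.2 hsub) hcard.le),
    div_lt_iff₀ hcard]
  have e1 : (I : ℝ) * L ^ ν * (1 - ν * (2 * r / L)) ≤ (bulk r Λ).card := by
    refine le_trans ?_ c3
    rw [c5, mul_assoc, mul_comm ((L : ℝ) ^ ν)]
    exact mul_le_mul_of_nonneg_left (mul_le_mul_of_nonneg_right c4 hLν.le) hI0.le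
  have e2 : (Λ.card : ℝ) < (1 + ε / 2) * (I * L ^ ν) := by
    calc (Λ.card : ℝ) ≤ O * (L : ℝ) ^ ν := c2
      _ < (1 + ε / 2) * I * L ^ ν := mul_lt_mul_of_pos_right c6 hLν
      _ = _ := by ring
  have e3 : (I : ℝ) * L ^ ν * (ν * (2 * r / L)) ≤ (I : ℝ) * L ^ ν * (ε / 2) :=
    mul_le_mul_of_nonneg_left hL.2.le (by positivity)
  nlinarith [mul_le_mul_of_nonneg_left c1 hε.le]

/-- The box of the sites with all coordinates in `[0, N)`. -/
def box (ν N : ℕ) : Finset (Site ν) := Fintype.piFinset fun _ => Finset.Ico 0 (N : ℤ)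

theorem innerCells_box {a : Fin ν → ℕ} (ha : ∀ i, 0 < a i) (N : ℕ) :
    ∏ i, (N / a i) ≤ innerCells a (box ν N) := by
  have h1 : (Fintype.piFinset fun i => Finset.Ico 0 ((N / a i : ℕ) : ℤ)).card = ∏ i, (N / a i) := by
    rw [Fintype.card_piFinset]
    simp only [Int.card_Ico, sub_zero, Int.toNat_natCast]
  rw [innerCells_eq ha, ← h1]
  refine Finset.card_le_card fun n hn => (mem_innerIndices ha).2 fun x hx => ?_
  rw [Fintype.mem_piFinset] at hn
  rw [cell, Fintype.mem_piFinset] at hx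
  rw [box, Fintype.mem_piFinset]
  intro i
  have h2 := Finset.mem_Ico.1 (hn i)
  have h3 := Finset.mem_Ico.1 (hx i)
  have ha' : (0 : ℤ) < a i := by exact_mod_cast ha i
  have h4 : (n i + 1) * (a i : ℤ) ≤ N := by
    rw [← Int.le_ediv_iff_mul_le ha']
    push_cast at h2
    omega
  exact Finset.mem_Ico.2 ⟨le_trans (mul_nonneg h2.1 ha'.le) h3.1, lt_of_lt_of_le h3.2 h4⟩

theorem outerCells_box {a : Fin ν → ℕ} (ha : ∀ i, 0 < a i) (N : ℕ) :
    outerCells a (box ν N) ≤ ∏ i, (N / a i + 1) := by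
  have h1 : (Fintype.piFinset fun i => Finset.Ico 0 ((N / a i + 1 : ℕ) : ℤ)).card =
      ∏ i, (N / a i + 1) := by
    rw [Fintype.card_piFinset]
    simp only [Int.card_Ico, sub_zero, Int.toNat_natCast]
  rw [outerCells_eq ha, ← h1]
  refine Finset.card_le_card fun n hn => ?_
  obtain ⟨x, hx, rfl⟩ := Finset.mem_image.1 hn
  rw [box, Fintype.mem_piFinset] at hx
  rw [Fintype.mem_piFinset]
  intro i
  have h2 := Finset.mem_Ico.1 (hx i)
  have ha' : (0 : ℤ) < a i := by exact_mod_cast ha i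
  refine Finset.mem_Ico.2 ⟨Int.ediv_nonneg h2.1 ha'.le, ?_⟩
  have h3 : x i / (a i : ℤ) ≤ N / (a i : ℤ) := Int.ediv_le_ediv ha' h2.2.le
  push_cast
  exact Int.lt_add_one_of_le h3

/-- Boxes show that the van Hove filter is nontrivial, without which `limUnder` would not be
determined by convergence. For `ν = 0` the number of inner cells could not tend to infinity. -/
theorem tendsto_box_vanHove [NeZero ν] : Tendsto (box ν) atTop (vanHove ν) := by
  rw [vanHove]
  simp only [tendsto_iInf, tendsto_inf, tendsto_comap_iff]
  intro a ha
  have hdiv : ∀ i, Tendsto (fun N : ℕ => N / a i) atTop atTop := fun i =>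
    Nat.tendsto_div_const_atTop (ha i).ne'
  have hev : ∀ᶠ N : ℕ in atTop, ∀ i, 1 ≤ N / a i :=
    eventually_all.2 fun i => (hdiv i).eventually_ge_atTop 1
  constructor
  · refine tendsto_atTop_mono' _ ?_ (hdiv 0)
    filter_upwards [hev] with N hN
    refine le_trans ?_ (innerCells_box ha N)
    exact Finset.single_le_prod' (f := fun i => N / a i) (fun i _ => hN i) (Finset.mem_univ 0)
  · have h1 : Tendsto (fun N : ℕ => ∏ i, (((N / a i : ℕ) : ℝ) / (((N / a i : ℕ) : ℝ) + 1)))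
        atTop (𝓝 1) := by
      have := tendsto_finsetProd (Finset.univ : Finset (Fin ν)) fun i _ =>
        (tendsto_natCast_div_add_atTop (1 : ℝ)).comp (hdiv i)
      simpa using this
    refine tendsto_of_tendsto_of_tendsto_of_le_of_le h1 tendsto_const_nhds (fun N => ?_)
      fun N => ?_
    · rw [Finset.prod_div_distrib]
      have hin : (∏ i, ((N / a i : ℕ) : ℝ)) ≤ innerCells a (box ν N) := by
        exact_mod_cast innerCells_box ha N
      have hout : (outerCells a (box ν N) : ℝ) ≤ ∏ i, (((N / a i : ℕ) : ℝ) + 1) := by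
        exact_mod_cast outerCells_box ha N
      rcases Nat.eq_zero_or_pos (outerCells a (box ν N)) with h0 | h0
      · have h0' : innerCells a (box ν N) = 0 := by
          have := innerCells_le_outerCells ha (box ν N)
          omega
        rw [h0', Nat.cast_zero] at hin
        have : (∏ i, ((N / a i : ℕ) : ℝ)) = 0 :=
          le_antisymm hin (Finset.prod_nonneg fun i _ => Nat.cast_nonneg _)
        simp [this, h0]
      · exact div_le_div₀ (Nat.cast_nonneg _) hin (Nat.cast_pos.2 h0) hout
    · exact div_le_one_of_le₀ (Nat.cast_le.2 (innerCells_le_outerCells ha (box ν N)))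
        (Nat.cast_nonneg _)

instance neBot_vanHove [NeZero ν] : (vanHove ν).NeBot := tendsto_box_vanHove.neBot

/-! ### Invariance of the entropy under `*`-isomorphisms of local algebras -/

section RealTrace

variable {n m : Type*} [Fintype n] [DecidableEq n] [Fintype m] [DecidableEq m]

/-- The real part of the trace is the only normalised real-linear `*`-invariant tracial functional
on a complex matrix algebra. -/
theorem eq_re_trace [Nonempty n] (f : Matrix n n ℂ →ₗ[ℝ] ℝ) (hmul : ∀ M N, f (M * N) = f (N * M))
    (hstar : ∀ M, f (star M) = f M) (hone : f 1 = Fintype.card n) (M : Matrix n n ℂ) :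
    f M = M.trace.re := by
  -- The trace property annihilates off-diagonal matrix units and equates the diagonal ones;
  -- `*`-invariance then removes the imaginary part of the coefficient.
  have hoff : ∀ i j z, i ≠ j → f (Matrix.single i j z) = 0 := by
    intro i j z hij
    have h1 : Matrix.single i j z = Matrix.single i j z * Matrix.single j j (1 : ℂ) := by
      rw [Matrix.single_mul_single_same, mul_one]
    rw [h1, hmul, Matrix.single_mul_single_of_ne _ _ _ _ hij.symm, map_zero]
  have hdiag : ∀ i j z, f (Matrix.single i i z) = f (Matrix.single j j z) := by
    intro i j z
    have h1 : Matrix.single i i z = Matrix.single i j z * Matrix.single j i (1 : ℂ) := by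
      rw [Matrix.single_mul_single_same, mul_one]
    rw [h1, hmul, Matrix.single_mul_single_same, one_mul]
  have hconj : ∀ i z, f (Matrix.single i i (star z)) = f (Matrix.single i i z) := by
    intro i z
    rw [← hstar (Matrix.single i i z), Matrix.star_eq_conjTranspose, Matrix.conjTranspose_single]
  have hone' : ∀ i, f (Matrix.single i i 1) = 1 := by
    intro i
    have h1 : (1 : Matrix n n ℂ) = ∑ j, Matrix.single j j 1 := by
      ext ξ η
      simp [Matrix.sum_apply, Matrix.single_apply, Matrix.one_apply, ite_and]
    rw [h1, map_sum, Finset.sum_congr rfl fun j _ => hdiag j i 1, Finset.sum_const,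
      Finset.card_univ, nsmul_eq_mul] at hone
    have hc : (Fintype.card n : ℝ) ≠ 0 := Nat.cast_ne_zero.2 Fintype.card_ne_zero
    exact mul_left_cancel₀ hc (by rw [hone, mul_one])
  have hre : ∀ i z, f (Matrix.single i i z) = z.re := by
    intro i z
    have h1 : Matrix.single i i z + Matrix.single i i (star z) =
        (2 * z.re) • Matrix.single i i (1 : ℂ) := by
      rw [← Matrix.single_add, Matrix.smul_single]
      congr 1
      rw [RCLike.star_def, Complex.add_conj]
      simp
    have h2 := congrArg f h1
    rw [map_add, hconj, map_smul, hone', smul_eq_mul, mul_one] at h2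
    linarith
  conv_lhs => rw [Matrix.matrix_eq_sum_single M]
  rw [map_sum, Matrix.trace, Complex.re_sum]
  refine Finset.sum_congr rfl fun i _ => ?_
  rw [map_sum, Finset.sum_eq_single i]
  · exact hre i _
  · intro j _ hj
    exact hoff i j _ hj.symm
  · simp

theorem re_trace_map [Nonempty m] (θ : Matrix m m ℂ →⋆ₐ[ℝ] Matrix n n ℂ)
    (hcard : Fintype.card n = Fintype.card m) (M : Matrix m m ℂ) :
    (θ M).trace.re = M.trace.re := by
  refine eq_re_trace
    { toFun := fun M => (θ M).trace.re
      map_add' := fun M N => by rw [map_add, Matrix.trace_add, Complex.add_re]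
      map_smul' := fun c M => by
        rw [map_smul, Matrix.trace_smul, Complex.smul_re, RingHom.id_apply] } ?_ ?_ ?_ M
  · intro M N
    change (θ (M * N)).trace.re = (θ (N * M)).trace.re
    rw [map_mul, map_mul, Matrix.trace_mul_comm]
  · intro M
    change (θ (star M)).trace.re = (θ M).trace.re
    rw [StarHomClass.map_star, Matrix.star_eq_conjTranspose, Matrix.trace_conjTranspose,
      RCLike.star_def, Complex.conj_re]
  · change (θ 1).trace.re = _
    rw [map_one, Matrix.trace_one, hcard]
    simp

theorem eq_of_re_trace_mul_eq {k : Type*} [Fintype k] {ρ σ : Matrix k k ℂ}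
    (h : ∀ M, (ρ * M).trace.re = (σ * M).trace.re) : ρ = σ := by
  have h1 := h (star (ρ - σ))
  rw [← sub_eq_zero, ← Complex.sub_re, ← Matrix.trace_sub, ← sub_mul] at h1
  have h2 : ((ρ - σ) * star (ρ - σ)).trace.re = ∑ i, ∑ j, Complex.normSq ((ρ - σ) i j) := by
    simp only [Matrix.trace, Matrix.diag_apply, Matrix.mul_apply, Matrix.star_apply, Complex.re_sum,
      RCLike.star_def, Complex.mul_conj, Complex.ofReal_re]
  rw [h2] at h1
  ext i j
  have h3 := (Finset.sum_eq_zero_iff_of_nonneg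
    fun i _ => Finset.sum_nonneg fun j _ => Complex.normSq_nonneg _).1 h1 i (Finset.mem_univ i)
  have h4 := (Finset.sum_eq_zero_iff_of_nonneg
    fun j _ => Complex.normSq_nonneg _).1 h3 j (Finset.mem_univ j)
  exact sub_eq_zero.1 (Complex.normSq_eq_zero.1 h4)

end RealTrace

/-- In matrix form `T` is a real `*`-homomorphism between algebras of equal dimension, hence
preserves the real part of the trace and carries one density matrix to the other. Only real
homogeneity of `T` is required, so the lemma serves translations and time reversals alike. -/
theorem State.localEntropy_eq_of_ringHom [NeZero D] {ω ω' : State ν D} {Λ Λ' : Finset (Site ν)}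
    (T : QuasilocalAlg ν D →+* QuasilocalAlg ν D) (hstar : ∀ A, T (star A) = star (T A))
    (hreal : ∀ (r : ℝ) A, T ((r : ℂ) • A) = (r : ℂ) • T A)
    (hloc : ∀ A, IsLocal Λ A → IsLocal Λ' (T A))
    (hsurj : ∀ B, IsLocal Λ' B → ∃ A, IsLocal Λ A ∧ T A = B) (hcard : Λ'.card = Λ.card)
    (h : ∀ A, IsLocal Λ A → (ω' (T A)).re = (ω A).re) :
    ω'.localEntropy Λ' = ω.localEntropy Λ := by
  have hex : ∀ M : Matrix (Λ → Fin D) (Λ → Fin D) ℂ, ∃ N, obs Λ' N = T (obs Λ M) := fun M =>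
    isLocal_iff.1 (hloc _ (isLocal_obs Λ M))
  choose F hF using hex
  let θ : Matrix (Λ → Fin D) (Λ → Fin D) ℂ →⋆ₐ[ℝ] Matrix (Λ' → Fin D) (Λ' → Fin D) ℂ :=
    { toFun := F
      map_one' := obs_injective Λ' (by rw [hF, map_one, map_one, map_one])
      map_mul' := fun M N => obs_injective Λ' (by rw [hF, map_mul, map_mul, map_mul, hF, hF])
      map_zero' := obs_injective Λ' (by rw [hF, map_zero, map_zero, map_zero])
      map_add' := fun M N => obs_injective Λ' (by rw [hF, map_add, map_add, map_add, hF, hF])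
      commutes' := fun r => obs_injective Λ' (by
        have e : ∀ {k : Type} [Fintype k] [DecidableEq k], algebraMap ℝ (Matrix k k ℂ) r =
            (r : ℂ) • 1 := fun {k} _ _ => by
          rw [Algebra.algebraMap_eq_smul_one]
          ext i j
          simp [Matrix.one_apply]
        rw [hF, e, e, map_smul (obs Λ), hreal, map_smul (obs Λ'), map_one, map_one, map_one])
      map_star' := fun M => obs_injective Λ' (by
        rw [hF, StarHomClass.map_star (obs Λ), hstar, StarHomClass.map_star (obs Λ'), hF]) }
  have hθ : ∀ M, obs Λ' (θ M) = T (obs Λ M) := hF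
  have hcard' : Fintype.card (Λ' → Fin D) = Fintype.card (Λ → Fin D) := by
    simp [hcard]
  have htr := re_trace_map θ hcard'
  have hρ : ω'.density Λ' = θ (ω.density Λ) := by
    refine eq_of_re_trace_mul_eq fun N => ?_
    obtain ⟨A, hA, hAN⟩ := hsurj (obs Λ' N) (isLocal_obs Λ' N)
    obtain ⟨M, rfl⟩ := isLocal_iff.1 hA
    have hN : N = θ M := obs_injective Λ' (by rw [hθ, hAN])
    rw [hN, ← map_mul, htr, ← ω.apply_obs, ← ω'.apply_obs, hθ]
    exact h _ (isLocal_obs Λ M)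
  rw [localEntropy, localEntropy, hρ]
  exact vonNeumannEntropy_map (ω.isHermitian_density Λ) θ htr

/-! ### Translations -/

theorem coe_translate (x : Site ν) (A : QuasilocalAlg ν D) :
    (translate ν D x A : Op ν D) = conjShift ν D x A := rfl

theorem translate_isLocal {x : Site ν} {Λ : Finset (Site ν)} {A : QuasilocalAlg ν D}
    (hA : IsLocal Λ A) : IsLocal (translateSet x Λ) (translate ν D x A) := by
  obtain ⟨M, rfl⟩ := isLocal_iff.1 hA
  exact conjShift_localEmbed_mem x Λ M

theorem translate_translate_neg (x : Site ν) (A : QuasilocalAlg ν D) :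
    translate ν D x (translate ν D (-x) A) = A := by
  apply Subtype.ext
  rw [coe_translate, coe_translate]
  change shiftOp ν D x * (shiftOp ν D (-x) * A * shiftOp ν D (- -x)) * shiftOp ν D (-x) = A
  rw [neg_neg]
  calc _ = (shiftOp ν D x * shiftOp ν D (-x)) * (A : Op ν D) *
        (shiftOp ν D x * shiftOp ν D (-x)) := by simp only [mul_assoc]
    _ = A := by rw [shiftOp_mul_shiftOp_neg, one_mul, mul_one]

theorem translateSet_neg_translateSet (x : Site ν) (Λ : Finset (Site ν)) :
    translateSet (-x) (translateSet x Λ) = Λ := by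
  ext y
  rw [mem_translateSet, mem_translateSet]
  simp

theorem card_translateSet (x : Site ν) (Λ : Finset (Site ν)) :
    (translateSet x Λ).card = Λ.card := Finset.card_map _

theorem State.IsTranslationInvariant.localEntropy_translateSet [NeZero D] {ω : State ν D}
    (hω : ω.IsTranslationInvariant) (x : Site ν) (Λ : Finset (Site ν)) :
    ω.localEntropy (translateSet x Λ) = ω.localEntropy Λ := by
  refine State.localEntropy_eq_of_ringHom ((translate ν D x : QuasilocalAlg ν D →⋆ₐ[ℂ] QuasilocalAlg ν D) : QuasilocalAlg ν D →+* QuasilocalAlg ν D)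
    (fun A => StarHomClass.map_star (translate ν D x) A)
    (fun r A => map_smul (translate ν D x) (r : ℂ) A) (fun A hA => translate_isLocal hA)
    (fun B hB => ⟨translate ν D (-x) B, ?_, translate_translate_neg x B⟩)
    (card_translateSet x Λ) fun A _ => congrArg Complex.re (hω x A)
  have := translate_isLocal (x := -x) hB
  rwa [translateSet_neg_translateSet] at this

/-! ### Existence of the mean entropy -/

open Classical in
/-- The sites of `Λ` that precede `x` in the lexicographic order. -/
def below (Λ : Finset (Site ν)) (x : Site ν) : Finset (Site ν) :=
  Λ.filter fun y => toLex y < toLex x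

theorem mem_below {Λ : Finset (Site ν)} {x y : Site ν} :
    y ∈ below Λ x ↔ y ∈ Λ ∧ toLex y < toLex x := by
  classical
  rw [below, Finset.mem_filter]

theorem disjoint_below (Λ : Finset (Site ν)) (x : Site ν) : Disjoint (below Λ x) {x} := by
  rw [Finset.disjoint_singleton_right, mem_below]
  exact fun h => lt_irrefl _ h.2

theorem below_mono {Λ Λ' : Finset (Site ν)} (h : Λ ⊆ Λ') (x : Site ν) :
    below Λ x ⊆ below Λ' x := by
  intro y hy
  rw [mem_below] at *
  exact ⟨h hy.1, hy.2⟩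

/-- The lexicographic order is invariant under translation; this makes the conditional entropies
covariant. -/
theorem below_translateSet (x : Site ν) (Λ : Finset (Site ν)) :
    below (translateSet x Λ) x = translateSet x (below Λ 0) := by
  ext y
  rw [mem_below, mem_translateSet, mem_translateSet, mem_below]
  refine and_congr_right fun _ => ?_
  have h : toLex y < toLex x ↔ toLex (y - x + x) < toLex (0 + x) := by simp
  rw [h, toLex_add, toLex_add, add_lt_add_iff_right]

theorem exists_subset_translateSet_cube (Λ : Finset (Site ν)) :
    ∃ r : ℕ, ∀ x ∈ Λ, Λ ⊆ translateSet x (cube ν r) := by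
  refine ⟨(Λ ×ˢ Λ).sup fun p => Finset.univ.sup fun i => (p.2 i - p.1 i).natAbs,
    fun x hx y hy => ?_⟩
  rw [mem_translateSet, mem_cube]
  intro i
  have h1 : (y i - x i).natAbs ≤
      (Λ ×ˢ Λ).sup fun p => Finset.univ.sup fun i => (p.2 i - p.1 i).natAbs :=
    (Finset.le_sup (f := fun i => (y i - x i).natAbs) (Finset.mem_univ i)).trans
      (Finset.le_sup (f := fun p : Site ν × Site ν => Finset.univ.sup fun i =>
        (p.2 i - p.1 i).natAbs) (Finset.mk_mem_product hx hy))
  generalize (Λ ×ˢ Λ).sup (fun p => Finset.univ.sup fun i => (p.2 i - p.1 i).natAbs) = r at *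
  rw [Pi.sub_apply]
  omega

namespace State

variable (ω : State ν D)

/-- The entropy of the site `x` conditioned on the preceding sites of `Λ`. -/
def condEntropy (Λ : Finset (Site ν)) (x : Site ν) : ℝ :=
  ω.localEntropy (below Λ x ∪ {x}) - ω.localEntropy (below Λ x)

/-- The chain rule: adding the sites in increasing order, a new largest site does not alter the
predecessors of the earlier ones. -/
theorem localEntropy_eq_sum_condEntropy (Λ : Finset (Site ν)) :
    ω.localEntropy Λ = ω.localEntropy ∅ + ∑ x ∈ Λ, ω.condEntropy Λ x := by
  induction Λ using Finset.induction_on_max_value (fun x : Site ν => toLex x) with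
  | empty => simp
  | insert a s ha hmax ih =>
    have hlt : ∀ x ∈ s, toLex x < toLex a := fun x hx =>
      lt_of_le_of_ne (hmax x hx) fun h => ha (toLex_inj.1 h ▸ hx)
    have h1 : below (insert a s) a = s := by
      ext y
      rw [mem_below, Finset.mem_insert]
      constructor
      · rintro ⟨rfl | h, h'⟩
        · exact absurd h' (lt_irrefl _)
        · exact h
      · exact fun h => ⟨Or.inr h, hlt y h⟩
    have h2 : ∀ x ∈ s, below (insert a s) x = below s x := by
      intro x hx
      ext y
      rw [mem_below, mem_below, Finset.mem_insert]
      refine and_congr_left fun h => or_iff_right ?_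
      rintro rfl
      exact lt_asymm h (hlt x hx)
    rw [Finset.sum_insert ha, Finset.sum_congr rfl fun x hx => by
      rw [condEntropy, h2 x hx, ← condEntropy], condEntropy, h1]
    have h3 : s ∪ {a} = insert a s := by rw [Finset.union_comm, Finset.insert_eq]
    rw [h3]
    linarith

theorem tendsto_entropy_bound (r : ℕ) :
    Tendsto (fun Λ : Finset (Site ν) => (ω.localEntropy ∅ + (Λ.card * ω.condEntropy (cube ν r) 0 +
      ((Λ.card : ℝ) - (bulk r Λ).card) * (Real.log D - ω.condEntropy (cube ν r) 0))) / (Λ.card : ℝ))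
      (vanHove ν) (𝓝 (ω.condEntropy (cube ν r) 0)) := by
  have hc : Tendsto (fun Λ : Finset (Site ν) => (Λ.card : ℝ)) (vanHove ν) atTop :=
    tendsto_natCast_atTop_atTop.comp tendsto_card_vanHove
  have h1 := (hc.const_div_atTop (ω.localEntropy ∅)).add_const (ω.condEntropy (cube ν r) 0)
  have h2 := h1.add ((tendsto_bulk_vanHove r).mul_const (Real.log D - ω.condEntropy (cube ν r) 0))
  rw [zero_mul, zero_add, add_zero] at h2
  refine h2.congr' ?_
  filter_upwards [hc.eventually_gt_atTop 0] with Λ hΛ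
  field_simp
  ring

theorem HasMeanEntropy.meanEntropy_eq [NeZero ν] {ω : State ν D} {s : ℝ} (h : ω.HasMeanEntropy s) :
    ω.meanEntropy = s := h.limUnder_eq

variable [NeZero D]

theorem condEntropy_anti {Λ Λ' : Finset (Site ν)} (h : Λ ⊆ Λ') (x : Site ν) :
    ω.condEntropy Λ' x ≤ ω.condEntropy Λ x :=
  ω.localEntropy_union_sub_le (disjoint_below Λ' x) (below_mono h x)

theorem condEntropy_le_log (Λ : Finset (Site ν)) (x : Site ν) :
    ω.condEntropy Λ x ≤ Real.log D := by
  have := ω.localEntropy_union_sub_le_log (disjoint_below Λ x)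
  simpa [condEntropy] using this

variable {ω}

theorem IsTranslationInvariant.condEntropy_translateSet (hω : ω.IsTranslationInvariant)
    (Λ : Finset (Site ν)) (x : Site ν) :
    ω.condEntropy (translateSet x Λ) x = ω.condEntropy Λ 0 := by
  have h : translateSet x (below Λ 0) ∪ {x} = translateSet x (below Λ 0 ∪ {0}) := by
    ext y
    rw [Finset.mem_union, mem_translateSet, mem_translateSet, Finset.mem_union,
      Finset.mem_singleton, Finset.mem_singleton, sub_eq_zero]
  rw [condEntropy, below_translateSet, h, hω.localEntropy_translateSet,
    hω.localEntropy_translateSet, condEntropy]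

/-- A bulk site sees a whole translated cube inside `Λ`, so strong subadditivity bounds its
conditional entropy by that of the cube; each remaining site contributes at most `log D`. -/
theorem IsTranslationInvariant.localEntropy_le (hω : ω.IsTranslationInvariant) (r : ℕ)
    (Λ : Finset (Site ν)) :
    ω.localEntropy Λ ≤ ω.localEntropy ∅ + (Λ.card * ω.condEntropy (cube ν r) 0 +
      ((Λ.card : ℝ) - (bulk r Λ).card) * (Real.log D - ω.condEntropy (cube ν r) 0)) := by
  rw [localEntropy_eq_sum_condEntropy]
  refine add_le_add_right ?_ _
  have hsub : bulk r Λ ⊆ Λ := Finset.filter_subset _ _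
  have h1 : ∑ x ∈ bulk r Λ, ω.condEntropy Λ x ≤ (bulk r Λ).card * ω.condEntropy (cube ν r) 0 := by
    rw [← nsmul_eq_mul]
    refine Finset.sum_le_card_nsmul _ _ _ fun x hx => ?_
    rw [← hω.condEntropy_translateSet (cube ν r) x]
    exact ω.condEntropy_anti (Finset.mem_filter.1 hx).2 x
  have h2 : ∑ x ∈ Λ \ bulk r Λ, ω.condEntropy Λ x ≤ ((Λ.card : ℝ) - (bulk r Λ).card) * Real.log D := by
    rw [← Nat.cast_sub (Finset.card_le_card hsub), ← Finset.card_sdiff_of_subset hsub,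
      ← nsmul_eq_mul]
    exact Finset.sum_le_card_nsmul _ _ _ fun x _ => ω.condEntropy_le_log Λ x
  rw [← Finset.sum_sdiff hsub]
  linarith

/-- A large enough cube about any site of `Λ` contains all of `Λ`, and enlarging the conditioning
region lowers every term. -/
theorem IsTranslationInvariant.exists_le_localEntropy (hω : ω.IsTranslationInvariant)
    (Λ : Finset (Site ν)) : ∃ r, ω.localEntropy ∅ + Λ.card * ω.condEntropy (cube ν r) 0 ≤
      ω.localEntropy Λ := by
  obtain ⟨r, hr⟩ := exists_subset_translateSet_cube Λ
  refine ⟨r, ?_⟩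
  rw [ω.localEntropy_eq_sum_condEntropy Λ, ← nsmul_eq_mul]
  refine add_le_add_right (Finset.card_nsmul_le_sum _ _ _ fun x hx => ?_) _
  rw [← hω.condEntropy_translateSet (cube ν r) x]
  exact ω.condEntropy_anti (hr x hx) x

variable [NeZero ν]

/-- A quantum conditional entropy can be negative in general. Here the entropies of large regions
are nonnegative, and their upper bounds per site converge to this conditional entropy. -/
theorem IsTranslationInvariant.condEntropy_cube_nonneg (hω : ω.IsTranslationInvariant) (r : ℕ) :
    0 ≤ ω.condEntropy (cube ν r) 0 := by
  refine ge_of_tendsto (ω.tendsto_entropy_bound r) (Eventually.of_forall fun Λ => ?_)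
  exact div_nonneg ((ω.localEntropy_nonneg Λ).trans (hω.localEntropy_le r Λ)) (Nat.cast_nonneg _)

/-- The mean entropy of a translation-invariant state exists. -/
theorem IsTranslationInvariant.hasMeanEntropy_iInf (hω : ω.IsTranslationInvariant) :
    ω.HasMeanEntropy (⨅ r, ω.condEntropy (cube ν r) 0) := by
  have hbdd : BddBelow (Set.range fun r => ω.condEntropy (cube ν r) 0) :=
    ⟨0, by rintro _ ⟨r, rfl⟩; exact hω.condEntropy_cube_nonneg r⟩
  have hc : Tendsto (fun Λ : Finset (Site ν) => (Λ.card : ℝ)) (vanHove ν) atTop :=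
    tendsto_natCast_atTop_atTop.comp tendsto_card_vanHove
  set s := ⨅ r, ω.condEntropy (cube ν r) 0 with hs
  refine tendsto_order.2 ⟨fun a ha => ?_, fun b hb => ?_⟩
  · have h1 : Tendsto (fun Λ : Finset (Site ν) => ω.localEntropy ∅ / (Λ.card : ℝ) + s)
        (vanHove ν) (𝓝 s) := by
      simpa using (hc.const_div_atTop (ω.localEntropy ∅)).add_const s
    filter_upwards [h1.eventually_const_lt ha, hc.eventually_gt_atTop 0] with Λ h2 h3
    refine h2.trans_le ?_
    obtain ⟨r, hr⟩ := hω.exists_le_localEntropy Λ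
    have hsr : s ≤ ω.condEntropy (cube ν r) 0 := ciInf_le hbdd r
    rw [le_div_iff₀ h3, add_mul, div_mul_cancel₀ _ h3.ne']
    nlinarith
  · obtain ⟨r, hr⟩ := exists_lt_of_ciInf_lt hb
    filter_upwards [(ω.tendsto_entropy_bound r).eventually_lt_const hr, hc.eventually_gt_atTop 0]
      with Λ h2 h3
    refine lt_of_le_of_lt ?_ h2
    exact div_le_div_of_nonneg_right (hω.localEntropy_le r Λ) h3.le

theorem IsTranslationInvariant.hasMeanEntropy (hω : ω.IsTranslationInvariant) :
    ω.HasMeanEntropy ω.meanEntropy := by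
  have h := hω.hasMeanEntropy_iInf
  rwa [h.meanEntropy_eq]

end State

/-! ### Inner dynamics of a `C*`-algebra -/

section InnerDynamics

variable {𝔄 : Type*} [CStarAlgebra 𝔄]

/-- The commutator with `h`. -/
def commutator (h : 𝔄) : 𝔄 →L[ℂ] 𝔄 :=
  ContinuousLinearMap.mul ℂ 𝔄 h - (ContinuousLinearMap.mul ℂ 𝔄).flip h

theorem commutator_apply (h a : 𝔄) : commutator h a = h * a - a * h := rfl

theorem norm_commutator_apply_le (h a : 𝔄) : ‖commutator h a‖ ≤ 2 * ‖h‖ * ‖a‖ := by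
  rw [commutator_apply]
  calc ‖h * a - a * h‖ ≤ ‖h * a‖ + ‖a * h‖ := norm_sub_le _ _
    _ ≤ ‖h‖ * ‖a‖ + ‖a‖ * ‖h‖ := add_le_add (norm_mul_le _ _) (norm_mul_le _ _)
    _ = _ := by ring

theorem exp_mulLeft_apply (h a : 𝔄) :
    NormedSpace.exp (ContinuousLinearMap.mul ℂ 𝔄 h) a = NormedSpace.exp h * a := by
  have h1 := (NormedSpace.exp_series_hasSum_exp' (𝕂 := ℂ) (ContinuousLinearMap.mul ℂ 𝔄 h)).mapL
    (ContinuousLinearMap.apply ℂ 𝔄 a)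
  have h2 := (NormedSpace.exp_series_hasSum_exp' (𝕂 := ℂ) h).mul_right a
  have : ∀ n : ℕ, ((ContinuousLinearMap.mul ℂ 𝔄 h) ^ n) a = h ^ n * a := by
    intro n
    induction n with
    | zero => simp
    | succ n ih => rw [pow_succ', pow_succ', mul_apply_eq_comp, ih, mul_assoc]; rfl
  refine h1.unique ((congrArg (HasSum · _) (funext fun n => ?_)).mpr h2)
  change (n.factorial : ℂ)⁻¹ • ((ContinuousLinearMap.mul ℂ 𝔄 h) ^ n) a = _
  rw [this, smul_mul_assoc]

theorem exp_mulRight_apply (h a : 𝔄) :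
    NormedSpace.exp ((ContinuousLinearMap.mul ℂ 𝔄).flip h) a = a * NormedSpace.exp h := by
  have h1 := (NormedSpace.exp_series_hasSum_exp' (𝕂 := ℂ)
    ((ContinuousLinearMap.mul ℂ 𝔄).flip h)).mapL (ContinuousLinearMap.apply ℂ 𝔄 a)
  have h2 := (NormedSpace.exp_series_hasSum_exp' (𝕂 := ℂ) h).mul_left a
  have : ∀ n : ℕ, (((ContinuousLinearMap.mul ℂ 𝔄).flip h) ^ n) a = a * h ^ n := by
    intro n
    induction n with
    | zero => simp
    | succ n ih => rw [pow_succ', pow_succ, mul_apply_eq_comp, ih, ← mul_assoc]; rfl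
  refine h1.unique ((congrArg (HasSum · _) (funext fun n => ?_)).mpr h2)
  change (n.factorial : ℂ)⁻¹ • (((ContinuousLinearMap.mul ℂ 𝔄).flip h) ^ n) a = _
  rw [this, mul_smul_comm]

/-- The commutator is a sum of a left and a right multiplication, which commute by associativity. -/
theorem exp_commutator_apply (h a : 𝔄) :
    NormedSpace.exp (commutator h) a = NormedSpace.exp h * a * NormedSpace.exp (-h) := by
  let _ : NormedAlgebra ℚ 𝔄 := .restrictScalars ℚ ℂ 𝔄
  let _ : NormedAlgebra ℚ (𝔄 →L[ℂ] 𝔄) := .restrictScalars ℚ ℂ _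
  have h1 : commutator h = ContinuousLinearMap.mul ℂ 𝔄 h + (ContinuousLinearMap.mul ℂ 𝔄).flip (-h) := by
    rw [map_neg, ← sub_eq_add_neg]
    rfl
  have h2 : Commute (ContinuousLinearMap.mul ℂ 𝔄 h) ((ContinuousLinearMap.mul ℂ 𝔄).flip (-h)) := by
    ext x
    change h * (x * -h) = h * x * -h
    rw [mul_assoc]
  rw [h1, NormedSpace.exp_add_of_commute h2, mul_apply_eq_comp, exp_mulRight_apply,
    exp_mulLeft_apply, mul_assoc]

/-- The automorphism `a ↦ exp(ith) a exp(-ith)`. -/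
def innerAut (h : selfAdjoint 𝔄) (t : ℝ) : 𝔄 ≃⋆ₐ[ℂ] 𝔄 :=
  Unitary.conjStarAlgAut ℂ 𝔄 (selfAdjoint.expUnitary (t • h))

theorem innerAut_apply (h : selfAdjoint 𝔄) (t : ℝ) (a : 𝔄) :
    innerAut h t a = NormedSpace.exp ((Complex.I * t) • (h : 𝔄)) * a *
      NormedSpace.exp ((-(Complex.I * t)) • (h : 𝔄)) := by
  have h1 : Complex.I • ((t • h : selfAdjoint 𝔄) : 𝔄) = (Complex.I * t) • (h : 𝔄) := by
    rw [selfAdjoint.val_smul, mul_smul, Complex.coe_smul]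
  rw [innerAut, Unitary.conjStarAlgAut_apply, selfAdjoint.expUnitary_coe, h1, NormedSpace.star_exp,
    star_smul, h.2.star_eq]
  congr 3
  simp

theorem innerAut_add (h : selfAdjoint 𝔄) (s t : ℝ) (a : 𝔄) :
    innerAut h (s + t) a = innerAut h s (innerAut h t a) := by
  have h1 : innerAut h (s + t) = innerAut h s * innerAut h t := by
    rw [innerAut, innerAut, innerAut, ← map_mul, add_smul]
    congr 1
    refine Commute.expUnitary_add ?_
    rw [selfAdjoint.val_smul, selfAdjoint.val_smul]
    exact ((Commute.refl (h : 𝔄)).smul_left s).smul_right t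
  rw [h1]
  rfl

theorem innerAut_zero (h : selfAdjoint 𝔄) (a : 𝔄) : innerAut h 0 a = a := by
  simp [innerAut_apply]

theorem norm_innerAut (h : selfAdjoint 𝔄) (t : ℝ) (a : 𝔄) : ‖innerAut h t a‖ = ‖a‖ :=
  StarAlgEquiv.norm_map (innerAut h t) a

theorem innerAut_eq_exp_commutator (h : selfAdjoint 𝔄) (t : ℝ) (a : 𝔄) :
    innerAut h t a = NormedSpace.exp ((Complex.I * t) • commutator (h : 𝔄)) a := by
  have h1 : (Complex.I * t) • commutator (h : 𝔄) = commutator ((Complex.I * t) • (h : 𝔄)) := by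
    ext x
    simp only [commutator_apply, _root_.smul_apply, smul_sub, smul_mul_assoc, mul_smul_comm]
  rw [h1, exp_commutator_apply, innerAut_apply, neg_smul]

/-- The iterated commutator with `h`. -/
def commutatorPow (h : 𝔄) (n : ℕ) : 𝔄 →L[ℂ] 𝔄 := commutator h ^ n

theorem commutatorPow_zero (h a : 𝔄) : commutatorPow h 0 a = a := by
  simp [commutatorPow]

theorem commutatorPow_succ (h : 𝔄) (n : ℕ) (a : 𝔄) :
    commutatorPow h (n + 1) a = commutatorPow h n (commutator h a) := by
  rw [commutatorPow, commutatorPow, pow_succ, mul_apply_eq_comp]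

theorem hasSum_innerAut (h : selfAdjoint 𝔄) (t : ℝ) (a : 𝔄) :
    HasSum (fun n : ℕ => (((n.factorial : ℂ)⁻¹ * (Complex.I * t) ^ n)) •
      commutatorPow (h : 𝔄) n a) (innerAut h t a) := by
  have h1 := (NormedSpace.exp_series_hasSum_exp' (𝕂 := ℂ)
    ((Complex.I * t) • commutator (h : 𝔄))).mapL (ContinuousLinearMap.apply ℂ 𝔄 a)
  rw [innerAut_eq_exp_commutator]
  refine (congrArg (HasSum · _) (funext fun n => ?_)).mpr h1
  change _ = (n.factorial : ℂ)⁻¹ • ((((Complex.I * t) • commutator (h : 𝔄)) ^ n) a)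
  have hpow : ∀ n : ℕ, (((Complex.I * t) • commutator (h : 𝔄)) ^ n) a =
      (Complex.I * t) ^ n • ((commutator (h : 𝔄)) ^ n) a := by
    intro n
    induction n with
    | zero => simp
    | succ n ih =>
      rw [pow_succ', pow_succ' (Complex.I * (t : ℂ)), pow_succ', mul_apply_eq_comp, ih,
        mul_apply_eq_comp, map_smul, _root_.smul_apply, smul_smul, mul_comm]
  rw [hpow, mul_smul]
  rfl

theorem hasDerivAt_innerAut (h : selfAdjoint 𝔄) (a : 𝔄) (t : ℝ) :
    HasDerivAt (fun t => innerAut h t a) (innerAut h t (Complex.I • commutator (h : 𝔄) a)) t := by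
  have h1 : HasDerivAt (fun t : ℝ => NormedSpace.exp ((Complex.I * t) • commutator (h : 𝔄)) a)
      (NormedSpace.exp ((Complex.I * t) • commutator (h : 𝔄))
        (Complex.I • commutator (h : 𝔄) a)) t := by
    have h2 := hasDerivAt_exp_smul_const (𝕂 := ℝ) (Complex.I • commutator (h : 𝔄)) t
    have h3 := ((ContinuousLinearMap.apply ℂ 𝔄 a).restrictScalars ℝ).hasFDerivAt.comp_hasDerivAt t h2
    have e : ∀ t : ℝ, t • (Complex.I • commutator (h : 𝔄)) = (Complex.I * t) • commutator (h : 𝔄) := by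
      intro t
      rw [mul_comm, mul_smul]
      rfl
    simp only [e] at h3
    exact h3
  simp only [innerAut_eq_exp_commutator]
  exact h1

end InnerDynamics

/-! ### The infinite-volume dynamics -/

theorem norm_translate (x : Site ν) (A : QuasilocalAlg ν D) : ‖translate ν D x A‖ = ‖A‖ := by
  refine le_antisymm (NonUnitalStarAlgHom.norm_apply_le (translate ν D x) A) ?_
  have h := NonUnitalStarAlgHom.norm_apply_le (translate ν D (-x)) (translate ν D x A)
  have h' := translate_translate_neg (-x) A
  rw [neg_neg] at h'
  rwa [h'] at h

namespace Interaction

variable (Φ : Interaction ν D)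

/-- The total strength `∑ₓ ‖Φ({0, x})‖` of the terms that contain a given site. -/
def strength : ℝ := ∑' x, ‖Φ {0, x}‖

/-- The interaction is summable. -/
def IsSummable : Prop := Summable fun x => ‖Φ {0, x}‖

theorem strength_nonneg : 0 ≤ Φ.strength := tsum_nonneg fun _ => norm_nonneg _

theorem norm_pair (x y : Site ν) : ‖Φ {x, y}‖ = ‖Φ {0, y - x}‖ := by
  have h : ({x, y} : Finset (Site ν)) = translateSet x {0, y - x} := by
    ext z
    simp only [mem_translateSet, Finset.mem_insert, Finset.mem_singleton, sub_eq_zero,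
      sub_left_inj]
  rw [h, Φ.translate_eq, norm_translate]

theorem exists_pair_of_mem {x : Site ν} {Z : Finset (Site ν)} (hx : x ∈ Z) (hZ : Z.card ≤ 2) :
    ∃ y, ({x, y} : Finset (Site ν)) = Z := by
  have h1 : (Z.erase x).card ≤ 1 := by
    rw [Finset.card_erase_of_mem hx]
    omega
  rcases (Z.erase x).eq_empty_or_nonempty with h | ⟨y, hy⟩
  · refine ⟨x, ?_⟩
    rw [← Finset.insert_erase hx, h]
    simp
  · refine ⟨y, ?_⟩
    have h2 : Z.erase x = {y} := Finset.eq_singleton_iff_unique_mem.2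
      ⟨hy, fun z hz => Finset.card_le_one.1 h1 z hz y hy⟩
    rw [← Finset.insert_erase hx, h2]

variable {Φ}

theorem hasSum_norm_pair (hΦ : Φ.IsSummable) (x : Site ν) :
    HasSum (fun y => ‖Φ {x, y}‖) Φ.strength := by
  have h : HasSum ((fun z => ‖Φ {0, z}‖) ∘ Equiv.subRight x) Φ.strength :=
    (Equiv.subRight x).hasSum_iff.2 hΦ.hasSum
  exact (congrArg (HasSum · Φ.strength) (funext fun y => Φ.norm_pair x y)).mpr h

/-- The sets of at most two sites that contain `x` are the sets `{x, y}`, each for exactly one `y`;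
the choice `y = x` gives the singleton. -/
theorem hasSum_of_hasSum_pair {g : Finset (Site ν) → ℝ} {x : Site ν} {a : ℝ}
    (h : HasSum (fun y => g {x, y}) a) (hg : ∀ Z, x ∉ Z ∨ 2 < Z.card → g Z = 0) : HasSum g a := by
  have hinj : Function.Injective fun y : Site ν => ({x, y} : Finset (Site ν)) := by
    intro y z h
    have h1 : y ∈ ({x, z} : Finset (Site ν)) := by
      rw [← show ({x, y} : Finset (Site ν)) = {x, z} from h]; simp
    have h2 : z ∈ ({x, y} : Finset (Site ν)) := by
      rw [show ({x, y} : Finset (Site ν)) = {x, z} from h]; simp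
    simp only [Finset.mem_insert, Finset.mem_singleton] at h1 h2
    rcases h1 with rfl | h1
    · rcases h2 with h2 | h2 <;> exact h2.symm
    · exact h1
  refine (hinj.hasSum_iff fun Z hZ => hg Z ?_).1 h
  by_contra! hx
  obtain ⟨y, hy⟩ := exists_pair_of_mem hx.1 hx.2
  exact hZ ⟨y, hy⟩

theorem hasSum_norm_of_mem (hΦ : Φ.IsSummable) (x : Site ν) :
    HasSum (fun Z => if x ∈ Z then ‖Φ Z‖ else 0) Φ.strength := by
  refine hasSum_of_hasSum_pair (x := x) ?_ ?_
  · refine (congrArg (HasSum · Φ.strength) (funext fun y => ?_)).mpr (hasSum_norm_pair hΦ x)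
    exact if_pos (Finset.mem_insert_self _ _)
  · rintro Z (hx | hZ)
    · exact if_neg hx
    · rw [Φ.two_body Z hZ, norm_zero, ite_self]

/-- The weight of the terms that meet a region `X`. -/
def weight (Φ : Interaction ν D) (X Z : Finset (Site ν)) : ℝ :=
  ∑ x ∈ X, if x ∈ Z then ‖Φ Z‖ else 0

theorem hasSum_weight (hΦ : Φ.IsSummable) (X : Finset (Site ν)) :
    HasSum (Φ.weight X) (X.card * Φ.strength) := by
  rw [← nsmul_eq_mul, ← Finset.sum_const]
  exact hasSum_sum fun x _ => hasSum_norm_of_mem hΦ x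

theorem weight_nonneg (X Z : Finset (Site ν)) : 0 ≤ Φ.weight X Z :=
  Finset.sum_nonneg fun x _ => by split_ifs <;> simp

theorem norm_le_weight {X Z : Finset (Site ν)} (h : ¬ Disjoint Z X) : ‖Φ Z‖ ≤ Φ.weight X Z := by
  obtain ⟨x, hxZ, hxX⟩ := Finset.not_disjoint_iff.1 h
  have h1 : (if x ∈ Z then ‖Φ Z‖ else 0) ≤ Φ.weight X Z :=
    Finset.single_le_sum (f := fun x => if x ∈ Z then ‖Φ Z‖ else 0)
      (fun x _ => by split_ifs <;> simp) hxX
  rwa [if_pos hxZ] at h1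

theorem commutator_eq_zero {X Z : Finset (Site ν)} (h : Disjoint Z X) {A : QuasilocalAlg ν D}
    (hA : IsLocal X A) : commutator (Φ Z) A = 0 := by
  rw [commutator_apply, sub_eq_zero]
  exact (Φ.isLocal Z).commute h hA

theorem norm_commutator_le_weight {X Z : Finset (Site ν)} {A : QuasilocalAlg ν D}
    (hA : IsLocal X A) : ‖commutator (Φ Z) A‖ ≤ 2 * ‖A‖ * Φ.weight X Z := by
  by_cases h : Disjoint Z X
  · rw [commutator_eq_zero h hA, norm_zero]
    exact mul_nonneg (by positivity) (weight_nonneg X Z)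
  · refine (norm_commutator_apply_le _ _).trans ?_
    have := mul_le_mul_of_nonneg_left (norm_le_weight (Φ := Φ) h) (norm_nonneg A)
    linarith

theorem isLocal_commutator {X Z : Finset (Site ν)} {A : QuasilocalAlg ν D} (hA : IsLocal X A) :
    IsLocal (X ∪ Z) (commutator (Φ Z) A) := by
  have h1 := (Φ.isLocal Z).mono (Finset.subset_union_right (s₁ := X))
  have h2 := hA.mono (Finset.subset_union_left (s₂ := Z))
  exact (h1.mul h2).sub (h2.mul h1)

/-- This is where the two-body condition enters: a term that meets `X` adds at most one site to the
support, so supports grow only linearly under iterated commutators. -/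
theorem card_union_le {X Z : Finset (Site ν)} (hd : ¬ Disjoint Z X) (hZ : Z.card ≤ 2) :
    (X ∪ Z).card ≤ X.card + 1 := by
  obtain ⟨x, hxZ, hxX⟩ := Finset.not_disjoint_iff.1 hd
  have h1 : (Z \ X).card ≤ 1 := by
    have : Z \ X ⊆ Z.erase x := fun y hy => by
      rw [Finset.mem_sdiff] at hy
      exact Finset.mem_erase.2 ⟨fun h => hy.2 (h ▸ hxX), hy.1⟩
    have h2 := Finset.card_le_card this
    rw [Finset.card_erase_of_mem hxZ] at h2
    omega
  rw [← Finset.union_sdiff_self_eq_union]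
  exact (Finset.card_union_le _ _).trans (by omega)

/-! ### Iterated commutators with the Hamiltonian, and the infinite-volume limit -/

variable (Φ)

theorem isSelfAdjoint_hamiltonian (Λ : Finset (Site ν)) : IsSelfAdjoint (Φ.hamiltonian Λ) :=
  isSelfAdjoint_sum _ fun X _ => Φ.isSelfAdjoint X

/-- The Hamiltonian as a self-adjoint element. -/
def ham (Λ : Finset (Site ν)) : selfAdjoint (QuasilocalAlg ν D) :=
  ⟨Φ.hamiltonian Λ, Φ.isSelfAdjoint_hamiltonian Λ⟩

theorem coe_ham (Λ : Finset (Site ν)) :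
    (Φ.ham Λ : QuasilocalAlg ν D) = ∑ X ∈ Λ.powerset, Φ X := rfl

theorem localEvolution_eq (Λ : Finset (Site ν)) (t : ℝ) (A : QuasilocalAlg ν D) :
    Φ.localEvolution Λ t A = innerAut (Φ.ham Λ) t A := by
  rw [innerAut_apply]
  rfl

theorem commutator_ham (Λ : Finset (Site ν)) (A : QuasilocalAlg ν D) :
    commutator (Φ.ham Λ : QuasilocalAlg ν D) A = ∑ Z ∈ Λ.powerset, commutator (Φ Z) A := by
  rw [coe_ham, commutator_apply, Finset.sum_mul, Finset.mul_sum, ← Finset.sum_sub_distrib]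
  rfl

theorem commutator_ham_pow_succ (Λ : Finset (Site ν)) (n : ℕ) (A : QuasilocalAlg ν D) :
    commutatorPow (Φ.ham Λ : QuasilocalAlg ν D) (n + 1) A =
      ∑ Z ∈ Λ.powerset, commutatorPow (Φ.ham Λ : QuasilocalAlg ν D) n (commutator (Φ Z) A) := by
  rw [commutatorPow_succ, commutator_ham, map_sum]

variable {Φ}

theorem norm_commutator_pow_commutator_le {Λ X Z : Finset (Site ν)} {n m : ℕ} (hX : X.card ≤ m)
    {A : QuasilocalAlg ν D} (hA : IsLocal X A)
    (ih : ∀ Y : Finset (Site ν), Y.card ≤ m + 1 → ∀ B : QuasilocalAlg ν D, IsLocal Y B →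
      ‖commutatorPow (Φ.ham Λ : QuasilocalAlg ν D) n B‖ ≤
        ‖B‖ * ((2 * Φ.strength) ^ n * (m + 1).ascFactorial n)) :
    ‖commutatorPow (Φ.ham Λ : QuasilocalAlg ν D) n (commutator (Φ Z) A)‖ ≤
      2 * ‖A‖ * Φ.weight X Z * ((2 * Φ.strength) ^ n * (m + 1).ascFactorial n) := by
  have hnn : 0 ≤ (2 * Φ.strength) ^ n * ((m + 1).ascFactorial n : ℝ) :=
    mul_nonneg (pow_nonneg (mul_nonneg zero_le_two Φ.strength_nonneg) _) (Nat.cast_nonneg _)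
  by_cases hd : Disjoint Z X
  · rw [commutator_eq_zero hd hA, map_zero, norm_zero]
    exact mul_nonneg (mul_nonneg (by positivity) (weight_nonneg X Z)) hnn
  by_cases hZ : Z.card ≤ 2
  · refine (ih (X ∪ Z) ((card_union_le hd hZ).trans (by omega)) _ (isLocal_commutator hA)).trans ?_
    exact mul_le_mul_of_nonneg_right (norm_commutator_le_weight hA) hnn
  · have h0 : commutator (Φ Z) A = 0 := by
      rw [Φ.two_body Z (by omega), commutator_apply, zero_mul, mul_zero, sub_zero]
    rw [h0, map_zero, norm_zero]
    exact mul_nonneg (mul_nonneg (by positivity) (weight_nonneg X Z)) hnn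

/-- The first commutator costs a factor `2 * m * Φ.strength` for `m` sites and leaves an observable
on at most `m + 1` sites; iteration produces `m (m + 1) ⋯ (m + n - 1)`. The bound does not depend on
`Λ`. -/
theorem norm_commutator_pow_le (hΦ : Φ.IsSummable) (Λ : Finset (Site ν)) (n : ℕ) :
    ∀ (m : ℕ) (X : Finset (Site ν)), X.card ≤ m → ∀ A : QuasilocalAlg ν D, IsLocal X A →
      ‖commutatorPow (Φ.ham Λ : QuasilocalAlg ν D) n A‖ ≤
        ‖A‖ * ((2 * Φ.strength) ^ n * m.ascFactorial n) := by
  induction n with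
  | zero => intro m X _ A _; rw [commutatorPow_zero]; simp
  | succ n ih =>
    intro m X hX A hA
    rw [commutator_ham_pow_succ]
    set c := (2 * Φ.strength) ^ n * ((m + 1).ascFactorial n : ℝ) with hc
    have hc0 : 0 ≤ c :=
      mul_nonneg (pow_nonneg (mul_nonneg zero_le_two Φ.strength_nonneg) _) (Nat.cast_nonneg _)
    have h1 : ∑ Z ∈ Λ.powerset, Φ.weight X Z ≤ m * Φ.strength := by
      refine (sum_le_hasSum _ (fun Z _ => weight_nonneg X Z) (hasSum_weight hΦ X)).trans ?_
      exact mul_le_mul_of_nonneg_right (Nat.cast_le.2 hX) Φ.strength_nonneg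
    calc _ ≤ ∑ Z ∈ Λ.powerset, 2 * ‖A‖ * Φ.weight X Z * c := norm_sum_le_of_le _ fun Z _ =>
          norm_commutator_pow_commutator_le hX hA (ih (m + 1))
      _ = 2 * ‖A‖ * c * ∑ Z ∈ Λ.powerset, Φ.weight X Z := by
          rw [Finset.mul_sum]
          exact Finset.sum_congr rfl fun Z _ => by ring
      _ ≤ 2 * ‖A‖ * c * (m * Φ.strength) := mul_le_mul_of_nonneg_left h1 (by positivity)
      _ = ‖A‖ * ((2 * Φ.strength) ^ (n + 1) * ((m * (m + 1).ascFactorial n : ℕ) : ℝ)) := by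
          rw [hc]
          push_cast
          ring
      _ = _ := by rw [← Nat.succ_eq_add_one, Nat.succ_ascFactorial, Nat.ascFactorial_succ]

/-- Dominated convergence over the terms `Z` of the interaction: each summand is eventually present
and converges by induction, and the summable weight dominates uniformly in `Λ`. -/
theorem exists_tendsto_commutator_pow (hΦ : Φ.IsSummable) (n : ℕ) :
    ∀ (X : Finset (Site ν)) (A : QuasilocalAlg ν D), IsLocal X A → ∃ B,
      Tendsto (fun Λ => commutatorPow (Φ.ham Λ : QuasilocalAlg ν D) n A) atTop (𝓝 B) := by
  induction n with
  | zero => exact fun X A _ => ⟨A, by simp only [commutatorPow_zero]; exact tendsto_const_nhds⟩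
  | succ n ih =>
    intro X A hA
    choose B hB using fun Z => ih (X ∪ Z) (commutator (Φ Z) A) (isLocal_commutator hA)
    refine ⟨∑' Z, B Z, ?_⟩
    have h1 : ∀ Λ, commutatorPow (Φ.ham Λ : QuasilocalAlg ν D) (n + 1) A = ∑' Z,
        if Z ∈ Λ.powerset then
          commutatorPow (Φ.ham Λ : QuasilocalAlg ν D) n (commutator (Φ Z) A) else 0 := by
      intro Λ
      rw [commutator_ham_pow_succ, tsum_eq_sum (s := Λ.powerset)]
      · exact Finset.sum_congr rfl fun Z hZ => (if_pos hZ).symm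
      · exact fun Z hZ => if_neg hZ
    simp only [h1]
    refine tendsto_tsum_of_dominated_convergence (bound := fun Z => 2 * ‖A‖ * Φ.weight X Z *
      ((2 * Φ.strength) ^ n * (X.card + 1).ascFactorial n)) ?_ ?_ ?_
    · exact ((hasSum_weight hΦ X).summable.mul_left _).mul_right _
    · intro Z
      refine (hB Z).congr' ?_
      filter_upwards [eventually_ge_atTop Z] with Λ hΛ
      rw [if_pos (Finset.mem_powerset.2 hΛ)]
    · refine Eventually.of_forall fun Λ Z => ?_
      have h2 := norm_commutator_pow_commutator_le (Z := Z) le_rfl hA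
        (fun Y hY B hB => norm_commutator_pow_le hΦ Λ n (X.card + 1) Y hY B hB)
      split_ifs
      · exact h2
      · rw [norm_zero]
        exact (norm_nonneg _).trans h2

theorem ascFactorial_le (m n : ℕ) : m.ascFactorial n ≤ n.factorial * 2 ^ (m + n) := by
  refine le_trans ?_ (Nat.mul_le_mul_left _ (Nat.choose_le_two_pow (m + n) n))
  rw [← Nat.ascFactorial_eq_factorial_mul_choose]
  induction n with
  | zero => simp
  | succ n ih =>
    rw [Nat.ascFactorial_succ, Nat.ascFactorial_succ]
    exact Nat.mul_le_mul (by omega) ih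

/-- The ascending factorial is at most `n! 2^(m+n)`, so the factorial of the exponential series
cancels and a geometric series of ratio `4 * Φ.strength * |t|` dominates, uniformly in `Λ`. -/
theorem exists_tendsto_of_small (hΦ : Φ.IsSummable) {t : ℝ} (ht : 4 * Φ.strength * |t| < 1)
    {X : Finset (Site ν)} {A : QuasilocalAlg ν D} (hA : IsLocal X A) :
    ∃ B, Tendsto (fun Λ => innerAut (Φ.ham Λ) t A) atTop (𝓝 B) := by
  choose B hB using fun n => exists_tendsto_commutator_pow hΦ n X A hA
  refine ⟨∑' n : ℕ, ((n.factorial : ℂ)⁻¹ * (Complex.I * t) ^ n) • B n, ?_⟩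
  have h1 : ∀ Λ, innerAut (Φ.ham Λ) t A = ∑' n : ℕ, ((n.factorial : ℂ)⁻¹ * (Complex.I * t) ^ n) •
      commutatorPow (Φ.ham Λ : QuasilocalAlg ν D) n A := fun Λ =>
    (hasSum_innerAut (Φ.ham Λ) t A).tsum_eq.symm
  simp only [h1]
  have h0 : 0 ≤ 4 * Φ.strength * |t| :=
    mul_nonneg (mul_nonneg (by norm_num) Φ.strength_nonneg) (abs_nonneg _)
  refine tendsto_tsum_of_dominated_convergence (bound := fun n : ℕ =>
    ‖A‖ * 2 ^ X.card * (4 * Φ.strength * |t|) ^ n) ?_ ?_ ?_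
  · exact (summable_geometric_of_lt_one h0 ht).mul_left _
  · intro n
    exact (hB n).const_smul _
  · refine Eventually.of_forall fun Λ n => ?_
    have h2 := norm_commutator_pow_le hΦ Λ n X.card X le_rfl A hA
    have h3 : (X.card.ascFactorial n : ℝ) ≤ n.factorial * 2 ^ (X.card + n) := by
      exact_mod_cast ascFactorial_le X.card n
    have hn : (0 : ℝ) < n.factorial := Nat.cast_pos.2 n.factorial_pos
    have hJ : 0 ≤ (2 * Φ.strength) ^ n := pow_nonneg (mul_nonneg zero_le_two Φ.strength_nonneg) _
    rw [norm_smul, norm_mul, norm_inv, norm_pow, norm_mul, Complex.norm_I, one_mul,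
      Complex.norm_real, Complex.norm_natCast, Real.norm_eq_abs]
    calc _ ≤ ((n.factorial : ℝ)⁻¹ * |t| ^ n) * (‖A‖ * ((2 * Φ.strength) ^ n *
          (n.factorial * 2 ^ (X.card + n)))) := by
          refine mul_le_mul_of_nonneg_left (h2.trans ?_) (by positivity)
          exact mul_le_mul_of_nonneg_left (mul_le_mul_of_nonneg_left h3 hJ) (norm_nonneg _)
      _ = ((n.factorial : ℝ)⁻¹ * n.factorial) * (‖A‖ * 2 ^ X.card *
          ((2 * Φ.strength) ^ n * 2 ^ n * |t| ^ n)) := by rw [pow_add]; ring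
      _ = _ := by
          rw [inv_mul_cancel₀ hn.ne', one_mul, ← mul_pow, ← mul_pow]
          ring

/-- The finite-volume evolutions at time `t` converge strongly. -/
def ConvergesAt (Φ : Interaction ν D) (t : ℝ) : Prop :=
  ∀ A : QuasilocalAlg ν D, ∃ B, Tendsto (fun Λ => innerAut (Φ.ham Λ) t A) atTop (𝓝 B)

/-- The evolutions are isometric, so convergence extends from the dense set of local observables by
an `ε / 3` argument. -/
theorem convergesAt_of_local {t : ℝ}
    (h : ∀ (X : Finset (Site ν)) (A : QuasilocalAlg ν D), IsLocal X A →
      ∃ B, Tendsto (fun Λ => innerAut (Φ.ham Λ) t A) atTop (𝓝 B)) : Φ.ConvergesAt t := by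
  intro A
  refine cauchySeq_tendsto_of_complete (Metric.cauchySeq_iff'.2 fun ε hε => ?_)
  obtain ⟨A', hA', X, hX⟩ := Metric.dense_iff.1 dense_isLocal A (ε / 3) (by positivity)
  obtain ⟨B, hB⟩ := h X A' hX
  obtain ⟨N, hN⟩ := Metric.cauchySeq_iff'.1 hB.cauchySeq (ε / 3) (by positivity)
  refine ⟨N, fun Λ hΛ => ?_⟩
  have hd : ∀ Λ, dist (innerAut (Φ.ham Λ) t A) (innerAut (Φ.ham Λ) t A') < ε / 3 := by
    intro Λ
    rw [dist_eq_norm, ← map_sub, norm_innerAut, ← dist_eq_norm, dist_comm]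
    exact hA'
  calc _ ≤ dist (innerAut (Φ.ham Λ) t A) (innerAut (Φ.ham Λ) t A') +
        dist (innerAut (Φ.ham Λ) t A') (innerAut (Φ.ham N) t A') +
        dist (innerAut (Φ.ham N) t A') (innerAut (Φ.ham N) t A) := dist_triangle4 _ _ _ _
    _ < ε / 3 + ε / 3 + ε / 3 := by
        have h3 := hd N
        rw [dist_comm] at h3
        exact add_lt_add (add_lt_add (hd Λ) (hN Λ hΛ)) h3
    _ = ε := by ring

theorem tendsto_innerAut_comp {t : ℝ} {A B : QuasilocalAlg ν D}
    {f : Finset (Site ν) → QuasilocalAlg ν D}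
    (hB : Tendsto (fun Λ => innerAut (Φ.ham Λ) t A) atTop (𝓝 B)) (hf : Tendsto f atTop (𝓝 A)) :
    Tendsto (fun Λ => innerAut (Φ.ham Λ) t (f Λ)) atTop (𝓝 B) := by
  have h1 : Tendsto (fun Λ => innerAut (Φ.ham Λ) t (f Λ) - innerAut (Φ.ham Λ) t A) atTop (𝓝 0) := by
    rw [tendsto_zero_iff_norm_tendsto_zero]
    simp only [← map_sub, norm_innerAut]
    rw [← tendsto_zero_iff_norm_tendsto_zero]
    simpa using hf.sub_const A
  simpa using h1.add hB

theorem ConvergesAt.add {s t : ℝ} (hs : Φ.ConvergesAt s) (ht : Φ.ConvergesAt t) :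
    Φ.ConvergesAt (s + t) := by
  intro A
  obtain ⟨B, hB⟩ := ht A
  obtain ⟨E, hE⟩ := hs B
  refine ⟨E, ?_⟩
  simp only [innerAut_add]
  exact tendsto_innerAut_comp hE hB

/-- The time is cut into `n` equal steps inside the radius of convergence, and limits of isometries
compose. -/
theorem convergesAt (hΦ : Φ.IsSummable) (t : ℝ) : Φ.ConvergesAt t := by
  obtain ⟨n, hn⟩ := exists_nat_gt (4 * Φ.strength * |t|)
  have h0 : 0 ≤ 4 * Φ.strength * |t| :=
    mul_nonneg (mul_nonneg (by norm_num) Φ.strength_nonneg) (abs_nonneg _)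
  have hn0 : (0 : ℝ) < n := h0.trans_lt hn
  have hsmall : Φ.ConvergesAt (t / n) := convergesAt_of_local fun X A hA =>
    exists_tendsto_of_small hΦ (by
      rw [abs_div, abs_of_pos hn0, ← mul_div_assoc, div_lt_one hn0]
      exact hn) hA
  have hmul : ∀ k : ℕ, Φ.ConvergesAt (k * (t / n)) := by
    intro k
    induction k with
    | zero => exact fun A => ⟨A, by simp [innerAut_zero]⟩
    | succ k ih =>
      have := ih.add hsmall
      rwa [show (k : ℝ) * (t / n) + t / n = ((k + 1 : ℕ) : ℝ) * (t / n) by push_cast; ring] at this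
  have := hmul n
  rwa [mul_div_cancel₀ _ hn0.ne'] at this

/-- The infinite-volume evolution of an observable. -/
def limEvolution (hΦ : Φ.IsSummable) (t : ℝ) (A : QuasilocalAlg ν D) : QuasilocalAlg ν D :=
  (convergesAt hΦ t A).choose

theorem tendsto_limEvolution (hΦ : Φ.IsSummable) (t : ℝ) (A : QuasilocalAlg ν D) :
    Tendsto (fun Λ => innerAut (Φ.ham Λ) t A) atTop (𝓝 (limEvolution hΦ t A)) :=
  (convergesAt hΦ t A).choose_spec

theorem limEvolution_add (hΦ : Φ.IsSummable) (s t : ℝ) (A : QuasilocalAlg ν D) :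
    limEvolution hΦ (s + t) A = limEvolution hΦ s (limEvolution hΦ t A) := by
  refine tendsto_nhds_unique (tendsto_limEvolution hΦ (s + t) A) ?_
  simp only [innerAut_add]
  exact tendsto_innerAut_comp (tendsto_limEvolution hΦ s _) (tendsto_limEvolution hΦ t A)

theorem limEvolution_zero (hΦ : Φ.IsSummable) (A : QuasilocalAlg ν D) :
    limEvolution hΦ 0 A = A := by
  refine tendsto_nhds_unique (tendsto_limEvolution hΦ 0 A) ?_
  simp [innerAut_zero]

/-- The infinite-volume dynamics. -/
def dynamics (hΦ : Φ.IsSummable) (t : ℝ) : QuasilocalAlg ν D ≃⋆ₐ[ℂ] QuasilocalAlg ν D where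
  toFun := limEvolution hΦ t
  invFun := limEvolution hΦ (-t)
  left_inv A := by rw [← limEvolution_add, neg_add_cancel, limEvolution_zero]
  right_inv A := by rw [← limEvolution_add, add_neg_cancel, limEvolution_zero]
  map_mul' A B := by
    refine tendsto_nhds_unique (tendsto_limEvolution hΦ t (A * B)) ?_
    simp only [map_mul]
    exact (tendsto_limEvolution hΦ t A).mul (tendsto_limEvolution hΦ t B)
  map_add' A B := by
    refine tendsto_nhds_unique (tendsto_limEvolution hΦ t (A + B)) ?_
    simp only [map_add]
    exact (tendsto_limEvolution hΦ t A).add (tendsto_limEvolution hΦ t B)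
  map_star' A := by
    refine tendsto_nhds_unique (tendsto_limEvolution hΦ t (star A)) ?_
    simp only [StarHomClass.map_star]
    exact (tendsto_limEvolution hΦ t A).star
  map_smul' c A := by
    refine tendsto_nhds_unique (tendsto_limEvolution hΦ t (c • A)) ?_
    simp only [map_smul]
    exact (tendsto_limEvolution hΦ t A).const_smul c

theorem tendsto_dynamics (hΦ : Φ.IsSummable) (t : ℝ) (A : QuasilocalAlg ν D) :
    Tendsto (fun Λ => innerAut (Φ.ham Λ) t A) atTop (𝓝 (dynamics hΦ t A)) :=
  tendsto_limEvolution hΦ t A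

theorem isDynamics (hΦ : Φ.IsSummable) : Φ.IsDynamics (dynamics hΦ) := by
  intro t Λ A _
  simp only [localEvolution_eq]
  exact tendsto_dynamics hΦ t A

theorem translate_ham (x : Site ν) (Λ : Finset (Site ν)) :
    translate ν D x (Φ.ham Λ) = Φ.ham (translateSet x Λ) := by
  rw [coe_ham, coe_ham, map_sum]
  refine Finset.sum_bij (fun X _ => translateSet x X) ?_ ?_ ?_ ?_
  · intro X hX
    rw [Finset.mem_powerset] at *
    exact Finset.map_subset_map.2 hX
  · intro X _ Y _ h
    exact Finset.map_injective _ h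
  · intro Y hY
    refine ⟨translateSet (-x) Y, ?_, ?_⟩
    · rw [Finset.mem_powerset] at *
      rw [← translateSet_neg_translateSet x Λ]
      exact Finset.map_subset_map.2 hY
    · have := translateSet_neg_translateSet (-x) Y
      rwa [neg_neg] at this
  · intro X _
    exact (Φ.translate_eq x X).symm

theorem translate_innerAut (x : Site ν) (Λ : Finset (Site ν)) (t : ℝ) (A : QuasilocalAlg ν D) :
    translate ν D x (innerAut (Φ.ham Λ) t A) =
      innerAut (Φ.ham (translateSet x Λ)) t (translate ν D x A) := by
  have hc : Continuous (translate ν D x) :=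
    AddMonoidHomClass.continuous_of_bound (translate ν D x) 1 fun A => by
      rw [norm_translate, one_mul]
  let _ : NormedAlgebra ℚ (QuasilocalAlg ν D) := .restrictScalars ℚ ℂ _
  rw [innerAut_apply, innerAut_apply, map_mul, map_mul, NormedSpace.map_exp _ hc,
    NormedSpace.map_exp _ hc, map_smul, map_smul, translate_ham]

theorem tendsto_translateSet (x : Site ν) :
    Tendsto (translateSet x : Finset (Site ν) → Finset (Site ν)) atTop atTop := by
  refine tendsto_atTop.2 fun Λ => ?_
  filter_upwards [eventually_ge_atTop (translateSet (-x) Λ)] with Λ' h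
  have := translateSet_neg_translateSet (-x) Λ
  rw [neg_neg] at this
  rw [← this]
  exact Finset.map_subset_map.2 h

/-- A translation carries the evolution in `Λ` to that in `Λ + x`, and translated regions still
exhaust the lattice. -/
theorem dynamics_translate (hΦ : Φ.IsSummable) (x : Site ν) (t : ℝ) (A : QuasilocalAlg ν D) :
    dynamics hΦ t (translate ν D x A) = translate ν D x (dynamics hΦ t A) := by
  have hc : Continuous (translate ν D x) :=
    AddMonoidHomClass.continuous_of_bound (translate ν D x) 1 fun A => by
      rw [norm_translate, one_mul]
  refine tendsto_nhds_unique
    ((tendsto_dynamics hΦ t (translate ν D x A)).comp (tendsto_translateSet x)) ?_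
  have h := (hc.tendsto _).comp (tendsto_dynamics hΦ t A)
  refine h.congr fun Λ => ?_
  exact translate_innerAut x Λ t A

end Interaction

theorem State.IsTranslationInvariant.comp_dynamics {ω : State ν D} (hω : ω.IsTranslationInvariant)
    {Φ : Interaction ν D} (hΦ : Φ.IsSummable) (t : ℝ) :
    (ω.comp (Interaction.dynamics hΦ t)).IsTranslationInvariant := by
  intro x A
  change ω (Interaction.dynamics hΦ t (translate ν D x A)) = ω (Interaction.dynamics hΦ t A)
  rw [Interaction.dynamics_translate, hω]

/-! ### The rate of change of the local entropy -/

section CommutatorLog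

open Matrix

/-- With `x = q / p ≥ 1` the claim is `(log x)² ≤ x`, which follows from `log x = 2 log √x ≤ √x`. -/
theorem sq_log_sub_log_mul_le {p q : ℝ} (hp : 0 < p) (hpq : p ≤ q) :
    (Real.log p - Real.log q) ^ 2 * p ≤ q := by
  have hq := hp.trans_le hpq
  have h0 : 0 ≤ Real.log (q / p) := Real.log_nonneg ((one_le_div hp).2 hpq)
  have h1 : Real.log (q / p) ≤ Real.sqrt (q / p) := by
    have h2 : Real.log (q / p) = 2 * Real.log (Real.sqrt (q / p)) := by
      rw [Real.log_sqrt (by positivity)]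
      ring
    have hs : 0 < Real.sqrt (q / p) := Real.sqrt_pos.2 (by positivity)
    have h3 := Real.log_le_sub_one_of_pos (x := Real.sqrt (q / p) / 2) (by positivity)
    rw [Real.log_div hs.ne' two_ne_zero] at h3
    have h4 := Real.log_le_sub_one_of_pos (x := 2) two_pos
    linarith
  have h2 : Real.log (q / p) ^ 2 ≤ q / p := by
    calc _ ≤ Real.sqrt (q / p) ^ 2 := pow_le_pow_left₀ h0 h1 2
      _ = _ := Real.sq_sqrt (by positivity)
  rw [← neg_sub, ← Real.log_div hq.ne' hp.ne', neg_sq]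
  exact (le_div_iff₀ hp).1 h2

variable {n : Type*} [Fintype n] [DecidableEq n]

/-- The matrix with entries `X` in an eigenbasis of `ρ`. -/
def ofEigenbasis {ρ : Matrix n n ℂ} (hρ : ρ.IsHermitian) (X : Matrix n n ℂ) : Matrix n n ℂ :=
  (hρ.eigenvectorUnitary : Matrix n n ℂ) * X * star (hρ.eigenvectorUnitary : Matrix n n ℂ)

theorem ofEigenbasis_mul {ρ : Matrix n n ℂ} (hρ : ρ.IsHermitian) (X Y : Matrix n n ℂ) :
    ofEigenbasis hρ (X * Y) = ofEigenbasis hρ X * ofEigenbasis hρ Y := by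
  simp only [ofEigenbasis]
  calc _ = (hρ.eigenvectorUnitary : Matrix n n ℂ) * X *
        (star (hρ.eigenvectorUnitary : Matrix n n ℂ) * (hρ.eigenvectorUnitary : Matrix n n ℂ)) *
        Y * star (hρ.eigenvectorUnitary : Matrix n n ℂ) := by
        rw [Unitary.coe_star_mul_self, mul_one]
        simp only [mul_assoc]
    _ = _ := by simp only [mul_assoc]

theorem star_ofEigenbasis {ρ : Matrix n n ℂ} (hρ : ρ.IsHermitian) (X : Matrix n n ℂ) :
    star (ofEigenbasis hρ X) = ofEigenbasis hρ (star X) := by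
  simp only [ofEigenbasis, star_mul, star_star, mul_assoc]

theorem exists_ofEigenbasis_eq {ρ : Matrix n n ℂ} (hρ : ρ.IsHermitian) (M : Matrix n n ℂ) :
    ∃ X, ofEigenbasis hρ X = M := by
  refine ⟨star (hρ.eigenvectorUnitary : Matrix n n ℂ) * M * (hρ.eigenvectorUnitary : Matrix n n ℂ),
    ?_⟩
  calc _ = ((hρ.eigenvectorUnitary : Matrix n n ℂ) * star (hρ.eigenvectorUnitary : Matrix n n ℂ)) *
        M * ((hρ.eigenvectorUnitary : Matrix n n ℂ) *
          star (hρ.eigenvectorUnitary : Matrix n n ℂ)) := by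
        simp only [ofEigenbasis, mul_assoc]
    _ = M := by rw [Unitary.mul_star_self_of_mem hρ.eigenvectorUnitary.2, one_mul, mul_one]

theorem trace_mul_ofEigenbasis {ρ : Matrix n n ℂ} (hρ : ρ.IsHermitian) (X : Matrix n n ℂ) :
    (ρ * ofEigenbasis hρ X).trace = ∑ i, (hρ.eigenvalues i : ℂ) * X i i := by
  have h : ρ = ofEigenbasis hρ (diagonal fun i => (hρ.eigenvalues i : ℂ)) := eq_conj_eigenvalues hρ
  conv_lhs => enter [1, 1]; rw [h]
  rw [← ofEigenbasis_mul, ofEigenbasis, trace_mul_comm, ← mul_assoc, Unitary.coe_star_mul_self,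
    one_mul, trace]
  exact Finset.sum_congr rfl fun i _ => by rw [diag_apply, diagonal_mul]

theorem re_trace_mul_self_star {ρ : Matrix n n ℂ} (hρ : ρ.IsHermitian) (X : Matrix n n ℂ) :
    (ρ * (ofEigenbasis hρ X * star (ofEigenbasis hρ X))).trace.re =
      ∑ i, ∑ j, hρ.eigenvalues i * Complex.normSq (X i j) := by
  rw [star_ofEigenbasis, ← ofEigenbasis_mul, trace_mul_ofEigenbasis, Complex.re_sum]
  refine Finset.sum_congr rfl fun i _ => ?_
  rw [Complex.re_ofReal_mul, mul_apply, Complex.re_sum, Finset.mul_sum]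
  simp only [star_apply, RCLike.star_def, Complex.mul_conj, Complex.ofReal_re]

theorem re_trace_mul_star_self {ρ : Matrix n n ℂ} (hρ : ρ.IsHermitian) (X : Matrix n n ℂ) :
    (ρ * (star (ofEigenbasis hρ X) * ofEigenbasis hρ X)).trace.re =
      ∑ i, ∑ j, hρ.eigenvalues j * Complex.normSq (X i j) := by
  rw [star_ofEigenbasis, ← ofEigenbasis_mul, trace_mul_ofEigenbasis, Complex.re_sum,
    Finset.sum_comm]
  refine Finset.sum_congr rfl fun i _ => ?_
  rw [Complex.re_ofReal_mul, mul_apply, Complex.re_sum, Finset.mul_sum]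
  simp only [star_apply, RCLike.star_def, mul_comm ((starRingEnd ℂ) _), Complex.mul_conj,
    Complex.ofReal_re]

/-- In an eigenbasis of `ρ` the commutator has entries `(log p i - log p j) X i j`. They are split
according to which eigenvalue is smaller, and each part is weighted with that smaller eigenvalue. By
`sq_log_sub_log_mul_le` this absorbs the logarithms, so no bound on `log ρ` is needed. -/
theorem exists_split_commutator_log {ρ : Matrix n n ℂ} (hρ : ρ.PosDef) (M : Matrix n n ℂ) :
    ∃ N₁ N₂ : Matrix n n ℂ, cfc Real.log ρ * M - M * cfc Real.log ρ = N₁ + N₂ ∧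
      (ρ * (N₁ * star N₁)).trace.re ≤ (ρ * (star M * M)).trace.re ∧
      (ρ * (star N₂ * N₂)).trace.re ≤ (ρ * (M * star M)).trace.re := by
  obtain ⟨X, rfl⟩ := exists_ofEigenbasis_eq hρ.isHermitian M
  set p := hρ.isHermitian.eigenvalues with hp
  have hpos : ∀ i, 0 < p i := hρ.eigenvalues_pos
  let c : n → n → ℂ := fun i j => ((Real.log (p i) - Real.log (p j) : ℝ) : ℂ) * X i j
  have hc : ∀ i j, Complex.normSq (c i j) =
      (Real.log (p i) - Real.log (p j)) ^ 2 * Complex.normSq (X i j) := fun i j => by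
    rw [map_mul, Complex.normSq_ofReal, sq]
  refine ⟨ofEigenbasis hρ.isHermitian (of fun i j => if p i ≤ p j then c i j else 0),
    ofEigenbasis hρ.isHermitian (of fun i j => if p i ≤ p j then 0 else c i j), ?_, ?_, ?_⟩
  · have hlog : cfc Real.log ρ =
        ofEigenbasis hρ.isHermitian (diagonal fun i => (Real.log (p i) : ℂ)) :=
      cfc_eq_conj hρ.isHermitian Real.log
    rw [hlog, ← ofEigenbasis_mul, ← ofEigenbasis_mul]
    simp only [ofEigenbasis, ← sub_mul, ← mul_sub, ← add_mul, ← mul_add]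
    congr 2
    ext i j
    rw [Matrix.sub_apply, Matrix.add_apply, diagonal_mul, mul_diagonal, of_apply, of_apply]
    have : (Real.log (p i) : ℂ) * X i j - X i j * (Real.log (p j) : ℂ) = c i j := by
      simp only [c]
      push_cast
      ring
    rw [this]
    split_ifs <;> simp
  · rw [re_trace_mul_self_star, re_trace_mul_star_self]
    refine Finset.sum_le_sum fun i _ => Finset.sum_le_sum fun j _ => ?_
    rw [of_apply]
    split_ifs with h
    · rw [hc, ← mul_assoc, mul_comm (p i)]
      exact mul_le_mul_of_nonneg_right (sq_log_sub_log_mul_le (hpos i) h) (Complex.normSq_nonneg _)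
    · rw [map_zero, mul_zero]
      exact mul_nonneg (hpos j).le (Complex.normSq_nonneg _)
  · rw [re_trace_mul_self_star, re_trace_mul_star_self]
    refine Finset.sum_le_sum fun i _ => Finset.sum_le_sum fun j _ => ?_
    rw [of_apply]
    split_ifs with h
    · rw [map_zero, mul_zero]
      exact mul_nonneg (hpos i).le (Complex.normSq_nonneg _)
    · rw [hc, ← mul_assoc, mul_comm (p j), ← neg_sub (Real.log (p j)), neg_sq]
      exact mul_le_mul_of_nonneg_right (sq_log_sub_log_mul_le (hpos j) (not_le.1 h).le)
        (Complex.normSq_nonneg _)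

end CommutatorLog

namespace State

/-- The logarithm of the density matrix of `ω` in `Λ`, as an observable. -/
def logDensity (ω : State ν D) (Λ : Finset (Site ν)) : QuasilocalAlg ν D :=
  obs Λ (cfc Real.log (ω.density Λ))

theorem isLocal_logDensity (ω : State ν D) (Λ : Finset (Site ν)) : IsLocal Λ (ω.logDensity Λ) :=
  isLocal_obs Λ _

theorem localEntropy_eq (ω : State ν D) (Λ : Finset (Site ν)) :
    ω.localEntropy Λ = -(ω (ω.logDensity Λ)).re := by
  rw [logDensity, apply_obs, localEntropy, vonNeumannEntropy, Complex.neg_re]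

theorem apply_commutator_logDensity_eq_zero (ω : State ν D) {Λ : Finset (Site ν)} {A : QuasilocalAlg ν D}
    (hA : IsLocal Λ A) : ω (commutator (ω.logDensity Λ) A) = 0 := by
  obtain ⟨M, rfl⟩ := isLocal_iff.1 hA
  have hc : ω.density Λ * cfc Real.log (ω.density Λ) =
      cfc Real.log (ω.density Λ) * ω.density Λ := by
    have h := (cfc_commute_cfc id Real.log (ω.density Λ)).eq
    rwa [cfc_id ℝ _ (ω.isHermitian_density Λ).isSelfAdjoint] at h
  rw [commutator_apply, logDensity, map_sub, ← map_mul, ← map_mul, apply_obs, apply_obs,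
    ← mul_assoc, hc, mul_assoc, Matrix.trace_mul_comm, mul_assoc, sub_self]

theorem re_mul_star_self_le (ω : State ν D) (A : QuasilocalAlg ν D) :
    (ω (A * star A)).re ≤ ‖A‖ ^ 2 := by
  have h := ω.re_star_mul_self_le (star A)
  have h' : ‖star A‖ = ‖A‖ := norm_star (A : Op ν D)
  rwa [star_star, h'] at h

variable [NeZero D] {ω : State ν D} {Λ : Finset (Site ν)}

/-- Klein's inequality as a supporting hyperplane: the right side is affine in `φ` and equals the
entropy at `φ = ω`. -/
theorem FaithfulOn.localEntropy_le (h : ω.FaithfulOn Λ) (φ : State ν D) :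
    φ.localEntropy Λ ≤ -(φ (ω.logDensity Λ)).re := by
  have h1 := relativeEntropy_nonneg (φ.posSemidef_density Λ) (φ.trace_density Λ) h.posDef
    (ω.trace_density Λ)
  rw [relativeEntropy, ← apply_obs] at h1
  change _ ≤ -(φ (obs Λ (cfc Real.log (ω.density Λ)))).re
  rw [localEntropy]
  linarith

/-- Cauchy–Schwarz is applied to the two parts of the commutator separately. The first part stands
to the left of `F`, giving `ω(N₁ N₁*)`; for the second `F` is moved to the left, giving `ω(N₂* N₂)`.
These are the two expressions that the splitting controls. -/
theorem FaithfulOn.norm_apply_commutator_mul_le (h : ω.FaithfulOn Λ)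
    (M : Matrix (Λ → Fin D) (Λ → Fin D) ℂ) {F : QuasilocalAlg ν D}
    (hF : ∀ N, Commute (obs Λ N) F) :
    ‖ω (commutator (ω.logDensity Λ) (obs Λ M) * F)‖ ≤ 2 * ‖obs Λ M‖ * ‖F‖ := by
  obtain ⟨N₁, N₂, hN, h₁, h₂⟩ := exists_split_commutator_log h.posDef M
  have e : commutator (ω.logDensity Λ) (obs Λ M) = obs Λ N₁ + obs Λ N₂ := by
    rw [commutator_apply, logDensity, ← map_mul, ← map_mul, ← map_sub, hN, map_add]
  have hM : (ω (star (obs Λ M) * obs Λ M)).re ≤ ‖obs Λ M‖ ^ 2 := ω.re_star_mul_self_le _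
  have hM' : (ω (obs Λ M * star (obs Λ M))).re ≤ ‖obs Λ M‖ ^ 2 := ω.re_mul_star_self_le _
  have b₁ : ‖ω (obs Λ N₁ * F)‖ ≤ ‖obs Λ M‖ * ‖F‖ := by
    refine le_of_sq_le_sq ?_ (by positivity)
    have hcs := ω.cauchy_schwarz (star (obs Λ N₁)) F
    rw [star_star] at hcs
    refine hcs.trans ?_
    rw [mul_pow]
    refine mul_le_mul ?_ (ω.re_star_mul_self_le F) (ω.re_nonneg F) (by positivity)
    refine le_trans ?_ hM
    rw [← StarHomClass.map_star, ← StarHomClass.map_star, ← map_mul, ← map_mul, apply_obs,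
      apply_obs]
    exact h₁
  have b₂ : ‖ω (obs Λ N₂ * F)‖ ≤ ‖obs Λ M‖ * ‖F‖ := by
    refine le_of_sq_le_sq ?_ (by positivity)
    have hcs := ω.cauchy_schwarz (star F) (obs Λ N₂)
    rw [star_star, ← (hF N₂).eq] at hcs
    refine hcs.trans ?_
    rw [mul_pow, mul_comm (‖obs Λ M‖ ^ 2)]
    refine mul_le_mul (ω.re_mul_star_self_le F) ?_ (ω.re_nonneg _) (by positivity)
    refine le_trans ?_ hM'
    rw [← StarHomClass.map_star, ← StarHomClass.map_star, ← map_mul, ← map_mul, apply_obs,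
      apply_obs]
    exact h₂
  rw [e, add_mul, map_add]
  calc _ ≤ ‖ω (obs Λ N₁ * F)‖ + ‖ω (obs Λ N₂ * F)‖ := norm_add_le _ _
    _ ≤ ‖obs Λ M‖ * ‖F‖ + ‖obs Λ M‖ * ‖F‖ := add_le_add b₁ b₂
    _ = _ := by ring

/-- Let `d = D ^ Y.card`. Expanding `A` in matrix units over `Y` gives `d²` terms. Each coefficient
is a sum of `d` sandwiches of `A` between matrix units, so it has norm at most `d ‖A‖`. Together
this gives `2 d³ ‖A‖`. -/
theorem FaithfulOn.norm_apply_commutator_le (h : ω.FaithfulOn Λ) {Y : Finset (Site ν)}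
    (hd : Disjoint Λ Y) {A : QuasilocalAlg ν D} (hA : IsLocal (Λ ∪ Y) A) :
    ‖ω (commutator (ω.logDensity Λ) A)‖ ≤ 2 * (D ^ Y.card : ℕ) ^ 3 * ‖A‖ := by
  obtain ⟨M, rfl⟩ := isLocal_iff.1 hA
  set A := obs (Λ ∪ Y) M with hAdef
  let E : (Y → Fin D) → (Y → Fin D) → Matrix (Λ → Fin D) (Λ → Fin D) ℂ :=
    fun c d => Matrix.of fun ξ η => M (glue ξ c) (glue η d)
  let F : (Y → Fin D) → (Y → Fin D) → QuasilocalAlg ν D := fun c d => obs Y (Matrix.single c d 1)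
  have hAE : A = ∑ c, ∑ d, obs Λ (E c d) * F c d := obs_union hd M
  have hcomm : ∀ N c d, Commute (obs Λ N) (F c d) := fun N c d =>
    (isLocal_obs Λ N).commute hd (isLocal_obs Y _)
  have hFF : ∀ a b c d, F a b * F c d = if b = c then F a d else 0 := by
    intro a b c d
    simp only [F]
    rw [← map_mul]
    split_ifs with hbc
    · rw [hbc, Matrix.single_mul_single_same, mul_one]
    · rw [Matrix.single_mul_single_of_ne _ _ _ _ hbc, map_zero]
  have hE : ∀ c d, obs Λ (E c d) = ∑ k, F k c * A * F d k := by
    intro c d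
    have h1 : ∀ k, F k c * A * F d k = obs Λ (E c d) * F k k := by
      intro k
      rw [hAE, Finset.mul_sum, Finset.sum_mul, Finset.sum_eq_single c, Finset.mul_sum,
        Finset.sum_mul, Finset.sum_eq_single d]
      · rw [← mul_assoc, ← (hcomm _ _ _).eq, mul_assoc, mul_assoc, hFF, if_pos rfl, hFF,
          if_pos rfl]
      · intro b _ hb
        rw [mul_assoc, mul_assoc, hFF, if_neg hb, mul_zero, mul_zero]
      · simp
      · intro a _ ha
        rw [Finset.mul_sum, Finset.sum_mul]
        refine Finset.sum_eq_zero fun b _ => ?_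
        rw [← mul_assoc, ← (hcomm _ _ _).eq, mul_assoc (obs Λ (E a b)), hFF, if_neg (Ne.symm ha),
          mul_zero, zero_mul]
      · simp
    rw [Finset.sum_congr rfl fun k _ => h1 k, ← Finset.mul_sum]
    simp only [F]
    rw [sum_obs_single, mul_one]
  have hcard : Fintype.card (Y → Fin D) = D ^ Y.card := by simp
  have hFn : ∀ c d, ‖F c d‖ ≤ 1 := fun c d => norm_obs_single_le Y c d
  have hEn : ∀ c d, ‖obs Λ (E c d)‖ ≤ (D ^ Y.card : ℕ) * ‖A‖ := by
    intro c d
    rw [hE, ← hcard, ← nsmul_eq_mul, ← Finset.card_univ, ← Finset.sum_const]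
    refine norm_sum_le_of_le _ fun k _ => ?_
    calc _ ≤ ‖F k c‖ * ‖A‖ * ‖F d k‖ :=
          (norm_mul_le _ _).trans (mul_le_mul_of_nonneg_right (norm_mul_le _ _) (norm_nonneg _))
      _ ≤ 1 * ‖A‖ * 1 := by gcongr <;> exact hFn _ _
      _ = ‖A‖ := by ring
  have hK : commutator (ω.logDensity Λ) A =
      ∑ c, ∑ d, commutator (ω.logDensity Λ) (obs Λ (E c d)) * F c d := by
    rw [hAE, map_sum]
    refine Finset.sum_congr rfl fun c _ => ?_
    rw [map_sum]
    refine Finset.sum_congr rfl fun d _ => ?_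
    rw [commutator_apply, commutator_apply, sub_mul, mul_assoc, mul_assoc, mul_assoc, logDensity,
      (hcomm (cfc Real.log (ω.density Λ)) c d).eq]
  have hterm : ∀ c d, ‖ω (commutator (ω.logDensity Λ) (obs Λ (E c d)) * F c d)‖ ≤
      2 * ((D ^ Y.card : ℕ) * ‖A‖) := by
    intro c d
    refine (h.norm_apply_commutator_mul_le (E c d) fun N => hcomm N c d).trans ?_
    calc _ ≤ 2 * ‖obs Λ (E c d)‖ * 1 :=
          mul_le_mul_of_nonneg_left (hFn c d) (by positivity)
      _ ≤ _ := by
          have := hEn c d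
          linarith
  rw [hK, map_sum]
  calc _ ≤ ∑ _c : Y → Fin D, ∑ _d : Y → Fin D, 2 * ((D ^ Y.card : ℕ) * ‖A‖) := by
        refine norm_sum_le_of_le _ fun c _ => ?_
        rw [map_sum]
        exact norm_sum_le_of_le _ fun d _ => hterm c d
    _ = _ := by
        rw [Finset.sum_const, Finset.sum_const, Finset.card_univ, hcard, nsmul_eq_mul,
          nsmul_eq_mul]
        ring

end State

/-! ### Conservation of the mean entropy -/

/-- A function touched from above at `t` has right difference quotients at `t` no larger than those
of the touching function, so its right slopes are controlled by `K` although it need not be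
differentiable. -/
theorem le_add_mul_sub_of_touching {f : ℝ → ℝ} {K a b : ℝ} (hab : a ≤ b) (hf : Continuous f)
    (h : ∀ t, ∃ (g : ℝ → ℝ) (g' : ℝ), (∀ s, f s ≤ g s) ∧ f t = g t ∧ HasDerivAt g g' t ∧ |g'| ≤ K) :
    f b ≤ f a + K * (b - a) := by
  refine image_le_of_liminf_slope_right_le_deriv_boundary (f := f) (a := a) (b := b)
    (B := fun x => f a + K * (x - a)) (B' := fun _ => K) hf.continuousOn (by simp)
    (by fun_prop) ?_ ?_ ⟨hab, le_rfl⟩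
  · intro x _
    have h1 := (((hasDerivAt_id x).sub_const a).const_mul K).const_add (f a)
    rw [mul_one] at h1
    exact h1.hasDerivWithinAt
  · intro x _ r hr
    obtain ⟨g, g', hg, hx, hd, hK⟩ := h x
    have h1 : Tendsto (slope g x) (𝓝[>] x) (𝓝 g') :=
      (hasDerivAt_iff_tendsto_slope.1 hd).mono_left (nhdsWithin_mono _ fun y hy => ne_of_gt hy)
    have h2 := h1.eventually (gt_mem_nhds (((le_abs_self g').trans hK).trans_lt hr))
    refine Eventually.frequently ?_
    filter_upwards [h2, self_mem_nhdsWithin] with z hz hxz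
    refine lt_of_le_of_lt ?_ hz
    rw [slope_def_field, slope_def_field, hx]
    exact div_le_div_of_nonneg_right (sub_le_sub_right (hg z) _) (sub_nonneg.2 (le_of_lt hxz))

theorem abs_sub_le_of_touching {f : ℝ → ℝ} {K : ℝ} (hf : Continuous f)
    (h : ∀ t, ∃ (g : ℝ → ℝ) (g' : ℝ), (∀ s, f s ≤ g s) ∧ f t = g t ∧ HasDerivAt g g' t ∧ |g'| ≤ K)
    (a b : ℝ) : |f b - f a| ≤ K * |b - a| := by
  have key : ∀ a b, a ≤ b → |f b - f a| ≤ K * |b - a| := by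
    intro a b hab
    have h1 := le_add_mul_sub_of_touching hab hf h
    -- Touching from above constrains both sides of `t`; reversing the time axis gives the lower
    -- bound on the increment.
    have h2 := le_add_mul_sub_of_touching (f := fun t => f (-t)) (neg_le_neg hab)
      (hf.comp continuous_neg) (fun t => by
        obtain ⟨g, g', hg, hx, hd, hK⟩ := h (-t)
        refine ⟨fun s => g (-s), -g', fun s => hg _, hx, ?_, by rwa [abs_neg]⟩
        have h3 := hd.scomp t (hasDerivAt_neg t)
        rwa [neg_one_smul] at h3)
    simp only [neg_neg] at h2
    rw [abs_of_nonneg (sub_nonneg.2 hab), abs_le]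
    constructor <;> linarith
  rcases le_total a b with hab | hab
  · exact key a b hab
  · rw [abs_sub_comm, abs_sub_comm b]
    exact key b a hab

theorem isClosed_isLocal (Λ : Finset (Site ν)) :
    IsClosed {A : QuasilocalAlg ν D | IsLocal Λ A} := by
  have h := (LinearMap.range (obs (D := D) Λ).toAlgHom.toLinearMap).closed_of_finiteDimensional
  convert h using 1
  ext A
  exact isLocal_iff

theorem IsLocal.commutatorPow {Λ : Finset (Site ν)} {H : QuasilocalAlg ν D} (hH : IsLocal Λ H)
    (n : ℕ) : ∀ {A : QuasilocalAlg ν D}, IsLocal Λ A → IsLocal Λ (commutatorPow H n A) := by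
  induction n with
  | zero => intro A hA; rwa [commutatorPow_zero]
  | succ n ih =>
    intro A hA
    rw [commutatorPow_succ]
    exact ih ((hH.mul hA).sub (hA.mul hH))

theorem IsLocal.innerAut {Λ : Finset (Site ν)} {H : selfAdjoint (QuasilocalAlg ν D)}
    (hH : IsLocal Λ (H : QuasilocalAlg ν D)) (t : ℝ) {A : QuasilocalAlg ν D} (hA : IsLocal Λ A) :
    IsLocal Λ (innerAut H t A) := by
  refine (isClosed_isLocal Λ).mem_of_tendsto (hasSum_innerAut H t A)
    (Eventually.of_forall fun s => ?_)
  change ((∑ n ∈ s, _ : QuasilocalAlg ν D) : Op ν D) ∈ localAlg ν D Λ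
  push_cast
  exact sum_mem fun n _ => (localAlg ν D Λ).smul_mem (hH.commutatorPow n hA) _

theorem State.comp_mix (ω ω' : State ν D) (ε : ℝ) (h0 : 0 ≤ ε) (h1 : ε ≤ 1)
    (θ : QuasilocalAlg ν D ≃⋆ₐ[ℂ] QuasilocalAlg ν D) :
    (ω.mix ω' ε h0 h1).comp θ = (ω.comp θ).mix (ω'.comp θ) ε h0 h1 :=
  State.ext fun _ => rfl

theorem tsum_le_tsum_of_translate {g k : Site ν → ℝ} (x : Site ν) (hg : Summable g)
    (hk : Summable k) (h : ∀ z, g (z + x) ≤ k z) : ∑' y, g y ≤ ∑' z, k z := by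
  rw [← (Equiv.addRight x).tsum_eq g]
  exact Summable.tsum_le_tsum h ((Equiv.addRight x).summable_iff.2 hg) hk

/-! ### Entropy flow across the boundary of a region -/

namespace Interaction

variable (Φ : Interaction ν D)

theorem isLocal_ham (Λ : Finset (Site ν)) : IsLocal Λ (Φ.ham Λ : QuasilocalAlg ν D) := by
  rw [coe_ham, IsLocal]
  push_cast
  exact sum_mem fun X hX => (Φ.isLocal X).mono (Finset.mem_powerset.1 hX)

/-- The strength of the terms that couple the site `x` to the complement of `Λ`. -/
def crossing (Λ : Finset (Site ν)) (x : Site ν) : ℝ :=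
  ∑' y, if y ∈ Λ then 0 else ‖Φ {x, y}‖

/-- The strength of the terms that couple `Λ` to its complement. -/
def boundary (Λ : Finset (Site ν)) : ℝ := ∑ x ∈ Λ, Φ.crossing Λ x

variable {Φ}

theorem summable_crossing (hΦ : Φ.IsSummable) (Λ : Finset (Site ν)) (x : Site ν) :
    Summable fun y => if y ∈ Λ then 0 else ‖Φ {x, y}‖ := by
  refine Summable.of_nonneg_of_le (fun y => ?_) (fun y => ?_) (hasSum_norm_pair hΦ x).summable
  · split_ifs <;> simp
  · split_ifs <;> simp

theorem crossing_le_strength (hΦ : Φ.IsSummable) (Λ : Finset (Site ν)) (x : Site ν) :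
    Φ.crossing Λ x ≤ Φ.strength := by
  rw [← (hasSum_norm_pair hΦ x).tsum_eq]
  refine (summable_crossing hΦ Λ x).tsum_le_tsum (fun y => ?_) (hasSum_norm_pair hΦ x).summable
  split_ifs <;> simp

theorem hasSum_crossing (hΦ : Φ.IsSummable) {Λ : Finset (Site ν)} {x : Site ν} (hx : x ∈ Λ) :
    HasSum (fun Z => if x ∈ Z ∧ ¬ Z ⊆ Λ then ‖Φ Z‖ else 0) (Φ.crossing Λ x) := by
  refine hasSum_of_hasSum_pair (x := x) ?_ ?_
  · refine (congrArg (HasSum · (Φ.crossing Λ x)) (funext fun y => ?_)).mpr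
      (summable_crossing hΦ Λ x).hasSum
    by_cases hy : y ∈ Λ
    · rw [if_pos hy, if_neg]
      rintro ⟨_, h⟩
      exact h (Finset.insert_subset hx (Finset.singleton_subset_iff.2 hy))
    · rw [if_neg hy, if_pos]
      exact ⟨Finset.mem_insert_self _ _, fun h => hy (h (by simp))⟩
  · rintro Z (hx | hZ)
    · exact if_neg fun h => hx h.1
    · rw [Φ.two_body Z hZ, norm_zero, ite_self]

theorem norm_apply_commutator_term_le [NeZero D] {ω : State ν D} {Λ : Finset (Site ν)}
    (h : ω.FaithfulOn Λ) (Z : Finset (Site ν)) :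
    ‖ω (commutator (ω.logDensity Λ) (Φ Z))‖ ≤
      2 * (D : ℝ) ^ 3 * ∑ x ∈ Λ, if x ∈ Z ∧ ¬ Z ⊆ Λ then ‖Φ Z‖ else 0 := by
  have hnn : 0 ≤ ∑ x ∈ Λ, if x ∈ Z ∧ ¬ Z ⊆ Λ then ‖Φ Z‖ else 0 :=
    Finset.sum_nonneg fun x _ => by split_ifs <;> simp
  have hrhs : 0 ≤ 2 * (D : ℝ) ^ 3 * ∑ x ∈ Λ, if x ∈ Z ∧ ¬ Z ⊆ Λ then ‖Φ Z‖ else 0 :=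
    mul_nonneg (by positivity) hnn
  by_cases hsub : Z ⊆ Λ
  · rw [ω.apply_commutator_logDensity_eq_zero ((Φ.isLocal Z).mono hsub), norm_zero]
    exact hrhs
  by_cases hd : Disjoint Λ Z
  · have h0 : commutator (ω.logDensity Λ) (Φ Z) = 0 := by
      rw [commutator_apply, sub_eq_zero]
      exact (ω.isLocal_logDensity Λ).commute hd (Φ.isLocal Z)
    rw [h0, map_zero, norm_zero]
    exact hrhs
  by_cases hZ : 2 < Z.card
  · rw [Φ.two_body Z hZ, map_zero, map_zero, norm_zero]
    rw [Φ.two_body Z hZ] at hrhs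
    exact hrhs
  obtain ⟨x, hxΛ, hxZ⟩ := Finset.not_disjoint_iff.1 hd
  -- A two-body term crossing the boundary has exactly one site outside `Λ`, so the auxiliary
  -- dimension is `D` and the constant is `2 * D ^ 3`.
  have hcard : (Z \ Λ).card = 1 := by
    have h1 : (Z \ Λ).card ≤ 1 := by
      have : Z \ Λ ⊆ Z.erase x := fun y hy => by
        rw [Finset.mem_sdiff] at hy
        exact Finset.mem_erase.2 ⟨fun h => hy.2 (h ▸ hxΛ), hy.1⟩
      have h2 := Finset.card_le_card this
      rw [Finset.card_erase_of_mem hxZ] at h2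
      omega
    have h2 : 0 < (Z \ Λ).card := Finset.card_pos.2 (Finset.sdiff_nonempty.2 hsub)
    omega
  have hloc : IsLocal (Λ ∪ Z \ Λ) (Φ Z) := (Φ.isLocal Z).mono (by
    rw [Finset.union_sdiff_self_eq_union]
    exact Finset.subset_union_right)
  have h1 := h.norm_apply_commutator_le Finset.disjoint_sdiff hloc
  rw [hcard, pow_one] at h1
  refine h1.trans (mul_le_mul_of_nonneg_left ?_ (by positivity))
  have h2 : (if x ∈ Z ∧ ¬ Z ⊆ Λ then ‖Φ Z‖ else 0) ≤
      ∑ x ∈ Λ, if x ∈ Z ∧ ¬ Z ⊆ Λ then ‖Φ Z‖ else 0 :=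
    Finset.single_le_sum (f := fun x => if x ∈ Z ∧ ¬ Z ⊆ Λ then ‖Φ Z‖ else 0)
      (fun x _ => by split_ifs <;> simp) hxΛ
  rwa [if_pos ⟨hxZ, hsub⟩] at h2

theorem norm_apply_commutator_ham_le [NeZero D] (hΦ : Φ.IsSummable) {ω : State ν D}
    {Λ : Finset (Site ν)} (h : ω.FaithfulOn Λ) (Λ' : Finset (Site ν)) :
    ‖ω (commutator (Φ.ham Λ' : QuasilocalAlg ν D) (ω.logDensity Λ))‖ ≤
      2 * (D : ℝ) ^ 3 * Φ.boundary Λ := by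
  have h1 : HasSum (fun Z => ∑ x ∈ Λ, if x ∈ Z ∧ ¬ Z ⊆ Λ then ‖Φ Z‖ else 0) (Φ.boundary Λ) :=
    hasSum_sum fun x hx => hasSum_crossing hΦ hx
  have h2 : ∑ Z ∈ Λ'.powerset, ∑ x ∈ Λ, (if x ∈ Z ∧ ¬ Z ⊆ Λ then ‖Φ Z‖ else 0) ≤ Φ.boundary Λ :=
    sum_le_hasSum _ (fun Z _ => Finset.sum_nonneg fun x _ => by split_ifs <;> simp) h1
  have hc : ∀ Z, ‖ω (commutator (Φ Z) (ω.logDensity Λ))‖ =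
      ‖ω (commutator (ω.logDensity Λ) (Φ Z))‖ := by
    intro Z
    rw [commutator_apply, commutator_apply, map_sub, map_sub, norm_sub_rev]
  rw [commutator_ham, map_sum]
  refine le_trans ?_ (mul_le_mul_of_nonneg_left h2 (by positivity))
  rw [Finset.mul_sum]
  refine norm_sum_le_of_le _ fun Z _ => ?_
  rw [hc]
  exact norm_apply_commutator_term_le h Z

theorem abs_localEntropy_sub_le_of_faithfulOn [NeZero D] (hΦ : Φ.IsSummable) {ω : State ν D}
    {Λ Λ' : Finset (Site ν)} (hΛ : Λ ⊆ Λ') (h : ω.FaithfulOn Λ') (t : ℝ) :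
    |(ω.comp (innerAut (Φ.ham Λ') t)).localEntropy Λ - ω.localEntropy Λ| ≤
      2 * (D : ℝ) ^ 3 * Φ.boundary Λ * |t| := by
  have hfaith : ∀ t, (ω.comp (innerAut (Φ.ham Λ') t)).FaithfulOn Λ := fun t =>
    (h.comp fun A hA => (Φ.isLocal_ham Λ').innerAut t hA).mono hΛ
  have hcont : Continuous fun t => (ω.comp (innerAut (Φ.ham Λ') t)).localEntropy Λ := by
    rw [continuous_iff_continuousAt]
    intro t
    refine State.tendsto_localEntropy fun A _ => ?_
    exact (ω.continuous.tendsto _).comp (hasDerivAt_innerAut (Φ.ham Λ') A t).continuousAt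
  have key := abs_sub_le_of_touching hcont (K := 2 * (D : ℝ) ^ 3 * Φ.boundary Λ) (fun t => by
    set φ := ω.comp (innerAut (Φ.ham Λ') t) with hφ
    -- The touching function at time `t` freezes the logarithm of the density matrix at `t` and
    -- evolves only the state. The state stays faithful because the evolution maps `𝒜(Λ')` into
    -- itself.
    refine ⟨fun s => -(ω (innerAut (Φ.ham Λ') s (φ.logDensity Λ))).re,
      -(φ (Complex.I • commutator (Φ.ham Λ' : QuasilocalAlg ν D) (φ.logDensity Λ))).re,
      fun s => (hfaith t).localEntropy_le _, φ.localEntropy_eq Λ, ?_, ?_⟩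
    · have h1 := hasDerivAt_innerAut (Φ.ham Λ') (φ.logDensity Λ) t
      have h2 := ((Complex.reCLM.comp (ω.toCLM.restrictScalars ℝ)).hasFDerivAt.comp_hasDerivAt
        t h1).neg
      exact h2
    · rw [abs_neg]
      refine (Complex.abs_re_le_norm _).trans ?_
      rw [map_smul, norm_smul, Complex.norm_I, one_mul]
      exact norm_apply_commutator_ham_le hΦ (hfaith t) Λ') 0 t
  have h0 : ω.comp (innerAut (Φ.ham Λ') 0) = ω := State.ext fun A => by
    change ω (innerAut (Φ.ham Λ') 0 A) = ω A
    rw [innerAut_zero]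
  rwa [h0, sub_zero] at key

theorem abs_localEntropy_innerAut_sub_le [NeZero D] (hΦ : Φ.IsSummable) (ω : State ν D)
    {Λ Λ' : Finset (Site ν)} (hΛ : Λ ⊆ Λ') (t : ℝ) :
    |(ω.comp (innerAut (Φ.ham Λ') t)).localEntropy Λ - ω.localEntropy Λ| ≤
      2 * (D : ℝ) ^ 3 * Φ.boundary Λ * |t| := by
  -- Mixing in a little of a state that is the trace on `Λ'` makes `ω` faithful. The mixture
  -- commutes with the evolution and the bound does not depend on it.
  refine le_of_tendsto ((((State.tendsto_localEntropy_mix (ω.comp (innerAut (Φ.ham Λ') t))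
    ((ω.twirl Λ').comp (innerAut (Φ.ham Λ') t)) Λ).sub
      (State.tendsto_localEntropy_mix ω (ω.twirl Λ') Λ))).abs) (Eventually.of_forall fun n => ?_)
  rw [← State.comp_mix]
  exact abs_localEntropy_sub_le_of_faithfulOn hΦ hΛ
    ((State.faithfulOn_twirl ω Λ').mix (by positivity) _) t

theorem abs_localEntropy_dynamics_sub_le [NeZero D] (hΦ : Φ.IsSummable) (ω : State ν D)
    (Λ : Finset (Site ν)) (t : ℝ) :
    |(ω.comp (dynamics hΦ t)).localEntropy Λ - ω.localEntropy Λ| ≤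
      2 * (D : ℝ) ^ 3 * Φ.boundary Λ * |t| := by
  have h : Tendsto (fun Λ' => (ω.comp (innerAut (Φ.ham Λ') t)).localEntropy Λ) atTop
      (𝓝 ((ω.comp (dynamics hΦ t)).localEntropy Λ)) :=
    State.tendsto_localEntropy fun A _ =>
      (ω.continuous.tendsto _).comp (tendsto_dynamics hΦ t A)
  refine le_of_tendsto ((h.sub_const (ω.localEntropy Λ)).abs) ?_
  filter_upwards [eventually_ge_atTop Λ] with Λ' hΛ'
  exact abs_localEntropy_innerAut_sub_le hΦ ω hΛ' t

theorem crossing_le_of_mem_bulk (hΦ : Φ.IsSummable) {r : ℕ} {Λ : Finset (Site ν)} {x : Site ν}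
    (hx : x ∈ bulk r Λ) : Φ.crossing Λ x ≤ Φ.crossing (cube ν r) 0 := by
  have hsub : translateSet x (cube ν r) ⊆ Λ := (Finset.mem_filter.1 hx).2
  refine tsum_le_tsum_of_translate x (summable_crossing hΦ Λ x) (summable_crossing hΦ _ 0)
    fun z => ?_
  rw [Φ.norm_pair, add_sub_cancel_right]
  by_cases hz : z ∈ cube ν r
  · rw [if_pos hz, if_pos]
    exact hsub (mem_translateSet.2 (by rwa [add_sub_cancel_right]))
  · rw [if_neg hz]
    split_ifs <;> simp

theorem tendsto_crossing_cube (hΦ : Φ.IsSummable) :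
    Tendsto (fun r => Φ.crossing (cube ν r) 0) atTop (𝓝 0) := by
  have h := tendsto_tsum_of_dominated_convergence (𝓕 := atTop)
    (f := fun (r : ℕ) (y : Site ν) => if y ∈ cube ν r then 0 else ‖Φ {0, y}‖)
    (g := fun _ => (0 : ℝ)) (bound := fun y => ‖Φ {0, y}‖) hΦ ?_ ?_
  · rwa [tsum_zero] at h
  · intro y
    refine tendsto_const_nhds.congr' ?_
    filter_upwards [eventually_ge_atTop (∑ i, (y i).natAbs)] with r hr
    rw [if_pos]
    rw [mem_cube]
    intro i
    have := Finset.single_le_sum (f := fun i => (y i).natAbs) (fun _ _ => Nat.zero_le _)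
      (Finset.mem_univ i)
    omega
  · refine Eventually.of_forall fun r y => ?_
    split_ifs <;> simp

/-- Bulk sites couple to the complement of `Λ` only beyond the cube of radius `r`, with strength
small for large `r`; for the others, a vanishing fraction in the van Hove limit, the total strength
is a sufficient bound. -/
theorem boundary_le (hΦ : Φ.IsSummable) (r : ℕ) (Λ : Finset (Site ν)) :
    Φ.boundary Λ ≤ Λ.card * Φ.crossing (cube ν r) 0 +
      (Λ.card - (bulk r Λ).card) * Φ.strength := by
  have hsub : bulk r Λ ⊆ Λ := Finset.filter_subset _ _
  have h0 : 0 ≤ Φ.crossing (cube ν r) 0 := tsum_nonneg fun y => by split_ifs <;> simp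
  rw [boundary, ← Finset.sum_sdiff hsub, add_comm]
  refine add_le_add ?_ ?_
  · calc _ ≤ ∑ _x ∈ bulk r Λ, Φ.crossing (cube ν r) 0 :=
          Finset.sum_le_sum fun x hx => crossing_le_of_mem_bulk hΦ hx
      _ = (bulk r Λ).card * Φ.crossing (cube ν r) 0 := by rw [Finset.sum_const, nsmul_eq_mul]
      _ ≤ _ := mul_le_mul_of_nonneg_right (Nat.cast_le.2 (Finset.card_le_card hsub)) h0
  · calc _ ≤ ∑ _x ∈ Λ \ bulk r Λ, Φ.strength :=
          Finset.sum_le_sum fun x _ => crossing_le_strength hΦ Λ x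
      _ = _ := by
          rw [Finset.sum_const, nsmul_eq_mul, Finset.card_sdiff_of_subset hsub,
            Nat.cast_sub (Finset.card_le_card hsub)]

theorem tendsto_boundary_vanHove (hΦ : Φ.IsSummable) :
    Tendsto (fun Λ => Φ.boundary Λ / (Λ.card : ℝ)) (vanHove ν) (𝓝 0) := by
  refine tendsto_order.2 ⟨fun ε hε => Eventually.of_forall fun Λ => ?_, fun ε hε => ?_⟩
  · refine hε.trans_le (div_nonneg (Finset.sum_nonneg fun x _ => tsum_nonneg fun y => ?_)
      (Nat.cast_nonneg _))
    split_ifs <;> simp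
  · obtain ⟨r, hr⟩ := ((tendsto_crossing_cube hΦ).eventually (gt_mem_nhds (half_pos hε))).exists
    have h1 := ((tendsto_bulk_vanHove (ν := ν) r).mul_const Φ.strength)
    rw [zero_mul] at h1
    filter_upwards [h1.eventually (gt_mem_nhds (half_pos hε))] with Λ hΛ
    rcases Nat.eq_zero_or_pos Λ.card with h0 | h0
    · rw [h0, Nat.cast_zero, div_zero]
      exact hε
    · have hc : (0 : ℝ) < Λ.card := Nat.cast_pos.2 h0
      calc _ ≤ (Λ.card * Φ.crossing (cube ν r) 0 +
            (Λ.card - (bulk r Λ).card) * Φ.strength) / (Λ.card : ℝ) :=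
            div_le_div_of_nonneg_right (boundary_le hΦ r Λ) hc.le
        _ = Φ.crossing (cube ν r) 0 +
            ((Λ.card : ℝ) - (bulk r Λ).card) / (Λ.card : ℝ) * Φ.strength := by
            field_simp
        _ < ε / 2 + ε / 2 := add_lt_add hr hΛ
        _ = ε := add_halves ε

end Interaction

theorem State.HasMeanEntropy.comp_dynamics [NeZero D] {ω : State ν D} {s : ℝ}
    (hω : ω.HasMeanEntropy s) {Φ : Interaction ν D} (hΦ : Φ.IsSummable) (t : ℝ) :
    (ω.comp (Interaction.dynamics hΦ t)).HasMeanEntropy s := by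
  have h1 : Tendsto (fun Λ => (ω.comp (Interaction.dynamics hΦ t)).localEntropy Λ / (Λ.card : ℝ) -
      ω.localEntropy Λ / (Λ.card : ℝ)) (vanHove ν) (𝓝 0) := by
    have h2 := (Interaction.tendsto_boundary_vanHove hΦ).const_mul (2 * (D : ℝ) ^ 3 * |t|)
    rw [mul_zero] at h2
    refine squeeze_zero_norm (fun Λ => ?_) h2
    rw [← sub_div, Real.norm_eq_abs, abs_div, Nat.abs_cast, ← mul_div_assoc]
    refine div_le_div_of_nonneg_right ?_ (Nat.cast_nonneg _)
    refine (Interaction.abs_localEntropy_dynamics_sub_le hΦ ω Λ t).trans (le_of_eq ?_)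
    ring
  have h3 := h1.add hω
  rw [zero_add] at h3
  refine h3.congr fun Λ => ?_
  ring

/-! ### Summability of the interaction -/

theorem summable_prod_apply {f : ℤ → ℝ} (hf : Summable f) (h0 : ∀ k, 0 ≤ f k) (n : ℕ) :
    Summable fun x : Fin n → ℤ => ∏ i, f (x i) := by
  induction n with
  | zero => exact Summable.of_finite
  | succ n ih =>
    rw [← (Fin.consEquiv fun _ : Fin (n + 1) => ℤ).summable_iff]
    refine (hf.mul_of_nonneg ih h0 fun x => Finset.prod_nonneg fun i _ => h0 _).congr fun p => ?_
    simp [Fin.prod_univ_succ, Fin.consEquiv]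

theorem summable_int_one_add_abs_sq_inv : Summable fun k : ℤ => ((1 + |(k : ℝ)|) ^ 2)⁻¹ := by
  have h : Summable fun n : ℕ => ((1 + (n : ℝ)) ^ 2)⁻¹ := by
    have h1 := (summable_nat_add_iff 1).2 (Real.summable_nat_pow_inv.2 one_lt_two)
    refine h1.congr fun n => ?_
    push_cast
    rw [add_comm]
  exact Summable.of_nat_of_neg (by simpa using h) (by simpa using h)

theorem abs_apply_le_siteNorm (x : Site ν) (i : Fin ν) : |(x i : ℝ)| ≤ siteNorm x := by
  rw [siteNorm, ← Real.sqrt_sq_eq_abs]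
  exact Real.sqrt_le_sqrt (Finset.single_le_sum (f := fun i => (x i : ℝ) ^ 2)
    (fun _ _ => sq_nonneg _) (Finset.mem_univ i))

/-- Each coordinate is at most the Euclidean length, so an exponent of at least `2ν` leaves two
powers for each of the `ν` coordinates. The lattice sum is thereby dominated by a product of
convergent one-dimensional sums. -/
theorem one_add_siteNorm_rpow_le {α : ℝ} (hα : 2 * (ν : ℝ) ≤ α) (x : Site ν) :
    (1 + siteNorm x) ^ (-α) ≤ ∏ i, ((1 + |(x i : ℝ)|) ^ 2)⁻¹ := by
  have h0 : 0 ≤ siteNorm x := Real.sqrt_nonneg _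
  rw [Real.rpow_neg (by positivity), Finset.prod_inv_distrib]
  refine inv_anti₀ (Finset.prod_pos fun i _ => by positivity) ?_
  calc ∏ i, (1 + |(x i : ℝ)|) ^ 2 ≤ ∏ _i : Fin ν, (1 + siteNorm x) ^ 2 := by
        refine Finset.prod_le_prod (fun i _ => by positivity) fun i _ => ?_
        exact pow_le_pow_left₀ (by positivity) (add_le_add_right (abs_apply_le_siteNorm x i) 1) 2
    _ = (1 + siteNorm x) ^ (2 * (ν : ℝ)) := by
        rw [Finset.prod_const, Finset.card_univ, Fintype.card_fin, ← pow_mul, ← Real.rpow_natCast]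
        push_cast
        rfl
    _ ≤ _ := Real.rpow_le_rpow_of_exponent_le (by linarith) hα

theorem Interaction.isSummable_of_norm_lt {Φ : Interaction ν D} {C α : ℝ}
    (hα : 2 * (ν : ℝ) < α) (hΦ : ∀ x : Site ν, ‖Φ {0, x}‖ < C * (1 + siteNorm x) ^ (-α)) :
    Φ.IsSummable := by
  have hpos : ∀ x : Site ν, 0 < (1 + siteNorm x) ^ (-α) := fun x =>
    Real.rpow_pos_of_pos (by have : 0 ≤ siteNorm x := Real.sqrt_nonneg _; positivity) _
  have hC : 0 ≤ C := (pos_of_mul_pos_left ((norm_nonneg _).trans_lt (hΦ 0)) (hpos 0).le).le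
  refine Summable.of_nonneg_of_le (fun _ => norm_nonneg _) (fun x => ?_)
    ((summable_prod_apply summable_int_one_add_abs_sq_inv (fun k => by positivity) ν).mul_left C)
  exact (hΦ x).le.trans (mul_le_mul_of_nonneg_left (one_add_siteNorm_rpow_le hα.le x) hC)

/-! ### Infinite times and time reversal -/

namespace State

theorem IsTranslationInvariant.of_tendsto {ψ : ℕ → State ν D} {φ : State ν D}
    (hψ : ∀ n, (ψ n).IsTranslationInvariant) (h : ∀ A, Tendsto (fun n => ψ n A) atTop (𝓝 (φ A))) :
    φ.IsTranslationInvariant := fun x A =>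
  tendsto_nhds_unique (h (translate ν D x A)) ((h A).congr fun n => (hψ n x A).symm)

/-- The image `A ↦ conj (φ (Θ A))` of a state under a time-reversal operation. -/
def reverse (φ : State ν D) (Θ : TimeReversal ν D) : State ν D where
  toFun :=
    { toFun := fun A => star (φ (Θ.toRingEquiv A))
      map_add' := fun A B => by rw [map_add, map_add, star_add]
      map_smul' := fun c A => by
        rw [Θ.map_smul, map_smul, smul_eq_mul, star_mul, star_star, mul_comm, RingHom.id_apply,
          smul_eq_mul] }
  nonneg A := by
    change 0 ≤ star (φ (Θ.toRingEquiv (star A * A)))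
    rw [map_mul, Θ.map_star, star_nonneg_iff]
    exact φ.nonneg _
  normalized := by
    change star (φ (Θ.toRingEquiv 1)) = 1
    rw [map_one, φ.normalized, star_one]

theorem reverse_apply (φ : State ν D) (Θ : TimeReversal ν D) (A : QuasilocalAlg ν D) :
    φ.reverse Θ A = star (φ (Θ.toRingEquiv A)) := rfl

/-- Taking the complex conjugate does not change real parts, and `Θ` is real-linear, so all local
entropies agree. -/
theorem meanEntropy_reverse [NeZero D] (φ : State ν D) (Θ : TimeReversal ν D) :
    (φ.reverse Θ).meanEntropy = φ.meanEntropy := by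
  have h : ∀ Λ, (φ.reverse Θ).localEntropy Λ = φ.localEntropy Λ := by
    intro Λ
    refine (localEntropy_eq_of_ringHom (ω := φ.reverse Θ) (ω' := φ) (Λ := Λ) (Λ' := Λ)
      (Θ.toRingEquiv : QuasilocalAlg ν D →+* QuasilocalAlg ν D) Θ.map_star (fun r A => ?_)
      (fun A hA => (Θ.isLocal_iff Λ A).2 hA) (fun B hB => ?_) rfl (fun A _ => ?_)).symm
    · have := Θ.map_smul (r : ℂ) A
      rwa [RCLike.star_def, Complex.conj_ofReal] at this
    · refine ⟨Θ.toRingEquiv.symm B, ?_, Θ.toRingEquiv.apply_symm_apply B⟩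
      rwa [← Θ.isLocal_iff, RingEquiv.apply_symm_apply]
    · rw [reverse_apply]
      exact (Complex.conj_re _).symm
  simp only [meanEntropy, h]

end State

/-- The limit of the reversed motion is the reversed limit. The sequence `v` is arbitrary so that
both `u` and `-u` can be inserted. -/
theorem TimeReversalInvariant.exists_reversal [NeZero D]
    {τ : ℝ → QuasilocalAlg ν D ≃⋆ₐ[ℂ] QuasilocalAlg ν D} {ω : State ν D}
    (h : TimeReversalInvariant τ ω) {v : ℕ → ℝ} {φ : State ν D}
    (hφ : ∀ A, Tendsto (fun n => ω.comp (τ (v n)) A) atTop (𝓝 (φ A))) :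
    ∃ φ' : State ν D, (∀ A, Tendsto (fun n => ω.comp (τ (-v n)) A) atTop (𝓝 (φ' A))) ∧
      φ'.meanEntropy = φ.meanEntropy := by
  rcases h with h | ⟨Θ, h⟩
  · exact ⟨φ, fun A => (hφ A).congr fun n => (h (v n) A).symm, rfl⟩
  · refine ⟨φ.reverse Θ, fun A => ?_, φ.meanEntropy_reverse Θ⟩
    exact ((hφ (Θ.toRingEquiv A)).star).congr fun n => (h (v n) A).symm

section IsStateAt

variable {τ : ℝ → QuasilocalAlg ν D ≃⋆ₐ[ℂ] QuasilocalAlg ν D} {ω φ : State ν D} {u : ℕ → ℝ}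

theorem isStateAt_top :
    IsStateAt τ ω u ⊤ φ ↔ ∀ A, Tendsto (fun n => ω.comp (τ (u n)) A) atTop (𝓝 (φ A)) := by
  simp [IsStateAt]

theorem isStateAt_bot :
    IsStateAt τ ω u ⊥ φ ↔ ∀ A, Tendsto (fun n => ω.comp (τ (-u n)) A) atTop (𝓝 (φ A)) := by
  simp [IsStateAt]

theorem isStateAt_coe {t : ℝ} : IsStateAt τ ω u t φ ↔ φ = ω.comp (τ t) := by
  simp only [IsStateAt, EReal.coe_eq_coe_iff, EReal.coe_ne_top, EReal.coe_ne_bot, false_implies,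
    and_true]
  exact ⟨fun h => h t rfl, fun h s hs => hs ▸ h⟩

theorem IsStateAt.isTranslationInvariant
    (hτ : ∀ t, (ω.comp (τ t)).IsTranslationInvariant) {T : EReal} (h : IsStateAt τ ω u T φ) :
    φ.IsTranslationInvariant := by
  induction T with
  | bot => exact .of_tendsto (fun n => hτ (-u n)) (isStateAt_bot.1 h)
  | coe t => exact isStateAt_coe.1 h ▸ hτ t
  | top => exact .of_tendsto (fun n => hτ (u n)) (isStateAt_top.1 h)

theorem IsStateAt.exists_bot_of_top [NeZero D] (hrev : TimeReversalInvariant τ ω)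
    (h : IsStateAt τ ω u ⊤ φ) :
    ∃ φ', IsStateAt τ ω u ⊥ φ' ∧ φ'.meanEntropy = φ.meanEntropy := by
  obtain ⟨φ', h', hs⟩ := hrev.exists_reversal (isStateAt_top.1 h)
  exact ⟨φ', isStateAt_bot.2 h', hs⟩

theorem IsStateAt.exists_top_of_bot [NeZero D] (hrev : TimeReversalInvariant τ ω)
    (h : IsStateAt τ ω u ⊥ φ) :
    ∃ φ', IsStateAt τ ω u ⊤ φ' ∧ φ'.meanEntropy = φ.meanEntropy := by
  obtain ⟨φ', h', hs⟩ := hrev.exists_reversal (isStateAt_bot.1 h)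
  simp only [neg_neg] at h'
  exact ⟨φ', isStateAt_top.2 h', hs⟩

/-- The second law, compared with time `0`, places the value at `-∞` below `s` and that at `+∞`
above. Reversal supplies at the opposite end a state with the same mean entropy, so both
inequalities hold at either end. If neither limit exists, only finite times remain. -/
theorem ModifiedSecondLaw.meanEntropyConstant [NeZero D] (hlaw : ModifiedSecondLaw τ ω u)
    (hrev : TimeReversalInvariant τ ω) {s : ℝ} (hs : ∀ t, (ω.comp (τ t)).meanEntropy = s) :
    MeanEntropyConstant τ ω u := by
  have h0 : IsStateAt τ ω u ((0 : ℝ) : EReal) (ω.comp (τ 0)) := isStateAt_coe.2 rfl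
  have hbot : ∀ φ, IsStateAt τ ω u ⊥ φ → φ.meanEntropy ≤ s := fun φ h =>
    (hlaw _ _ (EReal.bot_lt_coe 0) _ _ h h0).trans_eq (hs 0)
  have htop : ∀ φ, IsStateAt τ ω u ⊤ φ → s ≤ φ.meanEntropy := fun φ h =>
    (hs 0).symm.trans_le (hlaw _ _ (EReal.coe_lt_top 0) _ _ h0 h)
  have key : ∀ (T : EReal) (φ : State ν D), IsStateAt τ ω u T φ → φ.meanEntropy = s := by
    intro T φ h
    induction T with
    | bot =>
      obtain ⟨φ', h', he⟩ := h.exists_top_of_bot hrev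
      exact le_antisymm (hbot φ h) ((htop φ' h').trans_eq he)
    | coe t => rw [isStateAt_coe.1 h, hs t]
    | top =>
      obtain ⟨φ', h', he⟩ := h.exists_bot_of_top hrev
      exact le_antisymm (he.symm.trans_le (hbot φ' h')) (htop φ h)
  intro T₁ T₂ φ₁ φ₂ h₁ h₂
  rw [key T₁ φ₁ h₁, key T₂ φ₂ h₂]

end IsStateAt


end SpinSystem

end

/-! ### The proposition -/

open SpinSystem Filter in
theorem proposition2p2 {ν D : ℕ} [NeZero ν] [NeZero D] (Φ : Interaction ν D) (C α : ℝ)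
    (hα : 2 * (ν : ℝ) < α)
    (hΦ : ∀ x : Site ν, ‖Φ {0, x}‖ < C * (1 + siteNorm x) ^ (-α)) :
    ∃ τ : ℝ → QuasilocalAlg ν D ≃⋆ₐ[ℂ] QuasilocalAlg ν D, Φ.IsDynamics τ ∧
      ∀ ω : State ν D, ω.IsTranslationInvariant →
        (∀ t : ℝ, (ω.comp (τ t)).HasMeanEntropy ω.meanEntropy ∧
          (ω.comp (τ t)).meanEntropy = ω.meanEntropy) ∧
        ∀ u : ℕ → ℝ, Tendsto u atTop atTop →
          (∀ (T : EReal) (φ : State ν D), IsStateAt τ ω u T φ →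
            φ.HasMeanEntropy φ.meanEntropy) ∧
          (TimeReversalInvariant τ ω → ∀ φ : State ν D, IsStateAt τ ω u ⊤ φ →
            ω.meanEntropy < φ.meanEntropy →
            ∃ φ' : State ν D, IsStateAt τ ω u ⊥ φ' ∧ ω.meanEntropy < φ'.meanEntropy) ∧
          (ModifiedSecondLaw τ ω u → MeanEntropyConstant τ ω u ∨ TimeArrow τ ω) := by
  have hsum : Φ.IsSummable := Interaction.isSummable_of_norm_lt hα hΦ
  refine ⟨Interaction.dynamics hsum, Interaction.isDynamics hsum, fun ω hω => ?_⟩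
  have hmean : ∀ t, (ω.comp (Interaction.dynamics hsum t)).HasMeanEntropy ω.meanEntropy :=
    fun t => hω.hasMeanEntropy.comp_dynamics hsum t
  refine ⟨fun t => ⟨hmean t, (hmean t).meanEntropy_eq⟩, fun u _ => ⟨?_, ?_, ?_⟩⟩
  · intro T φ h
    exact (h.isTranslationInvariant fun t => hω.comp_dynamics hsum t).hasMeanEntropy
  · intro hrev φ h hlt
    obtain ⟨φ', h', he⟩ := h.exists_bot_of_top hrev
    exact ⟨φ', h', by rwa [he]⟩
  · intro hlaw
    by_cases hrev : TimeReversalInvariant (Interaction.dynamics hsum) ω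
    · exact Or.inl (hlaw.meanEntropyConstant hrev fun t => (hmean t).meanEntropy_eq)
    · exact Or.inr hrev
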